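/- **Setting.** Let $n\ge 2$ and $N=\mathbb R^{1+n}$ with coordinates $(x^0,\dots,x^n)$; greek indices run over $0,\dots,n$ and repeated greek indices are summed. Let $\mathbf h=(h_{\alpha\beta})$ be a smooth symmetric metric tensor on $N$ for which there is $c_1>0$ with $h_{00}\le -c_1$, $\sum_{i,j\ge1}h_{ij}\xi^i\xi^j\ge c_1|\xi|^2$ and $|h_{\alpha\beta}|\le c_1^{-1}$ everywhere, and with $h_{0i}=0$ for $i\ge1$. Put $\Sigma_0=\{x^0=0\}$, $N_T=\{|x^0|<T\}$, and let $\kappa:N\to\mathbb R$ be smooth. Let $T^*>0$ and let $I\subset N_{T^*}$ be a bounded open set such that $\Gamma:=\partial I\cap N_{T^*}$ is a smooth embedded timelike hypersurface, that $I$ lies locally on only one side of $\Gamma$ (no point of $\Gamma$ is interior to $\overline I$), that the mean curvature of $\Gamma$ (the trace of $A(X,Y)=\mathbf h(\nu,\nabla_XY)$, with $\nu$ the unit normal to $\Gamma$ pointing into $I$) equals $-\kappa$, and that $\Gamma$ is orthogonal to $\Sigma_0$. Let $M$ be a smooth $(n-1)$-manifold without boundary, $M_T:=(-T,T)\times M$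 and $M_T^r:=M_T\times(-r,r)$, with points $y=(y^\tau,y^n)$, $y^\tau=(y^0,y')$, where $y'=(y^1,\dots,y^{n-1})$ denotes local coordinates on $M$. Let $\Psi:M_{T^*}\to\Gamma$ be a diffeomorphism of the form $\Psi(y^\tau)=(y^0,\psi(y^\tau))$ with $\gamma_{0a}=\gamma_{a0}=0$ for $a=1,\dots,n-1$, where $\gamma_{ab}:=\mathbf h(\partial_{y^a}\Psi,\partial_{y^b}\Psi)$ for $a,b=0,\dots,n-1$, and let $(\gamma^{ab})=(\gamma_{ab})^{-1}$. (Thus $M\cong\Gamma\cap\Sigma_0$ is compact.) **Proposition 4.1.** For every $T_0<T^*$ there exist $T\in(T_0,T^*)$ with $T>0$, $\rho>0$, and a map $\phi:M_T^{2\rho}\to N$, extending continuously to $\overline{M_T^{2\rho}}=[-T,T]\times M\times[-2\rho,2\rho]$, which is a diffeomorphism onto its (open) image $N':=\phi(M_T^{2\rho})$, such that the following hold. 1. $\phi(y^\tau,0)=\Psi(y^\tau)$ on $M_T$; $\Gamma\cap N_{T_0}=\phi(M_{T_0}\times\{0\})$; $N'$ is an open neighbourhood of $\Gamma\cap N_{T_0}$;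 and if $y\in\overline{M_T^{2\rho}}$ with $|y^0|=T$, then $|x^0|>T_0$ for $x=\phi(y)$. 2. $\phi(y)\in\Sigma_0$ for every $y\in M_T^{2\rho}$ with $y^0=0$. 3. Let $g_{\alpha\beta}:=\mathbf h(\partial_{y^\alpha}\phi,\partial_{y^\beta}\phi)$, $(g^{\alpha\beta}):=(g_{\alpha\beta})^{-1}$, $g:=\det(g_{\alpha\beta})$ in local coordinates. Then, in block form (indices $0,\dots,n-1$, and $n$), where $O$ of a block matrix is meant blockwise, $$(g_{\alpha\beta})(y^\tau,y^n)=\begin{pmatrix}(\gamma_{ab})(y^\tau)&0\\0&1\end{pmatrix}+O\begin{pmatrix}|y^n|&|y^n|\\|y^n|&(y^n)^2\end{pmatrix},$$ $$(g^{\alpha\beta})(y^\tau,y^n)=\begin{pmatrix}(\gamma^{ab})(y^\tau)&0\\0&1\end{pmatrix}+O\begin{pmatrix}|y^n|&|y^n|\\|y^n|&(y^n)^2\end{pmatrix},$$ $$(\partial_{y^0}g^{\alpha\beta})(y^\tau,y^n)=O\begin{pmatrix}1&|y^n|\\|y^n|&(y^n)^2\end{pmatrix}.$$ 4. There is a unique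 smooth function $d_\Gamma:N'\to\mathbb R$ with $d_\Gamma=0$ on $\Gamma\cap N'$, $h^{\alpha\beta}\,\partial_{x^\alpha}d_\Gamma\,\partial_{x^\beta}d_\Gamma=1$ on $N'$, and $d_\Gamma>0$ in $I\cap N'$, where $(h^{\alpha\beta})=(h_{\alpha\beta})^{-1}$. Moreover, with $\pi^n(y^0,\dots,y^n)=y^n$, $$\pi^n\circ\phi^{-1}=d_\Gamma+O(d_\Gamma^2)\quad\text{on }N'.$$ 5. $$\frac{-1}{\sqrt{-g}}\,g^{n\alpha}\,\partial_{y^\alpha}\sqrt{-g}=\frac{-1}{\sqrt{-g}}\,\partial_{y^n}\sqrt{-g}+O(|y^n|)=-\kappa(\Psi(y^\tau))+O(|y^n|).$$ In 3 and 5, for every local coordinate chart of $M$ and every compact subset $K$ of its domain, the implied constants are uniform over all $|y^0|<T$, all $y'$ representing points of $K$, and all $|y^n|<2\rho$. In 4 the implied constant is uniform on $N'$. -/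

import Mathlib

open Set Filter Topology
open scoped Manifold ContDiff Matrix

noncomputable section

namespace Tubular

/-! ### Calculus in coordinates -/

/-- The coordinate partial derivative `∂f/∂y^a` at `y`. -/
def pd {k : ℕ} {F : Type*} [NormedAddCommGroup F] [NormedSpace ℝ F]
    (f : (Fin k → ℝ) → F) (a : Fin k) (y : Fin k → ℝ) : F :=
  fderiv ℝ f y (Pi.single a 1)

/-- The inner product `h_{αβ}(x) v^α w^β` at the point `x`. -/
def ip {k : ℕ} (h : (Fin k → ℝ) → Matrix (Fin k) (Fin k) ℝ) (x v w : Fin k → ℝ) : ℝ :=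
  v ⬝ᵥ (h x *ᵥ w)

/-- The pullback tensor `h(∂f/∂y^a, ∂f/∂y^b)` at `y`, as a matrix. -/
def pullback {k l : ℕ} (h : (Fin l → ℝ) → Matrix (Fin l) (Fin l) ℝ)
    (f : (Fin k → ℝ) → (Fin l → ℝ)) (y : Fin k → ℝ) : Matrix (Fin k) (Fin k) ℝ :=
  Matrix.of fun a b => ip h (f y) (pd f a y) (pd f b y)

/-- The Christoffel symbols `Γ^α_{μν}` of the metric `h`. -/
def christoffel {k : ℕ} (h : (Fin k → ℝ) → Matrix (Fin k) (Fin k) ℝ)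
    (α μ ν : Fin k) (x : Fin k → ℝ) : ℝ :=
  (1 / 2) * ∑ β, (h x)⁻¹ α β *
    (pd (fun z => h z β ν) μ x + pd (fun z => h z μ β) ν x - pd (fun z => h z ν μ) β x)

/-- The covariant derivative `∇_{∂_a f} ∂_b f` along the map `f`. -/
def covDeriv {k l : ℕ} (h : (Fin l → ℝ) → Matrix (Fin l) (Fin l) ℝ)
    (f : (Fin k → ℝ) → (Fin l → ℝ)) (a b : Fin k) (y : Fin k → ℝ) : Fin l → ℝ := fun α =>
  pd (fun z => pd f b z α) a y +
    ∑ μ, ∑ ν, christoffel h α μ ν (f y) * pd f a y μ * pd f b y ν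

/-- The mean curvature of the parametrized hypersurface `f` with respect to the normal `ν`: the
trace of the second fundamental form `A(X, Y) = h(ν, ∇_X Y)` for the induced metric. -/
def meanCurvature {k l : ℕ} (h : (Fin l → ℝ) → Matrix (Fin l) (Fin l) ℝ)
    (f : (Fin k → ℝ) → (Fin l → ℝ)) (ν : Fin l → ℝ) (y : Fin k → ℝ) : ℝ :=
  ∑ a, ∑ b, (pullback h f y)⁻¹ a b * ip h (f y) ν (covDeriv h f a b y)

/-! ### The spacetime `N = ℝ^{1+n}`, `n = m + 1`, with coordinates `x^0, …, x^n` -/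

/-- The standing assumptions on the Lorentzian metric `h`. -/
structure IsAdmissibleMetric {m : ℕ}
    (h : (Fin (m + 2) → ℝ) → Matrix (Fin (m + 2)) (Fin (m + 2)) ℝ) : Prop where
  smooth : ∀ α β, ContDiff ℝ ∞ fun x => h x α β
  symm : ∀ x, (h x).IsSymm
  bounds : ∃ c : ℝ, 0 < c ∧ ∀ x, h x 0 0 ≤ -c ∧
    (∀ ξ : Fin (m + 1) → ℝ,
      c * ∑ i, ξ i ^ 2 ≤ ∑ i, ∑ j, h x i.succ j.succ * ξ i * ξ j) ∧
    ∀ α β, |h x α β| ≤ c⁻¹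
  time_space : ∀ x (i : Fin (m + 1)), h x 0 i.succ = 0

/-- The slab `N_T = {|x^0| < T}`. -/
def slab (m : ℕ) (T : ℝ) : Set (Fin (m + 2) → ℝ) := {x | |x 0| < T}

/-- The hypersurface `Γ = ∂I ∩ N_T`. -/
def lateralBoundary {m : ℕ} (I : Set (Fin (m + 2) → ℝ)) (T : ℝ) : Set (Fin (m + 2) → ℝ) :=
  frontier I ∩ slab m T

/-! ### Local coordinates on `M_T = (-T, T) × M` and on `M_T × (-r, r)` -/

section Coordinates

variable {m : ℕ} {M : Type*} [TopologicalSpace M]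

/-- The point of `ℝ × M` with standard local coordinates `(y^0, y^1, …, y^m)`, where
`(y^1, …, y^m)` are the coordinates of the chart `e` of `M`. -/
def tanPoint (e : OpenPartialHomeomorph M (EuclideanSpace ℝ (Fin m)))
    (y : Fin (m + 1) → ℝ) : ℝ × M :=
  (y 0, e.symm (WithLp.toLp 2 (Fin.tail y)))

/-- The point of `(ℝ × M) × ℝ` with standard local coordinates `(y^0, y^1, …, y^m, y^n)`,
`n = m + 1`. -/
def tubePoint (e : OpenPartialHomeomorph M (EuclideanSpace ℝ (Fin m)))
    (y : Fin (m + 2) → ℝ) : (ℝ × M) × ℝ :=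
  (tanPoint e (Fin.init y), y (Fin.last (m + 1)))

/-- The coordinates `(y^0, y')` with `|y^0| < T` and `y'` in the range of the chart `e`. -/
def tanDomain (e : OpenPartialHomeomorph M (EuclideanSpace ℝ (Fin m))) (T : ℝ) :
    Set (Fin (m + 1) → ℝ) :=
  {y | |y 0| < T ∧ WithLp.toLp 2 (Fin.tail y) ∈ e.target}

/-- The coordinates `(y^0, y', y^n)` with `|y^0| < T`, `|y^n| < r`, and `y'` the coordinates in the
chart `e` of a point of `K`. -/
def tubeDomain (e : OpenPartialHomeomorph M (EuclideanSpace ℝ (Fin m))) (K : Set M) (T r : ℝ) :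
    Set (Fin (m + 2) → ℝ) :=
  {y | |y 0| < T ∧ WithLp.toLp 2 (Fin.tail (Fin.init y)) ∈ e '' K ∧ |y (Fin.last (m + 1))| < r}

variable (M) in
/-- `M_T = (-T, T) × M`. -/
def cylinder (T : ℝ) : Set (ℝ × M) := Ioo (-T) T ×ˢ univ

variable (M) in
/-- `M_T^r = M_T × (-r, r)`. -/
def tube (T r : ℝ) : Set ((ℝ × M) × ℝ) := cylinder M T ×ˢ Ioo (-r) r

variable (M) in
/-- The closure `[-T, T] × M × [-r, r]` of `M_T^r` (for `T, r > 0`). -/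
def closedTube (T r : ℝ) : Set ((ℝ × M) × ℝ) := (Icc (-T) T ×ˢ univ) ×ˢ Icc (-r) r

variable [ChartedSpace (EuclideanSpace ℝ (Fin m)) M]

/-- `Ψ` is a parametrization of the smooth embedded hypersurface `S` by `M_T`, of the form
`Ψ(y^0, y') = (y^0, ψ(y^0, y'))` and with `γ_{0a} = γ_{a0} = 0` for `a ≥ 1`. -/
structure IsAdaptedParametrization
    (h : (Fin (m + 2) → ℝ) → Matrix (Fin (m + 2)) (Fin (m + 2)) ℝ) (T : ℝ)
    (S : Set (Fin (m + 2) → ℝ)) (Ψ : ℝ × M → (Fin (m + 2) → ℝ)) : Prop where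
  smooth : ContMDiffOn (𝓘(ℝ, ℝ).prod (𝓡 m)) 𝓘(ℝ, Fin (m + 2) → ℝ) ∞ Ψ (cylinder M T)
  image_eq : Ψ '' cylinder M T = S
  embedding : IsEmbedding ((cylinder M T).domRestrict Ψ)
  immersion : ∀ e ∈ IsManifold.maximalAtlas (𝓡 m) ∞ M, ∀ y ∈ tanDomain e T,
    LinearIndependent ℝ fun a => pd (Ψ ∘ tanPoint e) a y
  time_eq : ∀ p ∈ cylinder M T, Ψ p 0 = p.1
  gamma_zero : ∀ e ∈ IsManifold.maximalAtlas (𝓡 m) ∞ M, ∀ y ∈ tanDomain e T, ∀ a : Fin m,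
    pullback h (Ψ ∘ tanPoint e) y 0 a.succ = 0 ∧ pullback h (Ψ ∘ tanPoint e) y a.succ 0 = 0

/-- The hypersurface parametrized by `Ψ` is timelike: each tangent space contains a timelike
vector. -/
def IsTimelike (h : (Fin (m + 2) → ℝ) → Matrix (Fin (m + 2)) (Fin (m + 2)) ℝ) (T : ℝ)
    (Ψ : ℝ × M → (Fin (m + 2) → ℝ)) : Prop :=
  ∀ e ∈ IsManifold.maximalAtlas (𝓡 m) ∞ M, ∀ y ∈ tanDomain e T,
    ∃ v ∈ Submodule.span ℝ (range fun a => pd (Ψ ∘ tanPoint e) a y),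
      ip h (Ψ (tanPoint e y)) v v < 0

/-- The hypersurface parametrized by `Ψ` is orthogonal to `Σ_0 = {x^0 = 0}`: at common points, the
normal vectors of the two hypersurfaces are orthogonal. -/
def IsOrthogonalToInitial (h : (Fin (m + 2) → ℝ) → Matrix (Fin (m + 2)) (Fin (m + 2)) ℝ) (T : ℝ)
    (Ψ : ℝ × M → (Fin (m + 2) → ℝ)) : Prop :=
  ∀ e ∈ IsManifold.maximalAtlas (𝓡 m) ∞ M, ∀ y ∈ tanDomain e T, y 0 = 0 →
    ∀ ν μ : Fin (m + 2) → ℝ,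
      (∀ a, ip h (Ψ (tanPoint e y)) ν (pd (Ψ ∘ tanPoint e) a y) = 0) →
      (∀ w : Fin (m + 2) → ℝ, w 0 = 0 → ip h (Ψ (tanPoint e y)) μ w = 0) →
      ip h (Ψ (tanPoint e y)) ν μ = 0

/-- `ν` is the unit normal at `f y` to the hypersurface parametrized by `f`, pointing into `I`. -/
def IsInwardNormal {k l : ℕ} (h : (Fin l → ℝ) → Matrix (Fin l) (Fin l) ℝ)
    (I : Set (Fin l → ℝ)) (f : (Fin k → ℝ) → (Fin l → ℝ)) (y : Fin k → ℝ)
    (ν : Fin l → ℝ) : Prop :=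
  ip h (f y) ν ν = 1 ∧ (∀ a, ip h (f y) ν (pd f a y) = 0) ∧ ∀ᶠ s : ℝ in 𝓝[>] 0, f y + s • ν ∈ I

/-- The mean curvature of the hypersurface parametrized by `Ψ`, with respect to the unit normal
pointing into `I`, equals `-κ`. -/
def HasPrescribedMeanCurvature
    (h : (Fin (m + 2) → ℝ) → Matrix (Fin (m + 2)) (Fin (m + 2)) ℝ) (κ : (Fin (m + 2) → ℝ) → ℝ)
    (T : ℝ) (I : Set (Fin (m + 2) → ℝ)) (Ψ : ℝ × M → (Fin (m + 2) → ℝ)) : Prop :=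
  ∀ e ∈ IsManifold.maximalAtlas (𝓡 m) ∞ M, ∀ y ∈ tanDomain e T, ∀ ν : Fin (m + 2) → ℝ,
    IsInwardNormal h I (Ψ ∘ tanPoint e) y ν →
      -κ (Ψ (tanPoint e y)) = meanCurvature h (Ψ ∘ tanPoint e) ν y

/-- `φ` restricts to a (smooth) diffeomorphism of `U` onto the open set `φ(U)`. (A map defined on all
of `ℝ^{1+n}` that restricts to the inverse exists only for nonempty `U`.) -/
def IsDiffeoOntoImage (φ : (ℝ × M) × ℝ → (Fin (m + 2) → ℝ)) (U : Set ((ℝ × M) × ℝ)) : Prop :=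
  IsOpen (φ '' U) ∧ InjOn φ U ∧
  ContMDiffOn ((𝓘(ℝ, ℝ).prod (𝓡 m)).prod 𝓘(ℝ, ℝ)) 𝓘(ℝ, Fin (m + 2) → ℝ) ∞ φ U ∧
  (U.Nonempty → ∃ φinv : (Fin (m + 2) → ℝ) → (ℝ × M) × ℝ, LeftInvOn φinv φ U ∧
    ContMDiffOn 𝓘(ℝ, Fin (m + 2) → ℝ) ((𝓘(ℝ, ℝ).prod (𝓡 m)).prod 𝓘(ℝ, ℝ)) ∞ φinv (φ '' U))

end Coordinates

/-! ### The objects in the conclusion -/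

/-- The block matrix with blocks `A, 0, 0, 1`. -/
def blockOne {k : ℕ} (A : Matrix (Fin k) (Fin k) ℝ) : Matrix (Fin (k + 1)) (Fin (k + 1)) ℝ :=
  fun α β =>
    Fin.lastCases (motive := fun _ => ℝ)
      (Fin.lastCases (motive := fun _ => ℝ) 1 (fun _ => 0) β)
      (fun a => Fin.lastCases (motive := fun _ => ℝ) 0 (fun b => A a b) β) α

/-- The blocks of `E` are bounded entrywise by `p` (tangential), `q` (mixed), `r` (normal). -/
def BlockBound {k : ℕ} (E : Matrix (Fin (k + 1)) (Fin (k + 1)) ℝ) (p q r : ℝ) : Prop :=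
  (∀ a b : Fin k, |E a.castSucc b.castSucc| ≤ p) ∧
  (∀ a : Fin k, |E a.castSucc (Fin.last k)| ≤ q ∧ |E (Fin.last k) a.castSucc| ≤ q) ∧
  |E (Fin.last k) (Fin.last k)| ≤ r

/-- `d` is a smooth solution on the open set `U` of the eikonal equation `h^{αβ} ∂_α d ∂_β d = 1`,
vanishing on `S` and positive in `I`. -/
structure IsEikonalSolution {l : ℕ} (h : (Fin l → ℝ) → Matrix (Fin l) (Fin l) ℝ)
    (S I U : Set (Fin l → ℝ)) (d : (Fin l → ℝ) → ℝ) : Prop where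
  smooth : ContDiffOn ℝ ∞ d U
  zero : ∀ x ∈ S ∩ U, d x = 0
  eikonal : ∀ x ∈ U, ∑ α, ∑ β, (h x)⁻¹ α β * pd d α x * pd d β x = 1
  pos : ∀ x ∈ I ∩ U, 0 < d x

/-- `√(-g)`, with `g = det (g_{αβ})` the determinant of the pullback metric of `f`. -/
def sqrtNegDet {k : ℕ} (h : (Fin k → ℝ) → Matrix (Fin k) (Fin k) ℝ)
    (f : (Fin k → ℝ) → (Fin k → ℝ)) (y : Fin k → ℝ) : ℝ :=
  Real.sqrt (-(pullback h f y).det)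

/-- `(-1/√(-g)) g^{nα} ∂_α √(-g)`, summed over `α = 0, …, n`. -/
def normalDivergence {k : ℕ} (h : (Fin (k + 1) → ℝ) → Matrix (Fin (k + 1)) (Fin (k + 1)) ℝ)
    (f : (Fin (k + 1) → ℝ) → (Fin (k + 1) → ℝ)) (y : Fin (k + 1) → ℝ) : ℝ :=
  -1 / sqrtNegDet h f y *
    ∑ α, (pullback h f y)⁻¹ (Fin.last k) α * pd (sqrtNegDet h f) α y

/-- The estimates for the metric in the local coordinates `f` of the tube, where `F` is the
parametrization of the hypersurface `{y^n = 0}` in the same coordinates, at the point `y` and with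
the constant `C`. -/
structure MetricEstimates {k : ℕ} (h : (Fin (k + 2) → ℝ) → Matrix (Fin (k + 2)) (Fin (k + 2)) ℝ)
    (κ : (Fin (k + 2) → ℝ) → ℝ) (F : (Fin (k + 1) → ℝ) → (Fin (k + 2) → ℝ))
    (f : (Fin (k + 2) → ℝ) → (Fin (k + 2) → ℝ)) (C : ℝ) (y : Fin (k + 2) → ℝ) : Prop where
  metric : BlockBound (pullback h f y - blockOne (pullback h F (Fin.init y)))
    (C * |y (Fin.last (k + 1))|) (C * |y (Fin.last (k + 1))|) (C * y (Fin.last (k + 1)) ^ 2)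
  inverse : BlockBound ((pullback h f y)⁻¹ - blockOne ((pullback h F (Fin.init y))⁻¹))
    (C * |y (Fin.last (k + 1))|) (C * |y (Fin.last (k + 1))|) (C * y (Fin.last (k + 1)) ^ 2)
  time_deriv_inverse : BlockBound (Matrix.of fun α β => pd (fun z => (pullback h f z)⁻¹ α β) 0 y)
    C (C * |y (Fin.last (k + 1))|) (C * y (Fin.last (k + 1)) ^ 2)
  divergence_normal :
    |normalDivergence h f y -
        -1 / sqrtNegDet h f y * pd (sqrtNegDet h f) (Fin.last (k + 1)) y| ≤
      C * |y (Fin.last (k + 1))|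
  divergence_curvature :
    |normalDivergence h f y - -κ (F (Fin.init y))| ≤ C * |y (Fin.last (k + 1))|

end Tubular

end

open Tubular

/-! Let ν be the inward unit normal of Γ, and let E(z, t) be the geodesic with initial point Ψ(z)
and initial velocity ν(z), obtained together with its momentum P from the Hamiltonian flow of h^{αβ}
p_α p_β / 2. On a short tube t is the signed distance: by `gauss_lemma` the momentum is conormal to
the parallel hypersurfaces, so P is the differential of t (`IsNormalFlow.differential_eq`) and t
solves the eikonal equation.

In general E does not map {y^0 = 0} into Σ_0, so its starting points are moved in time. For small s
there is k(y', s) with E((k, y'), s) in Σ_0 (`IsNormalFlow.exists_time_shift`). Since Γ is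
orthogonal to Σ_0, the normal ν is tangent to Σ_0 along their intersection, and therefore k vanishes
to second order at s = 0. The map of the theorem is φ = E ∘ σ with σ(y^0, y', s) = (y^0 + χ(y^0)
k(y', s), y', s), where the cutoff χ is 1 at 0 and vanishes for |y^0| ≥ T/2. On {y^n = 0} the shift
changes neither E nor its normal derivative, so φ = Ψ and ∂_n φ = ν there. It does not touch y^n, so
d_Γ ∘ φ = y^n exactly.

The estimates are Taylor expansions in y^n, uniform on compact sets
(`IsNormalTubeChart.exists_metricEstimates`). On {y^n = 0} the metric is block diagonal. With w =
∂_n φ - grad d_Γ one has g_nn = 1 + h(w, w), and w vanishes on {y^n = 0}; hence g_nn - 1 is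
quadratic (`pd_pullback_last_last_eq_zero`), and so is g^nn - 1, by differentiating g⁻¹ g = 1. The
curvature identity combines Jacobi's formula with the first variation ∂_n g_ab = -2 A_ab
(`IsNormalTubeChart.pd_pullback_last`).

For uniqueness, the gradient of any solution on Γ is a unit normal, and positivity in I makes it the
inward one. By the method of characteristics (`eikonal_characteristic`) the solution then grows at
unit speed along the geodesics, so its value at E(z, t) is t.

The supporting facts are smooth dependence of the flow on its data, by the inverse function theorem
in C([0, 1], E); a tube of uniform width, from compactness of M; and the fact that exactly one side
of Γ lies in I, which rests on Γ being embedded. -/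

noncomputable section

set_option linter.unusedSectionVars false

namespace Tubular

/-! ### Partial derivatives -/

section PartialDerivatives

variable {k : ℕ} {F : Type*} [NormedAddCommGroup F] [NormedSpace ℝ F]

lemma contDiffOn_pd {f : (Fin k → ℝ) → F} {U : Set (Fin k → ℝ)} (hU : IsOpen U)
    (hf : ContDiffOn ℝ ∞ f U) (a : Fin k) : ContDiffOn ℝ ∞ (pd f a) U :=
  (hf.fderiv_of_isOpen hU (by simp)).clm_apply contDiffOn_const

lemma pd_apply {l : ℕ} {f : (Fin k → ℝ) → (Fin l → ℝ)} {y : Fin k → ℝ}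
    (hf : DifferentiableAt ℝ f y) (a : Fin k) (α : Fin l) :
    pd (fun z => f z α) a y = pd f a y α := by
  unfold pd
  rw [fderiv_apply hf]
  rfl

lemma fderiv_eq_sum_pd {f : (Fin k → ℝ) → F} {y : Fin k → ℝ} (v : Fin k → ℝ) :
    fderiv ℝ f y v = ∑ a, v a • pd f a y := by
  conv_lhs => rw [← Finset.univ_sum_single v, map_sum]
  refine Finset.sum_congr rfl fun a _ => ?_
  unfold pd
  rw [← map_smul]
  congr 1
  rw [← Pi.single_smul, smul_eq_mul, mul_one]

lemma pd_congr {f g : (Fin k → ℝ) → F} {y : Fin k → ℝ} (h : f =ᶠ[𝓝 y] g) (a : Fin k) :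
    pd f a y = pd g a y := by
  unfold pd; rw [h.fderiv_eq]

lemma hasDerivAt_update {f : (Fin k → ℝ) → F} {y : Fin k → ℝ} {a : Fin k} {t : ℝ}
    (hf : DifferentiableAt ℝ f (Function.update y a t)) :
    HasDerivAt (fun s => f (Function.update y a s)) (pd f a (Function.update y a t)) t :=
  hf.hasFDerivAt.comp_hasDerivAt t (_root_.hasDerivAt_update y a t)

/-- Symmetry of second partial derivatives. -/
lemma pd_comm {f : (Fin k → ℝ) → F} {U : Set (Fin k → ℝ)} (hU : IsOpen U)
    (hf : ContDiffOn ℝ ∞ f U) {y : Fin k → ℝ} (hy : y ∈ U) (a b : Fin k) :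
    pd (pd f a) b y = pd (pd f b) a y := by
  have hfy : ContDiffAt ℝ ∞ f y := hf.contDiffAt (hU.mem_nhds hy)
  have hsymm := hfy.isSymmSndFDerivAt (by simp; norm_cast)
  have hd : DifferentiableAt ℝ (fderiv ℝ f) y :=
    (hfy.fderiv_right (m := 1) (by norm_cast)).differentiableAt (by simp)
  have key : ∀ a b, pd (pd f a) b y = fderiv ℝ (fderiv ℝ f) y (Pi.single b 1) (Pi.single a 1) := by
    intro a b
    unfold pd
    rw [fderiv_clm_apply hd (differentiableAt_const _)]
    simp
  rw [key, key, hsymm]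

end PartialDerivatives

/-! ### Smoothness of matrix operations -/

section MatrixSmooth

variable {E : Type*} [NormedAddCommGroup E] [NormedSpace ℝ E] {ι : Type*} [Fintype ι]
  [DecidableEq ι] {A : E → Matrix ι ι ℝ} {U : Set E} {n : WithTop ℕ∞}

lemma contDiffOn_det (hA : ∀ i j, ContDiffOn ℝ n (fun x => A x i j) U) :
    ContDiffOn ℝ n (fun x => (A x).det) U := by
  simp only [Matrix.det_apply]
  exact ContDiffOn.sum fun σ _ => (contDiffOn_prod fun i _ => hA (σ i) i).const_smul _

/-- By Cramer's rule an entry of the inverse is a determinant in the entries of `A` divided by `det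
A`. -/
lemma contDiffOn_inv_apply (hA : ∀ i j, ContDiffOn ℝ n (fun x => A x i j) U)
    (hdet : ∀ x ∈ U, (A x).det ≠ 0) (i j : ι) : ContDiffOn ℝ n (fun x => (A x)⁻¹ i j) U := by
  have : (fun x => (A x)⁻¹ i j) =
      fun x => ((A x).det)⁻¹ * ((A x).updateRow j (Pi.single i 1)).det := by
    ext x
    rw [Matrix.inv_def, Matrix.smul_apply, Ring.inverse_eq_inv', Matrix.adjugate_apply, smul_eq_mul]
  rw [this]
  refine ((contDiffOn_det hA).inv hdet).mul (contDiffOn_det fun a b => ?_)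
  simp only [Matrix.updateRow_apply]
  split_ifs
  · exact contDiffOn_const
  · exact hA a b

/-- Jacobi's formula. -/
lemma hasDerivAt_det {A : ℝ → Matrix ι ι ℝ} {A' : Matrix ι ι ℝ} {t : ℝ}
    (hA : ∀ i j, HasDerivAt (fun s => A s i j) (A' i j) t) (hdet : (A t).det ≠ 0) :
    HasDerivAt (fun s => (A s).det) ((A t).det * ((A t)⁻¹ * A').trace) t := by
  have hdiff : Differentiable ℝ fun B : ι → ι → ℝ => (Matrix.of B).det := by
    have h : ContDiffOn ℝ 1 (fun B : ι → ι → ℝ => (Matrix.of B).det) univ :=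
      contDiffOn_det fun i j => by
        simp only [Matrix.of_apply]; fun_prop
    exact (contDiffOn_univ.1 h).differentiable one_ne_zero
  have hu : IsUnit (A t).det := isUnit_iff_ne_zero.2 hdet
  obtain ⟨B, hB⟩ : ∃ B : ι → ι → ℝ, Matrix.of B = A t := ⟨_, rfl⟩
  obtain ⟨B', hB'⟩ : ∃ B' : ι → ι → ℝ, Matrix.of B' = A' := ⟨_, rfl⟩
  -- Along the straight line with the same velocity the derivative can be read off from det (1 + r
  -- X) = 1 + r tr X + O(r²). The chain rule then carries it over to the given curve.
  have hline : HasDerivAt (fun r : ℝ => (Matrix.of (B + r • B')).det)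
      ((A t).det * ((A t)⁻¹ * A').trace) 0 := by
    have hfac : ∀ r : ℝ, (Matrix.of (B + r • B')).det =
        (A t).det * (1 + r • ((A t)⁻¹ * A')).det := fun r => by
      rw [← Matrix.det_mul]
      congr 1
      rw [mul_add, mul_one, Matrix.mul_smul, Matrix.mul_nonsing_inv_cancel_left _ _ hu, ← hB, ← hB']
      rfl
    refine HasDerivAt.congr_of_eventuallyEq ?_ (Eventually.of_forall fun r =>
      (hfac r).trans (congrArg _ (Matrix.det_one_add_smul r _)))
    set q := ((1 + (Polynomial.X : Polynomial ℝ) • ((A t)⁻¹ * A').map Polynomial.C :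
      Matrix ι ι (Polynomial ℝ)).det.divX.divX) with hq
    have h1 : HasDerivAt (fun r : ℝ => 1 + ((A t)⁻¹ * A').trace * r + q.eval r * r ^ 2)
        (((A t)⁻¹ * A').trace * 1 + (q.derivative.eval 0 * 0 ^ 2 + q.eval 0 * (2 * 0 ^ 1 * 1))) 0 :=
      (((hasDerivAt_id (0 : ℝ)).const_mul _).const_add 1).add
        ((q.hasDerivAt 0).mul (by simpa using hasDerivAt_pow 2 (0 : ℝ)))
    simpa using h1.const_mul (A t).det
  have hF := (hdiff B).hasFDerivAt
  have hpath : HasDerivAt (fun s => (fun i j => A s i j : ι → ι → ℝ)) B' t :=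
    hasDerivAt_pi.2 fun i => hasDerivAt_pi.2 fun j => by
      rw [show B' i j = A' i j by rw [← hB']; rfl]; exact hA i j
  have hpath' : HasDerivAt (fun r : ℝ => B + r • B') B' 0 := by
    simpa using ((hasDerivAt_id (0 : ℝ)).smul_const B').const_add B
  have h2 := HasFDerivAt.comp_hasDerivAt (f := fun s => (fun i j => A s i j : ι → ι → ℝ)) t
    (by rw [show (fun i j => A t i j) = B by rw [← hB]; rfl]; exact hF) hpath
  have h3 := HasFDerivAt.comp_hasDerivAt (f := fun r : ℝ => B + r • B') 0
    (by rw [zero_smul, add_zero]; exact hF) hpath'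
  rw [← HasDerivAt.unique h3 hline]
  exact h2

end MatrixSmooth

/-! ### Taylor estimates in the last coordinate -/

section Taylor

variable {k : ℕ} {O K : Set (Fin (k + 1) → ℝ)} {f : (Fin (k + 1) → ℝ) → ℝ}

/-- Mean value inequality along the segment that scales the last coordinate by θ in [0, 1]. The case
C = 0 is also used, for functions that are constant in the last coordinate. -/
lemma abs_le_mul_pow_of_pd (hO : IsOpen O) (hKO : K ⊆ O)
    (hstar : ∀ y ∈ K, ∀ θ ∈ Icc (0 : ℝ) 1,
      Function.update y (Fin.last k) (θ * y (Fin.last k)) ∈ K)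
    (hf : DifferentiableOn ℝ f O) (h0 : ∀ y ∈ O, y (Fin.last k) = 0 → f y = 0) {C : ℝ} {j : ℕ}
    (hC : 0 ≤ C) (hpd : ∀ y ∈ K, |pd f (Fin.last k) y| ≤ C * |y (Fin.last k)| ^ j) :
    ∀ y ∈ K, |f y| ≤ C * |y (Fin.last k)| ^ (j + 1) := by
  intro y hy
  set s := y (Fin.last k) with hs
  have hder : ∀ θ ∈ Icc (0 : ℝ) 1, HasDerivAt (fun θ => f (Function.update y (Fin.last k) (θ * s)))
      (s • pd f (Fin.last k) (Function.update y (Fin.last k) (θ * s))) θ := fun θ hθ =>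
    HasDerivAt.scomp (g₁ := fun t => f (Function.update y (Fin.last k) t)) (h := fun θ => θ * s) θ
      (hasDerivAt_update ((hf _ (hKO (hstar y hy θ hθ))).differentiableAt
        (hO.mem_nhds (hKO (hstar y hy θ hθ))))) (by simpa using (hasDerivAt_id θ).mul_const s)
  have key := (convex_Icc (0 : ℝ) 1).norm_image_sub_le_of_norm_hasDerivWithin_le
    (C := C * |s| ^ (j + 1)) (fun θ hθ => (hder θ hθ).hasDerivWithinAt)
    (fun θ hθ => by
      rw [norm_smul, Real.norm_eq_abs, Real.norm_eq_abs]
      have h := hpd _ (hstar y hy θ hθ)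
      rw [Function.update_self, abs_mul, abs_of_nonneg hθ.1] at h
      have h2 : (θ * |s|) ^ j ≤ |s| ^ j :=
        pow_le_pow_left₀ (mul_nonneg hθ.1 (abs_nonneg s))
          (mul_le_of_le_one_left (abs_nonneg s) hθ.2) j
      calc |s| * _ ≤ |s| * (C * |s| ^ j) := by gcongr; exact h.trans (by gcongr)
        _ = C * |s| ^ (j + 1) := by ring)
    (left_mem_Icc.2 zero_le_one) (right_mem_Icc.2 zero_le_one)
  have hz : f (Function.update y (Fin.last k) (0 * s)) = 0 :=
    h0 _ (hKO (hstar y hy 0 (left_mem_Icc.2 zero_le_one))) (by simp)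
  rw [hz, one_mul, hs, Function.update_eq_self] at key
  simpa [Real.norm_eq_abs] using key

lemma exists_abs_le (hK : IsCompact K) (hKO : K ⊆ O)
    (hf : ContDiffOn ℝ ∞ f O) : ∃ C, 0 ≤ C ∧ ∀ y ∈ K, |f y| ≤ C := by
  obtain ⟨C, hC⟩ := hK.exists_bound_of_continuousOn (hf.continuousOn.mono hKO)
  exact ⟨max C 0, le_max_right _ _, fun y hy => (hC y hy).trans (le_max_left _ _)⟩

lemma exists_abs_le_mul_abs (hO : IsOpen O) (hK : IsCompact K) (hKO : K ⊆ O)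
    (hstar : ∀ y ∈ K, ∀ θ ∈ Icc (0 : ℝ) 1,
      Function.update y (Fin.last k) (θ * y (Fin.last k)) ∈ K)
    (hf : ContDiffOn ℝ ∞ f O) (h0 : ∀ y ∈ O, y (Fin.last k) = 0 → f y = 0) :
    ∃ C, 0 ≤ C ∧ ∀ y ∈ K, |f y| ≤ C * |y (Fin.last k)| := by
  obtain ⟨C, hC, hb⟩ := exists_abs_le hK hKO (contDiffOn_pd hO hf (Fin.last k))
  refine ⟨C, hC, fun y hy => ?_⟩
  simpa using abs_le_mul_pow_of_pd hO hKO hstar (hf.differentiableOn (by simp)) h0 (j := 0) hC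
    (by simpa using hb) y hy

lemma exists_abs_le_mul_sq (hO : IsOpen O) (hK : IsCompact K) (hKO : K ⊆ O)
    (hstar : ∀ y ∈ K, ∀ θ ∈ Icc (0 : ℝ) 1,
      Function.update y (Fin.last k) (θ * y (Fin.last k)) ∈ K)
    (hf : ContDiffOn ℝ ∞ f O) (h0 : ∀ y ∈ O, y (Fin.last k) = 0 → f y = 0)
    (h1 : ∀ y ∈ O, y (Fin.last k) = 0 → pd f (Fin.last k) y = 0) :
    ∃ C, 0 ≤ C ∧ ∀ y ∈ K, |f y| ≤ C * y (Fin.last k) ^ 2 := by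
  obtain ⟨C, hC, hb⟩ :=
    exists_abs_le_mul_abs hO hK hKO hstar (contDiffOn_pd hO hf (Fin.last k)) h1
  refine ⟨C, hC, fun y hy => ?_⟩
  simpa using abs_le_mul_pow_of_pd hO hKO hstar (hf.differentiableOn (by simp)) h0 (j := 1) hC
    (by simpa using hb) y hy

end Taylor

/-! ### The bilinear form of a metric and its derivatives -/

section Form

variable {k l : ℕ} {h : (Fin k → ℝ) → Matrix (Fin k) (Fin k) ℝ} {x : Fin k → ℝ}

lemma ip_eq_sum (h : (Fin k → ℝ) → Matrix (Fin k) (Fin k) ℝ) (x v w : Fin k → ℝ) :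
    ip h x v w = ∑ α, ∑ β, h x α β * v α * w β := by
  simp only [ip, dotProduct, Matrix.mulVec, Finset.mul_sum]
  exact Finset.sum_congr rfl fun α _ => Finset.sum_congr rfl fun β _ => by ring

lemma ip_comm (hs : (h x).IsSymm) (v w : Fin k → ℝ) : ip h x v w = ip h x w v := by
  unfold ip
  rw [Matrix.dotProduct_mulVec, ← Matrix.mulVec_transpose, hs.eq, dotProduct_comm]

lemma ip_add_right (u v w : Fin k → ℝ) : ip h x u (v + w) = ip h x u v + ip h x u w := by
  simp [ip, Matrix.mulVec_add]

lemma ip_smul_right (c : ℝ) (u v : Fin k → ℝ) : ip h x u (c • v) = c * ip h x u v := by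
  simp [ip, Matrix.mulVec_smul]

lemma ip_add_left (u v w : Fin k → ℝ) : ip h x (u + v) w = ip h x u w + ip h x v w := by
  simp [ip]

lemma ip_smul_left (c : ℝ) (u v : Fin k → ℝ) : ip h x (c • u) v = c * ip h x u v := by
  simp [ip]

lemma ip_neg_left (u v : Fin k → ℝ) : ip h x (-u) v = -ip h x u v := by
  simp [ip]

lemma ip_neg_right (u v : Fin k → ℝ) : ip h x u (-v) = -ip h x u v := by
  simp [ip, Matrix.mulVec_neg]

lemma ip_sum_right {ι : Type*} (s : Finset ι) (u : Fin k → ℝ) (v : ι → Fin k → ℝ) :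
    ip h x u (∑ i ∈ s, v i) = ∑ i ∈ s, ip h x u (v i) := by
  simp [ip, Matrix.mulVec_sum, dotProduct_sum]

/-- The derivative of the metric in the direction `u`, as a bilinear form. -/
def dip (h : (Fin k → ℝ) → Matrix (Fin k) (Fin k) ℝ) (x u v w : Fin k → ℝ) : ℝ :=
  ∑ α, ∑ β, fderiv ℝ (fun z => h z α β) x u * v α * w β

lemma dip_comm (hs : ∀ x, (h x).IsSymm) (u v w : Fin k → ℝ) : dip h x u v w = dip h x u w v := by
  unfold dip
  rw [Finset.sum_comm]
  refine Finset.sum_congr rfl fun α _ => Finset.sum_congr rfl fun β _ => ?_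
  rw [show (fun z => h z β α) = fun z => h z α β from funext fun z => (hs z).apply α β]
  ring

lemma hasDerivAt_ip (hh : ∀ α β, ContDiff ℝ ∞ fun x => h x α β) {c v w : ℝ → Fin k → ℝ}
    {c' v' w' : Fin k → ℝ} {t : ℝ} (hc : HasDerivAt c c' t) (hv : HasDerivAt v v' t)
    (hw : HasDerivAt w w' t) :
    HasDerivAt (fun s => ip h (c s) (v s) (w s))
      (dip h (c t) c' (v t) (w t) + ip h (c t) v' (w t) + ip h (c t) (v t) w') t := by
  simp only [ip_eq_sum, dip]
  rw [← Finset.sum_add_distrib, ← Finset.sum_add_distrib]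
  refine HasDerivAt.fun_sum fun α _ => ?_
  rw [← Finset.sum_add_distrib, ← Finset.sum_add_distrib]
  refine HasDerivAt.fun_sum fun β _ => ?_
  have h1 : HasDerivAt (fun s => h (c s) α β) (fderiv ℝ (fun z => h z α β) (c t) c') t :=
    ((((hh α β).differentiable (by simp)) (c t)).hasFDerivAt).comp_hasDerivAt t hc
  convert! (h1.mul (hasDerivAt_pi.1 hv α)).mul (hasDerivAt_pi.1 hw β) using 1
  simp only [Pi.mul_apply]
  ring

lemma dip_eq_sum (u v w : Fin k → ℝ) :
    dip h x u v w = ∑ α, ∑ β, ∑ μ, pd (fun z => h z α β) μ x * u μ * v α * w β := by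
  unfold dip
  refine Finset.sum_congr rfl fun α _ => Finset.sum_congr rfl fun β _ => ?_
  rw [fderiv_eq_sum_pd, Finset.sum_mul, Finset.sum_mul]
  exact Finset.sum_congr rfl fun μ _ => by rw [smul_eq_mul]; ring

/-- The Christoffel symbols with the index lowered. -/
lemma ip_christoffel (hdet : (h x).det ≠ 0) (n a b : Fin k → ℝ) :
    ip h x n (fun α => ∑ μ, ∑ ρ, christoffel h α μ ρ x * a μ * b ρ) =
      (dip h x a n b + dip h x b a n - dip h x n b a) / 2 := by
  -- `c μ ρ l` is twice the Christoffel symbol of the first kind; multiplication by `h x` cancels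
  -- the inverse metric in `christoffel`.
  let c : Fin k → Fin k → Fin k → ℝ := fun μ ρ l =>
    pd (fun z => h z l ρ) μ x + pd (fun z => h z μ l) ρ x - pd (fun z => h z ρ μ) l x
  have hlow : ∀ μ ρ, h x *ᵥ (fun α => christoffel h α μ ρ x) = (1 / 2 : ℝ) • c μ ρ := by
    intro μ ρ
    have : (fun α => christoffel h α μ ρ x) = (1 / 2 : ℝ) • ((h x)⁻¹ *ᵥ c μ ρ) := by
      ext α
      simp [christoffel, c, Matrix.mulVec, dotProduct]
    rw [this, Matrix.mulVec_smul, Matrix.mulVec_mulVec,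
      Matrix.mul_nonsing_inv _ (isUnit_iff_ne_zero.2 hdet), Matrix.one_mulVec]
  have hvec : (fun α => ∑ μ, ∑ ρ, christoffel h α μ ρ x * a μ * b ρ) =
      ∑ μ, ∑ ρ, (a μ * b ρ) • fun α => christoffel h α μ ρ x := by
    ext α
    simp only [Finset.sum_apply, Pi.smul_apply, smul_eq_mul]
    exact Finset.sum_congr rfl fun μ _ => Finset.sum_congr rfl fun ρ _ => by ring
  have hleft : ip h x n (fun α => ∑ μ, ∑ ρ, christoffel h α μ ρ x * a μ * b ρ) =
      ∑ μ, ∑ ρ, ∑ l, n l * c μ ρ l * a μ * b ρ / 2 := by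
    rw [hvec, ip_sum_right]
    refine Finset.sum_congr rfl fun μ _ => ?_
    rw [ip_sum_right]
    refine Finset.sum_congr rfl fun ρ _ => ?_
    rw [ip_smul_right, ip, hlow, dotProduct, Finset.mul_sum]
    exact Finset.sum_congr rfl fun l _ => by simp only [Pi.smul_apply, smul_eq_mul]; ring
  have h1 : dip h x a n b =
      ∑ μ, ∑ ρ, ∑ l, pd (fun z => h z l ρ) μ x * a μ * n l * b ρ := by
    rw [dip_eq_sum, Finset.sum_comm]
    rw [Finset.sum_congr rfl fun β _ => Finset.sum_comm]
    rw [Finset.sum_comm]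
  have h2 : dip h x b a n =
      ∑ μ, ∑ ρ, ∑ l, pd (fun z => h z μ l) ρ x * b ρ * a μ * n l := by
    rw [dip_eq_sum]
    exact Finset.sum_congr rfl fun α _ => Finset.sum_comm
  have h3 : dip h x n b a =
      ∑ μ, ∑ ρ, ∑ l, pd (fun z => h z ρ μ) l x * n l * b ρ * a μ := by
    rw [dip_eq_sum, Finset.sum_comm]
  rw [hleft, h1, h2, h3]
  simp only [← Finset.sum_add_distrib, ← Finset.sum_sub_distrib, Finset.sum_div]
  refine Finset.sum_congr rfl fun μ _ => Finset.sum_congr rfl fun ρ _ =>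
    Finset.sum_congr rfl fun l _ => ?_
  simp only [c]
  ring

lemma pullback_apply {f : (Fin l → ℝ) → (Fin k → ℝ)} (y : Fin l → ℝ) (a b : Fin l) :
    pullback h f y a b = ip h (f y) (pd f a y) (pd f b y) := rfl

lemma pullback_isSymm (hs : ∀ x, (h x).IsSymm) (f : (Fin l → ℝ) → (Fin k → ℝ)) (y : Fin l → ℝ) :
    (pullback h f y).IsSymm := by
  ext a b
  exact ip_comm (hs _) _ _

lemma contDiffOn_ip {E : Type*} [NormedAddCommGroup E] [NormedSpace ℝ E] {U : Set E}
    (hh : ∀ α β, ContDiff ℝ ∞ fun x => h x α β) {c v w : E → Fin k → ℝ}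
    (hc : ContDiffOn ℝ ∞ c U) (hv : ContDiffOn ℝ ∞ v U) (hw : ContDiffOn ℝ ∞ w U) :
    ContDiffOn ℝ ∞ (fun y => ip h (c y) (v y) (w y)) U := by
  simp only [ip_eq_sum]
  refine ContDiffOn.sum fun α _ => ContDiffOn.sum fun β _ => ?_
  exact (((hh α β).comp_contDiffOn hc).mul (contDiffOn_pi.1 hv α)).mul (contDiffOn_pi.1 hw β)

lemma contDiffOn_pullback (hh : ∀ α β, ContDiff ℝ ∞ fun x => h x α β)
    {f : (Fin l → ℝ) → (Fin k → ℝ)} {U : Set (Fin l → ℝ)} (hU : IsOpen U)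
    (hf : ContDiffOn ℝ ∞ f U) (a b : Fin l) :
    ContDiffOn ℝ ∞ (fun y => pullback h f y a b) U :=
  contDiffOn_ip hh hf (contDiffOn_pd hU hf a) (contDiffOn_pd hU hf b)

/-- The pullback is J h Jᵀ with J the Jacobian matrix, so its determinant has the sign of det h
wherever `f` is a local diffeomorphism. -/
lemma det_pullback (f : (Fin k → ℝ) → (Fin k → ℝ)) (y : Fin k → ℝ) :
    (pullback h f y).det = (h (f y)).det * (Matrix.of fun a α => pd f a y α).det ^ 2 := by
  have : pullback h f y = (Matrix.of fun a α => pd f a y α) * h (f y) *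
      (Matrix.of fun a α => pd f a y α)ᵀ := by
    ext a b
    simp only [pullback_apply, ip_eq_sum, Matrix.mul_apply, Matrix.of_apply,
      Matrix.transpose_apply, Finset.sum_mul]
    rw [Finset.sum_comm]
    exact Finset.sum_congr rfl fun α _ => Finset.sum_congr rfl fun β _ => by ring
  rw [this, Matrix.det_mul, Matrix.det_mul, Matrix.det_transpose]
  ring

end Form

/-! ### Lorentzian linear algebra -/

section Lorentz

variable {m : ℕ} {h : (Fin (m + 2) → ℝ) → Matrix (Fin (m + 2)) (Fin (m + 2)) ℝ}

lemma IsAdmissibleMetric.space_time (hh : IsAdmissibleMetric h) (x) (i : Fin (m + 1)) :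
    h x i.succ 0 = 0 := by
  rw [← (hh.symm x).apply, hh.time_space]

lemma IsAdmissibleMetric.time_time_neg (hh : IsAdmissibleMetric h) (x) : h x 0 0 < 0 := by
  obtain ⟨c, hc, hb⟩ := hh.bounds
  linarith [(hb x).1]

lemma IsAdmissibleMetric.ip_eq (hh : IsAdmissibleMetric h) (x v w : Fin (m + 2) → ℝ) :
    ip h x v w = h x 0 0 * v 0 * w 0 + ∑ i, ∑ j, h x (Fin.succ i) (Fin.succ j) * v i.succ * w j.succ := by
  rw [ip_eq_sum, Fin.sum_univ_succ]
  simp [Fin.sum_univ_succ (n := m + 1), hh.time_space, hh.space_time]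

lemma IsAdmissibleMetric.spatial_posDef (hh : IsAdmissibleMetric h) (x) :
    ((h x).submatrix Fin.succ Fin.succ).PosDef := by
  obtain ⟨c, hc, hb⟩ := hh.bounds
  refine Matrix.PosDef.of_dotProduct_mulVec_pos ?_ fun ξ hξ => ?_
  · ext i j
    simpa using (hh.symm x).apply _ _
  · have h1 := (hb x).2.1 ξ
    have h2 : 0 < ∑ i, ξ i ^ 2 := by
      obtain ⟨i, hi⟩ := Function.ne_iff.1 hξ
      exact Finset.sum_pos' (fun i _ => sq_nonneg _) ⟨i, Finset.mem_univ i, by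
        have : ξ i ≠ 0 := hi
        positivity⟩
    have h3 : star ξ ⬝ᵥ ((h x).submatrix Fin.succ Fin.succ) *ᵥ ξ =
        ∑ i, ∑ j, h x (Fin.succ i) (Fin.succ j) * ξ i * ξ j := by
      simp only [dotProduct, Matrix.mulVec, Matrix.submatrix_apply, Finset.mul_sum, star_trivial]
      exact Finset.sum_congr rfl fun i _ => Finset.sum_congr rfl fun j _ => by ring
    rw [h3]
    exact (mul_pos hc h2).trans_le h1

/-- The first row of `h x` has the single nonzero entry h_00 < 0, and the complementary minor is the
positive definite spatial block. -/
lemma IsAdmissibleMetric.det_neg (hh : IsAdmissibleMetric h) (x) : (h x).det < 0 := by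
  rw [Matrix.det_succ_row_zero, Fin.sum_univ_succ]
  have h0 : ∀ i : Fin (m + 1), h x 0 i.succ = 0 := hh.time_space x
  simp only [h0, mul_zero, zero_mul, Finset.sum_const_zero, add_zero, Fin.val_zero, pow_zero,
    one_mul]
  have := (hh.spatial_posDef x).det_pos
  refine mul_neg_of_neg_of_pos (hh.time_time_neg x) ?_
  rwa [Fin.succAbove_zero]

/-- A nonzero vector orthogonal to a timelike vector is spacelike. -/
lemma IsAdmissibleMetric.ip_self_pos (hh : IsAdmissibleMetric h) {x v n : Fin (m + 2) → ℝ}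
    (hv : ip h x v v < 0) (hn : n ≠ 0) (horth : ip h x n v = 0) : 0 < ip h x n n := by
  have hpd := hh.spatial_posDef x
  set S : (Fin (m + 1) → ℝ) → (Fin (m + 1) → ℝ) → ℝ := fun a b =>
    ∑ i, ∑ j, h x (Fin.succ i) (Fin.succ j) * a i * b j with hS
  have hSpos : ∀ a, a ≠ 0 → 0 < S a a := fun a ha => by
    have := hpd.dotProduct_mulVec_pos ha
    simp only [dotProduct, Matrix.mulVec, Matrix.submatrix_apply, Finset.mul_sum, star_trivial]
      at this
    exact this.trans_le (Finset.sum_congr rfl fun i _ => Finset.sum_congr rfl fun j _ => by ring).le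
  have hS0 : ∀ a, 0 ≤ S a a := fun a => by
    rcases eq_or_ne a 0 with rfl | ha
    · simp [hS]
    · exact (hSpos a ha).le
  have hSsymm : ∀ a b, S a b = S b a := fun a b => by
    simp only [hS]
    rw [Finset.sum_comm]
    refine Finset.sum_congr rfl fun i _ => Finset.sum_congr rfl fun j _ => ?_
    rw [(hh.symm x).apply]; ring
  have hSquad : ∀ (a b : Fin (m + 1) → ℝ) (s t : ℝ),
      S (fun i => s * a i + t * b i) (fun i => s * a i + t * b i) =
        s ^ 2 * S a a + 2 * s * t * S a b + t ^ 2 * S b b := by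
    intro a b s t
    have : 2 * s * t * S a b = s * t * S a b + s * t * S b a := by rw [hSsymm b a]; ring
    rw [this]
    simp only [hS, Finset.mul_sum, ← Finset.sum_add_distrib]
    exact Finset.sum_congr rfl fun i _ => Finset.sum_congr rfl fun j _ => by ring
  -- Cauchy–Schwarz for the spatial form, from its nonnegativity at S(b,b) a - S(a,b) b.
  have hCS : ∀ a b, S a b ^ 2 ≤ S a a * S b b := fun a b => by
    rcases eq_or_ne b 0 with rfl | hb
    · simp [hS]
    · have h1 := hS0 (fun i => S b b * a i + -S a b * b i)
      rw [hSquad] at h1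
      have h2 := hSpos b hb
      by_contra hlt
      push Not at hlt
      nlinarith
  rw [hh.ip_eq] at hv horth ⊢
  change h x 0 0 * v 0 * v 0 + S (fun i => v i.succ) (fun i => v i.succ) < 0 at hv
  change h x 0 0 * n 0 * v 0 + S (fun i => n i.succ) (fun i => v i.succ) = 0 at horth
  change 0 < h x 0 0 * n 0 * n 0 + S (fun i => n i.succ) (fun i => n i.succ)
  have ht := hh.time_time_neg x
  set p := -h x 0 0 with hp
  have hpp : 0 < p := by linarith
  rw [show h x 0 0 = -p by linarith] at *
  have hcs := hCS (fun i => n i.succ) (fun i => v i.succ)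
  have hvv := hS0 (fun i => v i.succ)
  -- If the spatial part of `n` vanished, orthogonality to `v`, whose time component is nonzero,
  -- would give n^0 = 0 as well.
  have hnn : 0 < S (fun i => n i.succ) (fun i => n i.succ) := by
    apply hSpos
    intro h0
    have hv0 : v 0 ≠ 0 := by rintro h0; rw [h0] at hv; nlinarith
    have : S (fun i => n i.succ) (fun i => v i.succ) = 0 := by
      rw [h0]; simp [hS]
    rw [this] at horth
    have hn0 : n 0 = 0 := by
      have : p * (n 0 * v 0) = 0 := by linarith
      rcases mul_eq_zero.1 this with h | h
      · exact absurd h hpp.ne'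
      · exact (mul_eq_zero.1 h).resolve_right hv0
    apply hn
    ext i
    refine Fin.cases hn0 (fun j => congrFun h0 j) i
  generalize S (fun i => n i.succ) (fun i => n i.succ) = A at *
  generalize S (fun i => n i.succ) (fun i => v i.succ) = B at *
  generalize S (fun i => v i.succ) (fun i => v i.succ) = D at *
  -- With A, D the spatial squares of n and v, orthogonality reads B = p n^0 v^0. If n were not
  -- spacelike, then p² (n^0)² (v^0)² ≤ A D < A p (v^0)² ≤ p² (n^0)² (v^0)², a contradiction.
  have hB : B = p * n 0 * v 0 := by linarith
  by_contra hle
  push Not at hle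
  have h1 : p ^ 2 * n 0 ^ 2 * v 0 ^ 2 ≤ A * D := by rw [hB] at hcs; nlinarith
  have h2 : A * D < A * (p * v 0 ^ 2) := mul_lt_mul_of_pos_left (by nlinarith) hnn
  have h3 : A * (p * v 0 ^ 2) ≤ p * n 0 ^ 2 * (p * v 0 ^ 2) :=
    mul_le_mul_of_nonneg_right (by nlinarith) (by positivity)
  nlinarith

end Lorentz

/-! ### Block matrices -/

section Block

variable {k : ℕ}

@[simp] lemma blockOne_castSucc_castSucc (A : Matrix (Fin k) (Fin k) ℝ) (a b : Fin k) :
    blockOne A a.castSucc b.castSucc = A a b := by simp [blockOne]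

@[simp] lemma blockOne_castSucc_last (A : Matrix (Fin k) (Fin k) ℝ) (a : Fin k) :
    blockOne A a.castSucc (Fin.last k) = 0 := by simp [blockOne]

@[simp] lemma blockOne_last_castSucc (A : Matrix (Fin k) (Fin k) ℝ) (a : Fin k) :
    blockOne A (Fin.last k) a.castSucc = 0 := by simp [blockOne]

@[simp] lemma blockOne_last_last (A : Matrix (Fin k) (Fin k) ℝ) :
    blockOne A (Fin.last k) (Fin.last k) = 1 := by simp [blockOne]

lemma matrix_ext_blocks {A B : Matrix (Fin (k + 1)) (Fin (k + 1)) ℝ}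
    (h1 : ∀ a b : Fin k, A a.castSucc b.castSucc = B a.castSucc b.castSucc)
    (h2 : ∀ a : Fin k, A a.castSucc (Fin.last k) = B a.castSucc (Fin.last k))
    (h3 : ∀ a : Fin k, A (Fin.last k) a.castSucc = B (Fin.last k) a.castSucc)
    (h4 : A (Fin.last k) (Fin.last k) = B (Fin.last k) (Fin.last k)) : A = B := by
  ext α β
  induction α using Fin.lastCases with
  | last => induction β using Fin.lastCases with
    | last => exact h4
    | cast b => exact h3 b
  | cast a => induction β using Fin.lastCases with
    | last => exact h2 a
    | cast b => exact h1 a b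

lemma blockOne_mul (A B : Matrix (Fin k) (Fin k) ℝ) :
    blockOne A * blockOne B = blockOne (A * B) := by
  apply matrix_ext_blocks <;> intros <;> simp [Matrix.mul_apply, Fin.sum_univ_castSucc]

lemma blockOne_one : blockOne (1 : Matrix (Fin k) (Fin k) ℝ) = 1 := by
  apply matrix_ext_blocks <;> intros <;> simp [Matrix.one_apply, (Fin.castSucc_lt_last _).ne']

lemma det_blockOne (A : Matrix (Fin k) (Fin k) ℝ) : (blockOne A).det = A.det := by
  rw [Matrix.det_succ_row _ (Fin.last k), Fin.sum_univ_castSucc]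
  have : (blockOne A).submatrix Fin.castSucc Fin.castSucc = A := by
    ext a b; simp
  simp [Fin.succAbove_last, this, ← two_mul, pow_mul]

lemma blockOne_inv (A : Matrix (Fin k) (Fin k) ℝ) (hA : A.det ≠ 0) :
    (blockOne A)⁻¹ = blockOne A⁻¹ := by
  apply Matrix.inv_eq_right_inv
  rw [blockOne_mul, Matrix.mul_nonsing_inv _ (isUnit_iff_ne_zero.2 hA), blockOne_one]

end Block

/-! ### Tubular coordinates around a hypersurface -/

section Tube

variable {k : ℕ} {h : (Fin (k + 2) → ℝ) → Matrix (Fin (k + 2)) (Fin (k + 2)) ℝ}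
  {κ : (Fin (k + 2) → ℝ) → ℝ} {F : (Fin (k + 1) → ℝ) → (Fin (k + 2) → ℝ)}
  {f : (Fin (k + 2) → ℝ) → (Fin (k + 2) → ℝ)} {O K : Set (Fin (k + 2) → ℝ)}

/-- The embedding of the hypersurface `{y^n = 0}`. -/
def zeroSection (k : ℕ) : (Fin k → ℝ) →L[ℝ] (Fin (k + 1) → ℝ) :=
  ContinuousLinearMap.pi fun i =>
    Fin.lastCases (motive := fun _ => (Fin k → ℝ) →L[ℝ] ℝ) 0 (fun a => ContinuousLinearMap.proj a) i

/-- The projection onto the tangential coordinates. -/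
def initL (k : ℕ) : (Fin (k + 1) → ℝ) →L[ℝ] (Fin k → ℝ) :=
  ContinuousLinearMap.pi fun i => ContinuousLinearMap.proj i.castSucc

@[simp] lemma zeroSection_last {k : ℕ} (w : Fin k → ℝ) : zeroSection k w (Fin.last k) = 0 := by
  simp [zeroSection]

@[simp] lemma zeroSection_castSucc {k : ℕ} (w : Fin k → ℝ) (a : Fin k) :
    zeroSection k w a.castSucc = w a := by
  simp [zeroSection]

@[simp] lemma init_zeroSection {k : ℕ} (w : Fin k → ℝ) : Fin.init (zeroSection k w) = w := by
  ext a; simp [Fin.init]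

lemma zeroSection_init {k : ℕ} {y : Fin (k + 1) → ℝ} (hy : y (Fin.last k) = 0) :
    zeroSection k (Fin.init y) = y := by
  ext i
  induction i using Fin.lastCases with
  | last => simp [hy]
  | cast a => simp [Fin.init]

lemma zeroSection_single {k : ℕ} (a : Fin k) :
    zeroSection k (Pi.single a 1) = Pi.single a.castSucc 1 := by
  ext i
  induction i using Fin.lastCases with
  | last => simp
  | cast b => simp [Pi.single_apply]

/-- The hypotheses on coordinates `f` adapted to the hypersurface `F`. -/
structure IsTubeChart {k : ℕ} (F : (Fin (k + 1) → ℝ) → (Fin (k + 2) → ℝ))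
    (f : (Fin (k + 2) → ℝ) → (Fin (k + 2) → ℝ)) (O : Set (Fin (k + 2) → ℝ)) : Prop where
  isOpen : IsOpen O
  smooth : ContDiffOn ℝ ∞ f O
  zero_mem : ∀ y ∈ O, zeroSection (k + 1) (Fin.init y) ∈ O
  eq_zeroSection : ∀ w, zeroSection (k + 1) w ∈ O → F w = f (zeroSection (k + 1) w)

lemma IsTubeChart.pd_eq (H : IsTubeChart F f O) {w : Fin (k + 1) → ℝ}
    (hw : zeroSection (k + 1) w ∈ O) (a : Fin (k + 1)) :
    pd F a w = pd f a.castSucc (zeroSection (k + 1) w) := by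
  have h1 : F =ᶠ[𝓝 w] f ∘ zeroSection (k + 1) := by
    filter_upwards [(zeroSection (k + 1)).continuous.continuousAt.preimage_mem_nhds
      (H.isOpen.mem_nhds hw)] with v hv
    exact H.eq_zeroSection v hv
  have h2 : DifferentiableAt ℝ f (zeroSection (k + 1) w) :=
    ((H.smooth _ hw).contDiffAt (H.isOpen.mem_nhds hw)).differentiableAt (by simp)
  rw [pd_congr h1]
  unfold pd
  rw [fderiv_comp _ h2 (zeroSection (k + 1)).differentiableAt, ContinuousLinearMap.fderiv,
    ContinuousLinearMap.comp_apply, zeroSection_single]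

/-- By `IsTubeChart.pd_eq` the pair `pd F b`, `pd f b.castSucc` is again a tube chart, so that lemma
applies a second time. -/
lemma IsTubeChart.pd_pd_eq (H : IsTubeChart F f O) {w : Fin (k + 1) → ℝ}
    (hw : zeroSection (k + 1) w ∈ O) (a b : Fin (k + 1)) :
    pd (pd F b) a w = pd (pd f b.castSucc) a.castSucc (zeroSection (k + 1) w) :=
  IsTubeChart.pd_eq (F := pd F b) (f := pd f b.castSucc) (O := O)
    ⟨H.isOpen, contDiffOn_pd H.isOpen H.smooth _, H.zero_mem, fun _ hw => H.pd_eq hw b⟩ hw a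

lemma IsTubeChart.pullback_eq (H : IsTubeChart F f O) {w : Fin (k + 1) → ℝ}
    (hw : zeroSection (k + 1) w ∈ O) (a b : Fin (k + 1)) :
    pullback h F w a b = pullback h f (zeroSection (k + 1) w) a.castSucc b.castSucc := by
  rw [pullback_apply, pullback_apply, H.pd_eq hw, H.pd_eq hw, H.eq_zeroSection w hw]

lemma IsTubeChart.differentiableAt (H : IsTubeChart F f O) {w : Fin (k + 1) → ℝ}
    (hw : zeroSection (k + 1) w ∈ O) : DifferentiableAt ℝ F w := by
  have h1 : F =ᶠ[𝓝 w] f ∘ zeroSection (k + 1) := by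
    filter_upwards [(zeroSection (k + 1)).continuous.continuousAt.preimage_mem_nhds
      (H.isOpen.mem_nhds hw)] with v hv
    exact H.eq_zeroSection v hv
  have h2 : DifferentiableAt ℝ f (zeroSection (k + 1) w) :=
    ((H.smooth _ hw).contDiffAt (H.isOpen.mem_nhds hw)).differentiableAt (by simp)
  exact (h2.comp w (zeroSection (k + 1)).differentiableAt).congr_of_eventuallyEq h1

/-- A function vanishing on `{y^n = 0}` has vanishing tangential derivatives there. -/
lemma pd_castSucc_eq_zero {k : ℕ} {O : Set (Fin (k + 1) → ℝ)} {u : (Fin (k + 1) → ℝ) → ℝ}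
    (hO : IsOpen O) (hu : ContDiffOn ℝ ∞ u O) (h0 : ∀ y ∈ O, y (Fin.last k) = 0 → u y = 0)
    {y : Fin (k + 1) → ℝ} (hy : y ∈ O) (hy0 : y (Fin.last k) = 0) (a : Fin k) :
    pd u a.castSucc y = 0 := by
  have hd : DifferentiableAt ℝ u (Function.update y a.castSucc (y a.castSucc)) := by
    rw [Function.update_eq_self]
    exact ((hu _ hy).contDiffAt (hO.mem_nhds hy)).differentiableAt (by simp)
  have h1 := hasDerivAt_update hd
  have h2 : (fun s => u (Function.update y a.castSucc s)) =ᶠ[𝓝 (y a.castSucc)] fun _ => 0 := by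
    have hc : ContinuousAt (fun s => Function.update y a.castSucc s) (y a.castSucc) := by fun_prop
    filter_upwards [hc.preimage_mem_nhds
      (hO.mem_nhds (by rwa [Function.update_eq_self]))] with s hs
    refine h0 _ hs ?_
    rw [Function.update_of_ne (Fin.castSucc_lt_last a).ne', hy0]
  have h3 := h1.congr_of_eventuallyEq h2.symm
  rw [Function.update_eq_self] at h3
  exact h3.unique (hasDerivAt_const _ _)


lemma pd_ip {k l : ℕ} {h : (Fin l → ℝ) → Matrix (Fin l) (Fin l) ℝ}
    (hh : ∀ α β, ContDiff ℝ ∞ fun x => h x α β) {c v w : (Fin k → ℝ) → Fin l → ℝ} {y : Fin k → ℝ}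
    (hc : DifferentiableAt ℝ c y) (hv : DifferentiableAt ℝ v y) (hw : DifferentiableAt ℝ w y)
    (i : Fin k) :
    pd (fun z => ip h (c z) (v z) (w z)) i y =
      dip h (c y) (pd c i y) (v y) (w y) + ip h (c y) (pd v i y) (w y) +
        ip h (c y) (v y) (pd w i y) := by
  rw [← Function.update_eq_self i y] at hc hv hw
  have h1 := hasDerivAt_ip hh (hasDerivAt_update hc) (hasDerivAt_update hv) (hasDerivAt_update hw)
  have hd : DifferentiableAt ℝ (fun z => ip h (c z) (v z) (w z)) (Function.update y i (y i)) := by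
    simp only [ip_eq_sum]
    refine DifferentiableAt.fun_sum fun α _ => DifferentiableAt.fun_sum fun β _ => ?_
    exact ((((hh α β).differentiable (by simp)).differentiableAt.comp _ hc).mul
      (differentiableAt_pi.1 hv α)).mul (differentiableAt_pi.1 hw β)
  have h2 := (hasDerivAt_update hd).unique h1
  rwa [Function.update_eq_self] at h2

/-- Coordinates in a tubular neighbourhood of the hypersurface `F` in which `∂_n f` is the unit
normal on `F`, normalized to first order along `F`. -/
structure IsNormalTubeChart {k : ℕ}
    (h : (Fin (k + 2) → ℝ) → Matrix (Fin (k + 2)) (Fin (k + 2)) ℝ)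
    (κ : (Fin (k + 2) → ℝ) → ℝ) (F : (Fin (k + 1) → ℝ) → (Fin (k + 2) → ℝ))
    (f : (Fin (k + 2) → ℝ) → (Fin (k + 2) → ℝ)) (O : Set (Fin (k + 2) → ℝ)) : Prop
    extends IsTubeChart F f O where
  orth : ∀ y ∈ O, y (Fin.last (k + 1)) = 0 → ∀ a : Fin (k + 1),
    ip h (f y) (pd f (Fin.last (k + 1)) y) (pd f a.castSucc y) = 0
  unit : ∀ y ∈ O, y (Fin.last (k + 1)) = 0 →
    ip h (f y) (pd f (Fin.last (k + 1)) y) (pd f (Fin.last (k + 1)) y) = 1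
  unit_deriv : ∀ y ∈ O, y (Fin.last (k + 1)) = 0 →
    pd (fun z => pullback h f z (Fin.last (k + 1)) (Fin.last (k + 1))) (Fin.last (k + 1)) y = 0
  det_neg : ∀ y ∈ O, (pullback h f y).det < 0
  curvature : ∀ w, zeroSection (k + 1) w ∈ O →
    -κ (F w) = meanCurvature h F (pd f (Fin.last (k + 1)) (zeroSection (k + 1) w)) w

lemma exists_uniform_bound {α ι : Type*} [Fintype ι] {K : Set α} {u : ι → α → ℝ} {w : α → ℝ}
    (hw : ∀ y, 0 ≤ w y) (hb : ∀ i, ∃ C, 0 ≤ C ∧ ∀ y ∈ K, |u i y| ≤ C * w y) :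
    ∃ C, 0 ≤ C ∧ ∀ i, ∀ y ∈ K, |u i y| ≤ C * w y := by
  choose c hc hcb using hb
  refine ⟨∑ i, c i, Finset.sum_nonneg fun i _ => hc i, fun i y hy => (hcb i y hy).trans ?_⟩
  exact mul_le_mul_of_nonneg_right
    (Finset.single_le_sum (fun i _ => hc i) (Finset.mem_univ i)) (hw y)

/-! ### Taylor estimates for the metric in a normal tube chart. -/

namespace IsNormalTubeChart

variable (hh : IsAdmissibleMetric h) (H : IsNormalTubeChart h κ F f O)
include hh H

/-- The first variation of the induced metric is minus twice the second fundamental form. -/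
lemma pd_pullback_last {w : Fin (k + 1) → ℝ} (hw : zeroSection (k + 1) w ∈ O) (a b : Fin (k + 1)) :
    pd (fun z => pullback h f z a.castSucc b.castSucc) (Fin.last (k + 1)) (zeroSection (k + 1) w) =
      -2 * ip h (F w) (pd f (Fin.last (k + 1)) (zeroSection (k + 1) w)) (covDeriv h F a b w) := by
  set y := zeroSection (k + 1) w with hy
  set n := Fin.last (k + 1) with hn
  have hy0 : y n = 0 := zeroSection_last w
  have hO := H.isOpen
  have diff : ∀ {u : (Fin (k + 2) → ℝ) → (Fin (k + 2) → ℝ)}, ContDiffOn ℝ ∞ u O →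
      DifferentiableAt ℝ u y := fun hu =>
    ((hu _ hw).contDiffAt (hO.mem_nhds hw)).differentiableAt (by simp)
  have hpf : ∀ i, ContDiffOn ℝ ∞ (pd f i) O := contDiffOn_pd hO H.smooth
  -- The relation h(∂_n f, ∂_b f) = 0 holds along the whole hypersurface, so it may be
  -- differentiated in the tangential direction a.
  have hnormal : ∀ a b : Fin (k + 1),
      dip h (f y) (pd f a.castSucc y) (pd f n y) (pd f b.castSucc y) +
        ip h (f y) (pd (pd f n) a.castSucc y) (pd f b.castSucc y) +
        ip h (f y) (pd f n y) (pd (pd f b.castSucc) a.castSucc y) = 0 := fun a b => by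
    rw [← pd_ip hh.smooth (diff H.smooth) (diff (hpf _)) (diff (hpf _))]
    exact pd_castSucc_eq_zero hO (contDiffOn_ip hh.smooth H.smooth (hpf _) (hpf _))
      (fun z hz hz0 => H.orth z hz hz0 b) hw hy0 a
  have hcov : ip h (F w) (pd f n y) (covDeriv h F a b w) =
      ip h (f y) (pd f n y) (pd (pd f b.castSucc) a.castSucc y) +
        (dip h (f y) (pd f a.castSucc y) (pd f n y) (pd f b.castSucc y) +
          dip h (f y) (pd f b.castSucc y) (pd f a.castSucc y) (pd f n y) -
          dip h (f y) (pd f n y) (pd f b.castSucc y) (pd f a.castSucc y)) / 2 := by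
    have hd : DifferentiableAt ℝ (pd F b) w :=
      IsTubeChart.differentiableAt (F := pd F b) (f := pd f b.castSucc) (O := O)
        ⟨H.isOpen, hpf _, H.zero_mem, fun _ hw => H.toIsTubeChart.pd_eq hw b⟩ hw
    have hsplit : covDeriv h F a b w = pd (pd F b) a w +
        fun α => ∑ μ, ∑ ρ, christoffel h α μ ρ (F w) * pd F a w μ * pd F b w ρ := by
      ext α
      simp only [covDeriv, Pi.add_apply, pd_apply hd]
    rw [hsplit, ip_add_right, ip_christoffel (hh.det_neg _).ne, H.toIsTubeChart.pd_pd_eq hw,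
      H.toIsTubeChart.pd_eq hw, H.toIsTubeChart.pd_eq hw, H.eq_zeroSection w hw]
  have hg : pd (fun z => pullback h f z a.castSucc b.castSucc) n y =
      dip h (f y) (pd f n y) (pd f a.castSucc y) (pd f b.castSucc y) +
        ip h (f y) (pd (pd f a.castSucc) n y) (pd f b.castSucc y) +
        ip h (f y) (pd f a.castSucc y) (pd (pd f b.castSucc) n y) :=
    pd_ip hh.smooth (diff H.smooth) (diff (hpf _)) (diff (hpf _)) n
  rw [hg, hcov]
  -- Adding the relations for (a, b) and (b, a) eliminates the mixed derivatives ∂_n ∂_a f and ∂_n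
  -- ∂_b f. The derivatives of `h` that remain are those of the lowered Christoffel symbols.
  have h1 := hnormal a b
  have h2 := hnormal b a
  rw [pd_comm hO H.smooth hw b.castSucc a.castSucc] at h1 ⊢
  rw [pd_comm hO H.smooth hw a.castSucc n, pd_comm hO H.smooth hw b.castSucc n]
  rw [ip_comm (hh.symm _) (pd f a.castSucc y), dip_comm hh.symm (pd f n y),
    dip_comm hh.symm (pd f b.castSucc y) (pd f a.castSucc y)]
  linarith

lemma contDiffOn_pullback_apply (α β : Fin (k + 2)) :
    ContDiffOn ℝ ∞ (fun y => pullback h f y α β) O :=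
  contDiffOn_pullback hh.smooth H.isOpen H.smooth α β

lemma contDiffOn_inv_pullback_apply (α β : Fin (k + 2)) :
    ContDiffOn ℝ ∞ (fun y => (pullback h f y)⁻¹ α β) O :=
  contDiffOn_inv_apply (H.contDiffOn_pullback_apply hh) (fun y hy => (H.det_neg y hy).ne) α β

omit hh in
lemma sqrtNegDet_pos {y : Fin (k + 2) → ℝ} (hy : y ∈ O) : 0 < sqrtNegDet h f y :=
  Real.sqrt_pos.2 (neg_pos.2 (H.det_neg y hy))

lemma contDiffOn_sqrtNegDet : ContDiffOn ℝ ∞ (sqrtNegDet h f) O :=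
  (contDiffOn_det (H.contDiffOn_pullback_apply hh)).neg.sqrt
    fun y hy => (neg_pos.2 (H.det_neg y hy)).ne'

lemma pullback_eq_blockOne {y : Fin (k + 2) → ℝ} (hy : y ∈ O) (hy0 : y (Fin.last (k + 1)) = 0) :
    pullback h f y = blockOne (pullback h F (Fin.init y)) := by
  have hz := zeroSection_init hy0
  have hw : zeroSection (k + 1) (Fin.init y) ∈ O := by rwa [hz]
  apply matrix_ext_blocks
  · intro a b
    rw [blockOne_castSucc_castSucc, H.toIsTubeChart.pullback_eq hw, hz]
  · intro a
    rw [blockOne_castSucc_last, pullback_apply, ip_comm (hh.symm _), H.orth y hy hy0]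
  · intro a
    rw [blockOne_last_castSucc, pullback_apply, H.orth y hy hy0]
  · rw [blockOne_last_last, pullback_apply, H.unit y hy hy0]

lemma inv_pullback_eq_blockOne {y : Fin (k + 2) → ℝ} (hy : y ∈ O)
    (hy0 : y (Fin.last (k + 1)) = 0) :
    (pullback h f y)⁻¹ = blockOne (pullback h F (Fin.init y))⁻¹ := by
  have h1 := H.pullback_eq_blockOne hh hy hy0
  rw [h1, blockOne_inv]
  rw [← det_blockOne, ← h1]
  exact (H.det_neg y hy).ne

lemma inv_pullback_init_eq {y : Fin (k + 2) → ℝ} (hy : y ∈ O) (a b : Fin (k + 1)) :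
    (pullback h F (Fin.init y))⁻¹ a b =
      (pullback h f (zeroSection (k + 1) (Fin.init y)))⁻¹ a.castSucc b.castSucc := by
  rw [H.inv_pullback_eq_blockOne hh (H.zero_mem y hy) (zeroSection_last _),
    blockOne_castSucc_castSucc, init_zeroSection]

/-- The first normal derivative of `g^{nn}` vanishes along the hypersurface. -/
lemma pd_inv_last_last {y : Fin (k + 2) → ℝ} (hy : y ∈ O) (hy0 : y (Fin.last (k + 1)) = 0) :
    pd (fun z => (pullback h f z)⁻¹ (Fin.last (k + 1)) (Fin.last (k + 1))) (Fin.last (k + 1)) y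
      = 0 := by
  set n := Fin.last (k + 1) with hn
  have hO := H.isOpen
  have der : ∀ {u : (Fin (k + 2) → ℝ) → ℝ}, ContDiffOn ℝ ∞ u O →
      HasDerivAt (fun s => u (Function.update y n s)) (pd u n y) (y n) := fun {u} hu => by
    have hd : DifferentiableAt ℝ u (Function.update y n (y n)) := by
      rw [Function.update_eq_self]
      exact ((hu _ hy).contDiffAt (hO.mem_nhds hy)).differentiableAt (by simp)
    have := hasDerivAt_update hd
    rwa [Function.update_eq_self] at this
  have hinv := H.inv_pullback_eq_blockOne hh hy hy0
  have hg := H.pullback_eq_blockOne hh hy hy0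
  -- Differentiate Σ_β g^{nβ} g_{βn} = 1 in y^n. Both matrices are block diagonal at y^n = 0, so
  -- only β = n contributes, and ∂_n g_nn = 0 there.
  have h1 : HasDerivAt (fun s => ∑ β, (pullback h f (Function.update y n s))⁻¹ n β *
      pullback h f (Function.update y n s) β n)
      (∑ β, (pd (fun z => (pullback h f z)⁻¹ n β) n y * pullback h f y β n +
        (pullback h f y)⁻¹ n β * pd (fun z => pullback h f z β n) n y)) (y n) := by
    refine HasDerivAt.fun_sum fun β _ => ?_
    have := (der (H.contDiffOn_inv_pullback_apply hh n β)).mul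
      (der (H.contDiffOn_pullback_apply hh β n))
    rw [Function.update_eq_self] at this
    exact this
  have h2 : (fun s => ∑ β, (pullback h f (Function.update y n s))⁻¹ n β *
      pullback h f (Function.update y n s) β n) =ᶠ[𝓝 (y n)] fun _ => 1 := by
    have hc : ContinuousAt (fun s => Function.update y n s) (y n) := by fun_prop
    filter_upwards [hc.preimage_mem_nhds (hO.mem_nhds (by rwa [Function.update_eq_self]))] with s hs
    rw [← Matrix.mul_apply, Matrix.nonsing_inv_mul _ (isUnit_iff_ne_zero.2 (H.det_neg _ hs).ne),
      Matrix.one_apply_eq]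
  have h3 := (h1.congr_of_eventuallyEq h2.symm).unique (hasDerivAt_const _ _)
  rw [Fin.sum_univ_castSucc] at h3
  rw [hinv, hg] at h3
  simp only [hn, blockOne_castSucc_last, blockOne_last_castSucc, blockOne_last_last, mul_zero, zero_mul,
    add_zero, Finset.sum_const_zero, zero_add, mul_one, one_mul] at h3
  rwa [H.unit_deriv y hy hy0, add_zero] at h3

/-- Jacobi's formula gives ∂_n log √(-g) = tr(g⁻¹ ∂_n g) / 2. On {y^n = 0} the normal block
contributes nothing because ∂_n g_nn = 0, and the tangential block of ∂_n g is -2 times the second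
fundamental form; so the trace is -2 times the mean curvature, which is -κ. -/
lemma pd_sqrtNegDet_last {y : Fin (k + 2) → ℝ} (hy : y ∈ O) (hy0 : y (Fin.last (k + 1)) = 0) :
    -1 / sqrtNegDet h f y * pd (sqrtNegDet h f) (Fin.last (k + 1)) y = -κ (F (Fin.init y)) := by
  set n := Fin.last (k + 1) with hn
  have hO := H.isOpen
  have hz := zeroSection_init hy0
  have hw : zeroSection (k + 1) (Fin.init y) ∈ O := by rwa [hz]
  have der : ∀ {u : (Fin (k + 2) → ℝ) → ℝ}, ContDiffOn ℝ ∞ u O →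
      HasDerivAt (fun s => u (Function.update y n s)) (pd u n y) (y n) := fun {u} hu => by
    have hd : DifferentiableAt ℝ u (Function.update y n (y n)) := by
      rw [Function.update_eq_self]
      exact ((hu _ hy).contDiffAt (hO.mem_nhds hy)).differentiableAt (by simp)
    have := hasDerivAt_update hd
    rwa [Function.update_eq_self] at this
  let A' : Matrix (Fin (k + 2)) (Fin (k + 2)) ℝ :=
    Matrix.of fun α β => pd (fun z => pullback h f z α β) n y
  have h1 := hasDerivAt_det (A := fun s => pullback h f (Function.update y n s)) (A' := A')
    (t := y n) (fun i j => der (H.contDiffOn_pullback_apply hh i j))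
    (by rw [Function.update_eq_self]; exact (H.det_neg y hy).ne)
  rw [Function.update_eq_self] at h1
  have hneg := H.det_neg y hy
  have h2 : HasDerivAt (fun s => sqrtNegDet h f (Function.update y n s))
      (-((pullback h f y).det * ((pullback h f y)⁻¹ * A').trace) /
        (2 * √(-(pullback h f y).det))) (y n) := by
    have := h1.fun_neg.sqrt (by rw [Function.update_eq_self]; exact (neg_pos.2 hneg).ne')
    rwa [Function.update_eq_self] at this
  have h3 := (der (H.contDiffOn_sqrtNegDet hh)).unique h2
  have hs : √(-(pullback h f y).det) ≠ 0 := (H.sqrtNegDet_pos hy).ne'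
  have hsq : √(-(pullback h f y).det) ^ 2 = -(pullback h f y).det :=
    Real.sq_sqrt (by linarith)
  have htr : ((pullback h f y)⁻¹ * A').trace =
      -2 * meanCurvature h F (pd f n (zeroSection (k + 1) (Fin.init y))) (Fin.init y) := by
    rw [H.inv_pullback_eq_blockOne hh hy hy0]
    simp only [Matrix.trace, Matrix.diag, Matrix.mul_apply, Fin.sum_univ_castSucc (n := k + 1),
      blockOne_castSucc_castSucc, blockOne_castSucc_last, blockOne_last_castSucc,
      blockOne_last_last, zero_mul, Finset.sum_const_zero, zero_add, add_zero, one_mul]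
    have hnn : A' (Fin.last (k + 1)) (Fin.last (k + 1)) = 0 := H.unit_deriv y hy hy0
    rw [hnn, add_zero, meanCurvature, Finset.mul_sum]
    refine Finset.sum_congr rfl fun a _ => ?_
    rw [Finset.mul_sum]
    refine Finset.sum_congr rfl fun b _ => ?_
    have hab : A' b.castSucc a.castSucc = A' a.castSucc b.castSucc := by
      simp only [A', Matrix.of_apply]
      congr 1
      ext z
      exact (pullback_isSymm hh.symm f z).apply _ _
    have := H.pd_pullback_last hh hw a b
    rw [hz] at this ⊢
    rw [hab]
    simp only [A', Matrix.of_apply]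
    rw [this]
    ring
  rw [h3, H.curvature _ hw]
  rw [htr]
  simp only [sqrtNegDet]
  field_simp
  rw [hsq]
  ring

/-- Every quantity is smooth on `O`, and its order of vanishing on {y^n = 0} dictates the power of
|y^n|. A time derivative is tangential to {y^n = 0}, so it preserves the order of vanishing. One
constant serves for all entries because there are finitely many. -/
theorem exists_metricEstimates (hκ : ContDiff ℝ ∞ κ) (hK : IsCompact K) (hKO : K ⊆ O)
    (hstar : ∀ y ∈ K, ∀ θ ∈ Icc (0 : ℝ) 1,
      Function.update y (Fin.last (k + 1)) (θ * y (Fin.last (k + 1))) ∈ K) :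
    ∃ C, ∀ y ∈ K, MetricEstimates h κ F f C y := by
  have hO := H.isOpen
  have hg := H.contDiffOn_pullback_apply hh
  have hG := H.contDiffOn_inv_pullback_apply hh
  have hZ : ContDiffOn ℝ ∞ (fun y : Fin (k + 2) → ℝ => zeroSection (k + 1) (Fin.init y)) O :=
    ((zeroSection (k + 1)).comp (initL (k + 1))).contDiff.contDiffOn
  have hmaps : MapsTo (fun y : Fin (k + 2) → ℝ => zeroSection (k + 1) (Fin.init y)) O O :=
    H.zero_mem
  have lin : ∀ {u : (Fin (k + 2) → ℝ) → ℝ}, ContDiffOn ℝ ∞ u O →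
      (∀ y ∈ O, y (Fin.last (k + 1)) = 0 → u y = 0) →
      ∃ C, 0 ≤ C ∧ ∀ y ∈ K, |u y| ≤ C * |y (Fin.last (k + 1))| :=
    fun hu h0 => exists_abs_le_mul_abs hO hK hKO hstar hu h0
  have quad : ∀ {u : (Fin (k + 2) → ℝ) → ℝ}, ContDiffOn ℝ ∞ u O →
      (∀ y ∈ O, y (Fin.last (k + 1)) = 0 → u y = 0) →
      (∀ y ∈ O, y (Fin.last (k + 1)) = 0 → pd u (Fin.last (k + 1)) y = 0) →
      ∃ C, 0 ≤ C ∧ ∀ y ∈ K, |u y| ≤ C * y (Fin.last (k + 1)) ^ 2 :=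
    fun hu h0 h1 => exists_abs_le_mul_sq hO hK hKO hstar hu h0 h1
  have hG0 : ∀ y ∈ O, y (Fin.last (k + 1)) = 0 →
      (pullback h f y)⁻¹ = blockOne (pullback h F (Fin.init y))⁻¹ :=
    fun y hy hy0 => H.inv_pullback_eq_blockOne hh hy hy0
  have hGsymm : ∀ y α β, (pullback h f y)⁻¹ α β = (pullback h f y)⁻¹ β α := fun y α β =>
    ((pullback_isSymm hh.symm f y).inv).apply β α
  have pd_sub_one : ∀ (u : (Fin (k + 2) → ℝ) → ℝ) (i) (y), pd (fun z => u z - 1) i y = pd u i y :=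
    fun u i y => by unfold pd; rw [fderiv_sub_const]
  -- the metric
  obtain ⟨C₁, hC₁, b₁⟩ := exists_uniform_bound (K := K)
    (u := fun (p : Fin (k + 1) × Fin (k + 1)) y => pullback h f y p.1.castSucc p.2.castSucc -
      pullback h f (zeroSection (k + 1) (Fin.init y)) p.1.castSucc p.2.castSucc)
    (w := fun y => |y (Fin.last (k + 1))|) (fun _ => abs_nonneg _)
    (fun p => lin ((hg _ _).sub ((hg _ _).comp hZ hmaps)) fun y _ hy0 => by
      rw [zeroSection_init hy0, sub_self])
  obtain ⟨C₂, hC₂, b₂⟩ := exists_uniform_bound (K := K)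
    (u := fun (a : Fin (k + 1)) y => pullback h f y a.castSucc (Fin.last (k + 1)))
    (w := fun y => |y (Fin.last (k + 1))|) (fun _ => abs_nonneg _)
    (fun a => lin (hg _ _) fun y hy hy0 => by
      rw [H.pullback_eq_blockOne hh hy hy0, blockOne_castSucc_last])
  obtain ⟨C₃, hC₃, b₃⟩ := quad
    (u := fun y => pullback h f y (Fin.last (k + 1)) (Fin.last (k + 1)) - 1)
    ((hg _ _).sub contDiffOn_const)
    (fun y hy hy0 => by rw [H.pullback_eq_blockOne hh hy hy0, blockOne_last_last, sub_self])
    (fun y hy hy0 => by rw [pd_sub_one]; exact H.unit_deriv y hy hy0)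
  -- the inverse metric
  obtain ⟨C₄, hC₄, b₄⟩ := exists_uniform_bound (K := K)
    (u := fun (p : Fin (k + 1) × Fin (k + 1)) y => (pullback h f y)⁻¹ p.1.castSucc p.2.castSucc -
      (pullback h f (zeroSection (k + 1) (Fin.init y)))⁻¹ p.1.castSucc p.2.castSucc)
    (w := fun y => |y (Fin.last (k + 1))|) (fun _ => abs_nonneg _)
    (fun p => lin ((hG _ _).sub ((hG _ _).comp hZ hmaps)) fun y _ hy0 => by
      rw [zeroSection_init hy0, sub_self])
  have hmix : ∀ (a : Fin (k + 1)), ∀ y ∈ O, y (Fin.last (k + 1)) = 0 →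
      (pullback h f y)⁻¹ a.castSucc (Fin.last (k + 1)) = 0 := fun a y hy hy0 => by
    rw [hG0 y hy hy0, blockOne_castSucc_last]
  obtain ⟨C₅, hC₅, b₅⟩ := exists_uniform_bound (K := K)
    (u := fun (a : Fin (k + 1)) y => (pullback h f y)⁻¹ a.castSucc (Fin.last (k + 1)))
    (w := fun y => |y (Fin.last (k + 1))|) (fun _ => abs_nonneg _)
    (fun a => lin (hG _ _) (hmix a))
  have hnn : ContDiffOn ℝ ∞
      (fun y => (pullback h f y)⁻¹ (Fin.last (k + 1)) (Fin.last (k + 1)) - 1) O :=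
    (hG _ _).sub contDiffOn_const
  have hnn0 : ∀ y ∈ O, y (Fin.last (k + 1)) = 0 →
      (pullback h f y)⁻¹ (Fin.last (k + 1)) (Fin.last (k + 1)) - 1 = 0 := fun y hy hy0 => by
    rw [hG0 y hy hy0, blockOne_last_last, sub_self]
  obtain ⟨C₆, hC₆, b₆⟩ := quad hnn hnn0
    (fun y hy hy0 => by rw [pd_sub_one]; exact H.pd_inv_last_last hh hy hy0)
  -- the time derivative of the inverse metric
  obtain ⟨C₇, hC₇, b₇⟩ := exists_uniform_bound (K := K)
    (u := fun (p : Fin (k + 1) × Fin (k + 1)) y =>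
      pd (fun z => (pullback h f z)⁻¹ p.1.castSucc p.2.castSucc) 0 y)
    (w := fun _ => 1) (fun _ => zero_le_one)
    (fun p => by simpa using exists_abs_le hK hKO (contDiffOn_pd hO (hG _ _) 0))
  obtain ⟨C₈, hC₈, b₈⟩ := exists_uniform_bound (K := K)
    (u := fun (a : Fin (k + 1)) y =>
      pd (fun z => (pullback h f z)⁻¹ a.castSucc (Fin.last (k + 1))) 0 y)
    (w := fun y => |y (Fin.last (k + 1))|) (fun _ => abs_nonneg _)
    (fun a => lin (contDiffOn_pd hO (hG _ _) 0) fun y hy hy0 =>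
      pd_castSucc_eq_zero hO (hG _ _) (hmix a) hy hy0 0)
  obtain ⟨C₉, hC₉, b₉⟩ := quad
    (u := pd (fun y => (pullback h f y)⁻¹ (Fin.last (k + 1)) (Fin.last (k + 1)) - 1) 0)
    (contDiffOn_pd hO hnn 0) (fun y hy hy0 => pd_castSucc_eq_zero hO hnn hnn0 hy hy0 0)
    (fun y hy hy0 => by
      -- ∂_n ∂_0 g^nn = ∂_0 ∂_n g^nn, and ∂_n g^nn already vanishes along the hypersurface.
      rw [pd_comm hO hnn hy]
      refine pd_castSucc_eq_zero hO (contDiffOn_pd hO hnn _) (fun z hz hz0 => ?_) hy hy0 0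
      rw [pd_sub_one]
      exact H.pd_inv_last_last hh hz hz0)
  -- the divergence
  have hsq := H.contDiffOn_sqrtNegDet hh
  have hquot : ContDiffOn ℝ ∞ (fun y => -1 / sqrtNegDet h f y) O :=
    contDiffOn_const.div hsq fun y hy => (H.sqrtNegDet_pos hy).ne'
  have hdiv : ContDiffOn ℝ ∞ (normalDivergence h f) O :=
    hquot.mul (ContDiffOn.sum fun α _ => (hG _ α).mul (contDiffOn_pd hO hsq α))
  have hdiv0 : ∀ y ∈ O, y (Fin.last (k + 1)) = 0 → normalDivergence h f y =
      -1 / sqrtNegDet h f y * pd (sqrtNegDet h f) (Fin.last (k + 1)) y := fun y hy hy0 => by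
    unfold normalDivergence
    rw [Fin.sum_univ_castSucc, hG0 y hy hy0]
    simp
  obtain ⟨C₁₀, hC₁₀, b₁₀⟩ := lin
    (u := fun y => normalDivergence h f y -
      -1 / sqrtNegDet h f y * pd (sqrtNegDet h f) (Fin.last (k + 1)) y)
    (hdiv.sub (hquot.mul (contDiffOn_pd hO hsq _)))
    (fun y hy hy0 => by rw [hdiv0 y hy hy0, sub_self])
  obtain ⟨C₁₁, hC₁₁, b₁₁⟩ := lin
    (u := fun y => normalDivergence h f y - -κ (f (zeroSection (k + 1) (Fin.init y))))
    (hdiv.sub (hκ.comp_contDiffOn (H.smooth.comp hZ hmaps)).neg)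
    (fun y hy hy0 => by
      rw [hdiv0 y hy hy0, H.pd_sqrtNegDet_last hh hy hy0, H.eq_zeroSection _ (H.zero_mem y hy),
        sub_self])
  set C := C₁ + C₂ + C₃ + C₄ + C₅ + C₆ + C₇ + C₈ + C₉ + C₁₀ + C₁₁ with hC
  refine ⟨C, fun y hy => ?_⟩
  have hyO := hKO hy
  have weak : ∀ {c t w : ℝ}, |t| ≤ c * w → c ≤ C → 0 ≤ w → |t| ≤ C * w := fun h1 h2 h3 =>
    h1.trans (mul_le_mul_of_nonneg_right h2 h3)
  have hz := H.zero_mem y hyO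
  refine ⟨⟨fun a b => ?_, fun a => ⟨?_, ?_⟩, ?_⟩, ⟨fun a b => ?_, fun a => ⟨?_, ?_⟩, ?_⟩,
    ⟨fun a b => ?_, fun a => ⟨?_, ?_⟩, ?_⟩, ?_, ?_⟩
  · rw [Matrix.sub_apply, blockOne_castSucc_castSucc, H.toIsTubeChart.pullback_eq hz]
    exact weak (b₁ (a, b) y hy) (by linarith) (abs_nonneg _)
  · rw [Matrix.sub_apply, blockOne_castSucc_last, sub_zero]
    exact weak (b₂ a y hy) (by linarith) (abs_nonneg _)
  · rw [Matrix.sub_apply, blockOne_last_castSucc, sub_zero,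
      (pullback_isSymm hh.symm f y).apply]
    exact weak (b₂ a y hy) (by linarith) (abs_nonneg _)
  · rw [Matrix.sub_apply, blockOne_last_last]
    exact weak (b₃ y hy) (by linarith) (sq_nonneg _)
  · rw [Matrix.sub_apply, blockOne_castSucc_castSucc, H.inv_pullback_init_eq hh hyO]
    exact weak (b₄ (a, b) y hy) (by linarith) (abs_nonneg _)
  · rw [Matrix.sub_apply, blockOne_castSucc_last, sub_zero]
    exact weak (b₅ a y hy) (by linarith) (abs_nonneg _)
  · rw [Matrix.sub_apply, blockOne_last_castSucc, sub_zero, hGsymm]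
    exact weak (b₅ a y hy) (by linarith) (abs_nonneg _)
  · rw [Matrix.sub_apply, blockOne_last_last]
    exact weak (b₆ y hy) (by linarith) (sq_nonneg _)
  · have : |_| ≤ C * 1 := weak (b₇ (a, b) y hy) (by linarith) zero_le_one
    rwa [mul_one] at this
  · exact weak (b₈ a y hy) (by linarith) (abs_nonneg _)
  · simp only [Matrix.of_apply, hGsymm _ (Fin.last (k + 1))]
    exact weak (b₈ a y hy) (by linarith) (abs_nonneg _)
  · have := b₉ y hy
    rw [pd_sub_one] at this
    exact weak this (by linarith) (sq_nonneg _)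
  · exact weak (b₁₀ y hy) (by linarith) (abs_nonneg _)
  · rw [H.eq_zeroSection _ hz]
    exact weak (b₁₁ y hy) (by linarith) (abs_nonneg _)

end IsNormalTubeChart

end Tube

/-! ### Smoothness of superposition operators -/

section Superposition

universe u

variable {K : Type*} [TopologicalSpace K] [CompactSpace K]
  {E F : Type u} [NormedAddCommGroup E] [NormedSpace ℝ E] [NormedAddCommGroup F] [NormedSpace ℝ F]

/-- Pointwise application of a continuous family of linear maps, as a bilinear map. -/
def pointwiseApply : C(K, E →L[ℝ] F) →L[ℝ] C(K, E) →L[ℝ] C(K, F) :=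
  LinearMap.mkContinuous₂
    (LinearMap.mk₂ ℝ (fun (A : C(K, E →L[ℝ] F)) (u : C(K, E)) =>
        (⟨fun r => A r (u r), A.continuous.clm_apply u.continuous⟩ : C(K, F)))
      (fun A B u => by ext; simp) (fun c A u => by ext; simp)
      (fun A u w => by ext; simp) (fun c A u => by ext; simp)) 1
    (fun A u => by
      rw [one_mul]
      refine (ContinuousMap.norm_le _ (by positivity)).2 fun r => ?_
      exact ((A r).le_opNorm _).trans
        (mul_le_mul (A.norm_coe_le_norm r) (u.norm_coe_le_norm r) (norm_nonneg (u r)) (norm_nonneg A)))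

/-- Compactness of `s` makes `fderiv ℝ V` uniformly continuous at the points of `s`, with the second
point free in `E`. This matters because `E` need not be locally compact. -/
lemma exists_uniform_linearization {V : E → F} (hV : ContDiff ℝ 1 V) {s : Set E} (hs : IsCompact s)
    {ε : ℝ} (hε : 0 < ε) :
    ∃ δ > 0, ∀ x ∈ s, ∀ w : E, ‖w‖ < δ → ‖V (x + w) - V x - fderiv ℝ V x w‖ ≤ ε * ‖w‖ := by
  have hc : Continuous (fderiv ℝ V) := hV.continuous_fderiv one_ne_zero
  have hu := hs.uniformContinuousAt_of_continuousAt (fderiv ℝ V) (fun a _ => hc.continuousAt)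
    (Metric.dist_mem_uniformity hε)
  obtain ⟨δ, hδ, h⟩ := Metric.mem_uniformity_dist.1 hu
  refine ⟨δ, hδ, fun x hx w hw => ?_⟩
  have key := (convex_ball x δ).norm_image_sub_le_of_norm_hasFDerivWithin_le' (f := V)
    (f' := fderiv ℝ V) (φ := fderiv ℝ V x) (C := ε) (x := x) (y := x + w)
    (fun y _ => ((hV.differentiable one_ne_zero) y).hasFDerivAt.hasFDerivWithinAt)
    (fun y hy => by
      have := h (a := x) (b := y) (by rw [dist_comm]; exact hy) hx
      rw [mem_ofPred_eq, dist_comm, dist_eq_norm] at this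
      exact this.le)
    (Metric.mem_ball_self hδ) (by simpa [Metric.mem_ball, dist_eq_norm] using hw)
  simpa using key

/-- The range of `u` is compact, so the first-order remainder is small uniformly in the parameter,
which is what the sup norm requires. -/
lemma hasFDerivAt_superposition {V : E → F} (hV : ContDiff ℝ 1 V) (u : C(K, E)) :
    HasFDerivAt (fun u : C(K, E) => (ContinuousMap.mk V hV.continuous).comp u)
      (pointwiseApply
        ((ContinuousMap.mk (fderiv ℝ V) (hV.continuous_fderiv one_ne_zero)).comp u)) u := by
  rw [hasFDerivAt_iff_isLittleO_nhds_zero, Asymptotics.isLittleO_iff]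
  intro ε hε
  obtain ⟨δ, hδ, h⟩ := exists_uniform_linearization hV (isCompact_range u.continuous) hε
  filter_upwards [Metric.ball_mem_nhds (0 : C(K, E)) hδ] with w hw
  refine (ContinuousMap.norm_le _ (by positivity)).2 fun r => ?_
  have hwr : ‖w r‖ ≤ ‖w‖ := w.norm_coe_le_norm r
  have hw' : ‖w‖ < δ := by simpa using hw
  refine (h (u r) (mem_range_self r) (w r) (hwr.trans_lt hw')).trans ?_
  gcongr

/-- The derivative is superposition with `fderiv ℝ V`, one degree less smooth, followed by the
continuous linear map `pointwiseApply`. The induction passes from `F` to `E →L[ℝ] F`, which is why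
both spaces live in one universe. -/
lemma contDiff_superposition_nat (n : ℕ) {F : Type u} [NormedAddCommGroup F] [NormedSpace ℝ F]
    (V : C(E, F)) (hV : ContDiff ℝ n V) : ContDiff ℝ n (fun u : C(K, E) => V.comp u) := by
  induction n generalizing F with
  | zero =>
    exact contDiff_zero.2 (ContinuousMap.continuous_postcomp _)
  | succ n ih =>
    have h1 : ContDiff ℝ 1 V := hV.of_le (by exact_mod_cast Nat.le_add_left 1 n)
    have h2 : ContDiff ℝ n (fderiv ℝ V) := hV.fderiv_right (by exact_mod_cast le_rfl)
    have : ((n + 1 : ℕ) : WithTop ℕ∞) = (n : WithTop ℕ∞) + 1 := by norm_cast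
    rw [this, contDiff_succ_iff_hasFDerivAt]
    refine ⟨fun u => pointwiseApply
      ((ContinuousMap.mk (fderiv ℝ V) (h1.continuous_fderiv one_ne_zero)).comp u), ?_,
      fun u => hasFDerivAt_superposition h1 u⟩
    exact pointwiseApply.contDiff.comp
      (ih (ContinuousMap.mk (fderiv ℝ V) (h1.continuous_fderiv one_ne_zero)) h2)

lemma contDiff_superposition (V : C(E, F)) (hV : ContDiff ℝ ∞ V) :
    ContDiff ℝ ∞ (fun u : C(K, E) => V.comp u) :=
  contDiff_infty.2 fun n => contDiff_superposition_nat n V (contDiff_infty.1 hV n)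

end Superposition

/-! ### The inverse function theorem on open sets -/

section InverseFunction

variable {E F : Type*} [NormedAddCommGroup E] [NormedSpace ℝ E] [CompleteSpace E]
  [NormedAddCommGroup F] [NormedSpace ℝ F]

/-- The inverse function theorem, with a smooth inverse on the whole target. -/
lemma exists_openPartialHomeomorph {f : E → F} {U : Set E} (hU : IsOpen U)
    (hf : ContDiffOn ℝ ∞ f U) {a : E} (ha : a ∈ U) (f' : E ≃L[ℝ] F)
    (hf' : HasFDerivAt f (f' : E →L[ℝ] F) a) :
    ∃ P : OpenPartialHomeomorph E F, a ∈ P.source ∧ P.source ⊆ U ∧ (∀ x, P x = f x) ∧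
      ContDiffOn ℝ ∞ P.symm P.target := by
  have hfa : ContDiffAt ℝ ∞ f a := hf.contDiffAt (hU.mem_nhds ha)
  let P₀ := hfa.toOpenPartialHomeomorph f hf' (by simp)
  have hcont : ContinuousOn (fderiv ℝ f) U := hf.continuousOn_fderiv_of_isOpen hU (by simp)
  have hinv : ∀ᶠ x in 𝓝 a, fderiv ℝ f x ∈ range ((↑) : (E ≃L[ℝ] F) → E →L[ℝ] F) := by
    have h1 : ContinuousAt (fderiv ℝ f) a := hcont.continuousAt (hU.mem_nhds ha)
    have h2 := ContinuousLinearEquiv.nhds f'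
    rw [← hf'.fderiv] at h2
    exact h1 h2
  -- Invertible maps form an open set. Restricting the source to where the derivative stays
  -- invertible makes the inverse smooth at every point of the target, not only at the image of `a`.
  obtain ⟨W, hW, hWo, haW⟩ := eventually_nhds_iff.1 (hinv.and (hU.mem_nhds ha))
  refine ⟨P₀.restrOpen W hWo, ⟨hfa.mem_toOpenPartialHomeomorph_source hf' (by simp), haW⟩,
    fun x hx => (hW x hx.2).2, fun x => rfl, fun b hb => ContDiffAt.contDiffWithinAt ?_⟩
  have hb' := (P₀.restrOpen W hWo).map_target hb
  obtain ⟨g, hg⟩ := (hW _ hb'.2).1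
  have hd : ContDiffAt ℝ ∞ f ((P₀.restrOpen W hWo).symm b) :=
    hf.contDiffAt (hU.mem_nhds (hW _ hb'.2).2)
  refine OpenPartialHomeomorph.contDiffAt_symm (P₀.restrOpen W hWo) (f₀' := g) hb ?_ hd
  rw [hg]
  exact (hd.differentiableAt (by simp)).hasFDerivAt

end InverseFunction

/-! ### Smooth dependence of the solutions of ordinary differential equations on the data -/

section Flow

variable {E : Type*} [NormedAddCommGroup E] [NormedSpace ℝ E] [CompleteSpace E]

lemma continuous_comp_projIcc (u : C(Icc (0 : ℝ) 1, E)) :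
    Continuous fun s : ℝ => u (projIcc 0 1 zero_le_one s) :=
  u.continuous.comp continuous_projIcc

/-- The primitive vanishing at `0`, as an operator on the continuous functions on `[0, 1]`. -/
def primitive : C(Icc (0 : ℝ) 1, E) →L[ℝ] C(Icc (0 : ℝ) 1, E) :=
  LinearMap.mkContinuous
    { toFun := fun u => ⟨fun r => ∫ s in (0 : ℝ)..r, u (projIcc 0 1 zero_le_one s),
        (intervalIntegral.continuous_primitive
          (fun a b => (continuous_comp_projIcc u).intervalIntegrable a b) 0).comp
          continuous_subtype_val⟩
      map_add' := fun u w => by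
        ext r
        exact intervalIntegral.integral_add ((continuous_comp_projIcc u).intervalIntegrable _ _)
          ((continuous_comp_projIcc w).intervalIntegrable _ _)
      map_smul' := fun c u => by
        ext r
        exact intervalIntegral.integral_smul c _ } 1 (fun u => by
      rw [one_mul]
      refine (ContinuousMap.norm_le _ (norm_nonneg u)).2 fun r => ?_
      have h := intervalIntegral.norm_integral_le_of_norm_le_const (a := (0 : ℝ)) (b := r)
        (C := ‖u‖) (f := fun s => u (projIcc 0 1 zero_le_one s))
        (fun s _ => u.norm_coe_le_norm _)
      refine h.trans ?_
      rw [sub_zero, abs_of_nonneg r.2.1]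
      exact mul_le_of_le_one_right (norm_nonneg u) r.2.2)

lemma primitive_apply (u : C(Icc (0 : ℝ) 1, E)) (r : Icc (0 : ℝ) 1) :
    primitive u r = ∫ s in (0 : ℝ)..r, u (projIcc 0 1 zero_le_one s) := rfl

/-- Restriction of a path to `[0, θ]`, reparametrized over `[0, 1]`. -/
def dilate (θ : Icc (0 : ℝ) 1) (u : C(Icc (0 : ℝ) 1, E)) : C(Icc (0 : ℝ) 1, E) :=
  ⟨fun r => u (θ * r), u.continuous.comp (continuous_const.mul continuous_id)⟩

/-- Substitution s ↦ θ s. Through this scaling a solution of the integral equation for τ becomes,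
after `dilate θ`, a solution for θ τ. -/
lemma primitive_dilate (θ : Icc (0 : ℝ) 1) (u : C(Icc (0 : ℝ) 1, E)) (r : Icc (0 : ℝ) 1) :
    (θ : ℝ) • primitive (dilate θ u) r = primitive u (θ * r) := by
  rw [primitive_apply, primitive_apply]
  have h := intervalIntegral.smul_integral_comp_mul_left (a := 0) (b := (r : ℝ))
    (fun s : ℝ => u (projIcc 0 1 zero_le_one s)) (θ : ℝ)
  rw [mul_zero] at h
  rw [show ((θ * r : Icc (0 : ℝ) 1) : ℝ) = (θ : ℝ) * r from rfl, ← h]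
  congr 1
  refine intervalIntegral.integral_congr fun s hs => ?_
  rw [uIcc_of_le r.2.1] at hs
  have hs1 : s ∈ Icc (0 : ℝ) 1 := ⟨hs.1, hs.2.trans r.2.2⟩
  have hs2 : (θ : ℝ) * s ∈ Icc (0 : ℝ) 1 := (θ * ⟨s, hs1⟩).2
  simp only [dilate, ContinuousMap.coe_mk]
  rw [projIcc_of_mem _ hs1, projIcc_of_mem _ hs2]
  rfl

/-- Near `((x₀, 0), x₀)`, the solution of `u = x + τ ∫ V(u)` in `C([0, 1], E)` depends smoothly on
`(x, τ)`. -/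
lemma exists_integralEquation_solution {V : E → E} (hV : ContDiff ℝ ∞ V) (x₀ : E) :
    ∃ δ > 0, ∃ U : E × ℝ → C(Icc (0 : ℝ) 1, E),
      ContDiffOn ℝ ∞ U (Metric.ball (x₀, 0) δ) ∧
      (∀ q ∈ Metric.ball (x₀, (0 : ℝ)) δ, ∀ r,
        U q r = q.1 + q.2 • ∫ s in (0 : ℝ)..r, V (U q (projIcc 0 1 zero_le_one s))) ∧
      ∀ x τ, (x, τ) ∈ Metric.ball (x₀, (0 : ℝ)) δ → ∀ θ : Icc (0 : ℝ) 1,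
        U (x, θ * τ) = dilate θ (U (x, τ)) := by
  let VC : C(E, E) := ⟨V, hV.continuous⟩
  let cst : E →L[ℝ] C(Icc (0 : ℝ) 1, E) := ContinuousLinearMap.const ℝ (Icc (0 : ℝ) 1)
  -- The parameters are carried along unchanged, and the last component measures the failure of the
  -- integral equation. At τ = 0 its derivative in u is the identity, so the full derivative is an
  -- invertible skew product.
  let f : (E × ℝ) × C(Icc (0 : ℝ) 1, E) → (E × ℝ) × C(Icc (0 : ℝ) 1, E) := fun q =>
    (q.1, q.2 - cst q.1.1 - q.1.2 • primitive (VC.comp q.2))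
  have hN : ContDiff ℝ ∞ fun u : C(Icc (0 : ℝ) 1, E) => primitive (VC.comp u) :=
    (primitive (E := E)).contDiff.comp (contDiff_superposition VC hV)
  have hf : ContDiff ℝ ∞ f := by
    refine contDiff_fst.prodMk ((contDiff_snd.sub (cst.contDiff.comp
      (contDiff_fst.comp contDiff_fst))).sub ?_)
    exact (contDiff_snd.comp contDiff_fst).smul (hN.comp contDiff_snd)
  let L : E × ℝ →L[ℝ] C(Icc (0 : ℝ) 1, E) :=
    -(cst.comp (ContinuousLinearMap.fst ℝ E ℝ)) -
      (ContinuousLinearMap.snd ℝ E ℝ).smulRight (primitive (VC.comp (cst x₀)))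
  let f' := (ContinuousLinearEquiv.refl ℝ (E × ℝ)).skewProd
    (ContinuousLinearEquiv.refl ℝ C(Icc (0 : ℝ) 1, E)) L
  have hf' : HasFDerivAt f (f' : _ →L[ℝ] _) ((x₀, 0), cst x₀) := by
    have h1 : HasFDerivAt (fun q : (E × ℝ) × C(Icc (0 : ℝ) 1, E) => q.1)
      (ContinuousLinearMap.fst ℝ _ _) ((x₀, 0), cst x₀) := hasFDerivAt_fst
    have h2 : HasFDerivAt (fun q : (E × ℝ) × C(Icc (0 : ℝ) 1, E) => q.2)
      (ContinuousLinearMap.snd ℝ _ _) ((x₀, 0), cst x₀) := hasFDerivAt_snd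
    have h3 := (((hN.differentiable (by simp)) (cst x₀)).hasFDerivAt).comp
      ((x₀, 0), cst x₀) h2
    have h4 := h1.prodMk ((h2.sub (cst.hasFDerivAt.comp _ (h1.fst))).sub (h1.snd.smul h3))
    refine h4.congr_fderiv ?_
    ext q <;> simp [f', L, ContinuousLinearEquiv.skewProd_apply, sub_eq_add_neg]
  obtain ⟨P, hP, -, hPf, hPs⟩ :=
    exists_openPartialHomeomorph isOpen_univ hf.contDiffOn (mem_univ _) f' hf'
  obtain ⟨ε, hε, hball⟩ := Metric.isOpen_iff.1 P.open_source _ hP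
  have hbase : P ((x₀, 0), cst x₀) = ((x₀, 0), 0) := by rw [hPf]; simp [f]
  have hmem : ((x₀, (0 : ℝ)), (0 : C(Icc (0 : ℝ) 1, E))) ∈ P.target := by
    rw [← hbase]; exact P.map_source hP
  have hsymm : P.symm ((x₀, 0), 0) = ((x₀, 0), cst x₀) := by rw [← hbase]; exact P.left_inv hP
  have hcont : ContinuousAt P.symm ((x₀, 0), 0) := P.continuousAt_symm hmem
  have hev : ∀ᶠ q in 𝓝 ((x₀, (0 : ℝ)), (0 : C(Icc (0 : ℝ) 1, E))),
      q ∈ P.target ∧ P.symm q ∈ Metric.ball ((x₀, (0 : ℝ)), cst x₀) ε :=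
    (eventually_mem_set.2 (P.open_target.mem_nhds hmem)).and
      (hcont (by rw [hsymm]; exact Metric.ball_mem_nhds _ hε))
  have hev' : ∀ᶠ q in 𝓝 (x₀, (0 : ℝ)), (q, (0 : C(Icc (0 : ℝ) 1, E))) ∈ P.target ∧
      P.symm (q, 0) ∈ Metric.ball ((x₀, (0 : ℝ)), cst x₀) ε :=
    ((Continuous.prodMk_left (0 : C(Icc (0 : ℝ) 1, E))).tendsto (x₀, (0 : ℝ))).eventually hev
  obtain ⟨δ, hδ, hδ'⟩ := Metric.eventually_nhds_iff_ball.1 hev'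
  have hfst : ∀ q ∈ Metric.ball (x₀, (0 : ℝ)) δ, (P.symm (q, 0)).1 = q := fun q hq => by
    have := P.right_inv (hδ' q hq).1
    rw [hPf] at this
    exact congrArg Prod.fst this
  have hsol : ∀ q ∈ Metric.ball (x₀, (0 : ℝ)) δ,
      (P.symm (q, 0)).2 = cst q.1 + q.2 • primitive (VC.comp (P.symm (q, 0)).2) := fun q hq => by
    have := P.right_inv (hδ' q hq).1
    rw [hPf] at this
    have := congrArg Prod.snd this
    simp only [f, hfst q hq] at this
    rw [sub_sub, sub_eq_zero] at this
    exact this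
  refine ⟨δ, hδ, fun q => (P.symm (q, 0)).2, ?_, fun q hq r => ?_, fun x τ hx θ => ?_⟩
  · exact contDiff_snd.comp_contDiffOn (hPs.comp (by fun_prop) fun q hq => (hδ' q hq).1)
  · change (P.symm (q, 0)).2 r = _
    conv_lhs => rw [hsol q hq]
    rfl
  · have hu := hsol _ hx
    have hub := (hδ' _ hx).2
    set u := (P.symm ((x, τ), 0)).2 with hudef
    have hxτ : P.symm ((x, τ), 0) = ((x, τ), u) := Prod.ext (hfst _ hx) rfl
    rw [hxτ] at hub
    have habs : |(θ : ℝ) * τ| ≤ |τ| := by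
      rw [abs_mul, abs_of_nonneg θ.2.1]
      exact mul_le_of_le_one_left (abs_nonneg τ) θ.2.2
    -- Dilation increases neither |τ| nor the sup distance to the constant path, so the dilated
    -- solution stays in the ball on which `P` is injective. It is therefore the solution selected
    -- for θ τ.
    have hin : ((x, (θ : ℝ) * τ), dilate θ u) ∈ P.source := by
      apply hball
      simp only [Metric.mem_ball, Prod.dist_eq, max_lt_iff, dist_zero_right, Real.norm_eq_abs]
        at hub ⊢
      refine ⟨⟨hub.1.1, habs.trans_lt hub.1.2⟩, ?_⟩
      rw [ContinuousMap.dist_lt_iff hε]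
      exact fun r => (ContinuousMap.dist_apply_le_dist (θ * r)).trans_lt hub.2
    have himg : P ((x, (θ : ℝ) * τ), dilate θ u) = ((x, (θ : ℝ) * τ), 0) := by
      rw [hPf]
      refine Prod.ext rfl ?_
      ext r
      have h1 : u (θ * r) = x + τ • primitive (VC.comp u) (θ * r) := by
        conv_lhs => rw [hu]
        rfl
      have h2 := primitive_dilate θ (VC.comp u) r
      simp only [f]
      change u (θ * r) - x - ((θ : ℝ) * τ) • primitive (VC.comp (dilate θ u)) r = 0
      rw [h1, ← h2, show VC.comp (dilate θ u) = dilate θ (VC.comp u) from rfl, smul_smul,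
        mul_comm τ]
      abel
    change (P.symm ((x, (θ : ℝ) * τ), 0)).2 = _
    rw [← himg, P.left_inv hin]

/-- The flow is the endpoint at parameter 1 of the path solving the integral equation for τ = t. By
the dilation property one path contains all intermediate times, so the fundamental theorem of
calculus gives the differential equation. -/
theorem exists_localFlow {V : E → E} (hV : ContDiff ℝ ∞ V) (x₀ : E) :
    ∃ δ > 0, ∃ Fl : ℝ × E → E, ContDiffOn ℝ ∞ Fl (Ioo (-δ) δ ×ˢ Metric.ball x₀ δ) ∧
      (∀ x ∈ Metric.ball x₀ δ, Fl (0, x) = x) ∧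
      ∀ t ∈ Ioo (-δ) δ, ∀ x ∈ Metric.ball x₀ δ,
        HasDerivAt (fun s => Fl (s, x)) (V (Fl (t, x))) t := by
  obtain ⟨δ, hδ, U, hU, hsol, hdil⟩ := exists_integralEquation_solution hV x₀
  have hball : ∀ x ∈ Metric.ball x₀ (δ / 2), ∀ τ, |τ| < δ → (x, τ) ∈ Metric.ball (x₀, (0 : ℝ)) δ := by
    intro x hx τ hτ
    simp only [Metric.mem_ball, Prod.dist_eq, max_lt_iff, dist_zero_right, Real.norm_eq_abs] at hx ⊢
    exact ⟨by linarith, hτ⟩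
  let Fl : ℝ × E → E := fun q => U (q.2, q.1) 1
  have hFl : ContDiffOn ℝ ∞ Fl (Ioo (-(δ / 2)) (δ / 2) ×ˢ Metric.ball x₀ (δ / 2)) := by
    have h1 : ContDiffOn ℝ ∞ (fun q : ℝ × E => U (q.2, q.1))
        (Ioo (-(δ / 2)) (δ / 2) ×ˢ Metric.ball x₀ (δ / 2)) :=
      hU.comp (by fun_prop) fun q hq => hball _ hq.2 _ (by
        have := abs_lt.2 hq.1; linarith)
    exact (ContinuousMap.evalCLM ℝ (1 : Icc (0 : ℝ) 1)).contDiff.comp_contDiffOn h1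
  have hval : ∀ x ∈ Metric.ball x₀ (δ / 2), ∀ τ, |τ| < δ → ∀ θ : Icc (0 : ℝ) 1,
      Fl (θ * τ, x) = U (x, τ) θ := by
    intro x hx τ hτ θ
    change U (x, θ * τ) 1 = _
    rw [hdil x τ (hball x hx τ hτ)]
    change U (x, τ) (θ * 1) = _
    rw [mul_one]
  have hne : ∀ t ∈ Ioo (-(δ / 2)) (δ / 2), t ≠ 0 → ∀ x ∈ Metric.ball x₀ (δ / 2),
      HasDerivAt (fun s => Fl (s, x)) (V (Fl (t, x))) t := by
    intro t ht ht0 x hx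
    -- The path for time 2t passes through time t at the interior parameter 1/2, where a two-sided
    -- derivative is available; this costs half of the radius δ.
    have hτ : |2 * t| < δ := by
      have := abs_lt.2 ht; rw [abs_mul, abs_two]; linarith
    have hc : Continuous fun s : ℝ => V (U (x, 2 * t) (projIcc 0 1 zero_le_one s)) :=
      hV.continuous.comp (continuous_comp_projIcc _)
    have hhalf : (1 / 2 : ℝ) ∈ Icc (0 : ℝ) 1 := by constructor <;> norm_num
    have h1 : HasDerivAt (fun θ : ℝ => x + (2 * t) •
        ∫ s in (0 : ℝ)..θ, V (U (x, 2 * t) (projIcc 0 1 zero_le_one s)))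
        ((2 * t) • V (U (x, 2 * t) (projIcc 0 1 zero_le_one (1 / 2)))) (1 / 2) :=
      ((hc.integral_hasStrictDerivAt 0 (1 / 2)).hasDerivAt.const_smul (2 * t)).const_add x
    have h2 : HasDerivAt (fun s : ℝ => s / (2 * t)) (1 / (2 * t)) t :=
      (hasDerivAt_id t).div_const _
    have ht2 : t / (2 * t) = 1 / 2 := by field_simp
    rw [← ht2] at h1
    have h3 := h1.scomp t h2
    rw [ht2, smul_smul, one_div_mul_cancel (by simpa using ht0), one_smul] at h3
    rw [projIcc_of_mem _ hhalf] at h3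
    have h4 : Fl (t, x) = U (x, 2 * t) ⟨1 / 2, hhalf⟩ := by
      rw [← hval x hx _ hτ]
      congr 2
      change t = 1 / 2 * (2 * t)
      ring
    rw [h4]
    refine h3.congr_of_eventuallyEq ?_
    have h5 : ∀ᶠ s in 𝓝 t, s / (2 * t) ∈ Ioo (0 : ℝ) 1 :=
      h2.continuousAt.eventually (Ioo_mem_nhds (by simp only [ht2]; norm_num)
        (by simp only [ht2]; norm_num))
    filter_upwards [h5] with s hs
    have h6 := hval x hx _ hτ ⟨s / (2 * t), Ioo_subset_Icc_self hs⟩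
    have h7 : s / (2 * t) * (2 * t) = s := div_mul_cancel₀ _ (by simpa using ht0)
    simp only [h7] at h6
    rw [h6, hsol _ (hball x hx _ hτ)]
    rfl
  refine ⟨δ / 2, by positivity, Fl, hFl, fun x hx => ?_, fun t ht x hx => ?_⟩
  · change U (x, 0) 1 = x
    rw [hsol _ (hball x hx 0 (by simpa using hδ))]
    simp
  · rcases eq_or_ne t 0 with rfl | ht0
    -- At t = 0 the path degenerates. Both sides of the equation are continuous there and agree for
    -- t ≠ 0.
    · have hsm : ContDiffOn ℝ ∞ (fun s => Fl (s, x)) (Ioo (-(δ / 2)) (δ / 2)) :=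
        hFl.comp (by fun_prop) fun s hs => ⟨hs, hx⟩
      have hd : ContDiffAt ℝ ∞ (fun s => Fl (s, x)) 0 := hsm.contDiffAt (isOpen_Ioo.mem_nhds ht)
      have hd1 : HasDerivAt (fun s => Fl (s, x)) (deriv (fun s => Fl (s, x)) 0) 0 :=
        (hd.differentiableAt (by simp)).hasDerivAt
      have hc1 : ContinuousAt (deriv fun s => Fl (s, x)) 0 :=
        (hsm.continuousOn_deriv_of_isOpen isOpen_Ioo (by simp)).continuousAt
          (isOpen_Ioo.mem_nhds ht)
      have hc2 : ContinuousAt (fun s => V (Fl (s, x))) 0 :=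
        hV.continuous.continuousAt.comp hd.continuousAt
      have heq : (deriv fun s => Fl (s, x)) =ᶠ[𝓝[≠] 0] fun s => V (Fl (s, x)) := by
        filter_upwards [self_mem_nhdsWithin, mem_nhdsWithin_of_mem_nhds (isOpen_Ioo.mem_nhds ht)]
          with s hs0 hs
        exact (hne s hs hs0 x hx).deriv
      have := tendsto_nhds_unique_of_eventuallyEq (hc1.tendsto.mono_left nhdsWithin_le_nhds)
        (hc2.tendsto.mono_left nhdsWithin_le_nhds) heq
      rwa [this] at hd1
    · exact hne t ht ht0 x hx

lemma integralCurve_eventuallyEq {V : E → E} (hV : ContDiff ℝ 1 V) {γ₁ γ₂ : ℝ → E} {t₀ : ℝ}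
    (h₁ : ∀ᶠ t in 𝓝 t₀, HasDerivAt γ₁ (V (γ₁ t)) t) (h₂ : ∀ᶠ t in 𝓝 t₀, HasDerivAt γ₂ (V (γ₂ t)) t)
    (h0 : γ₁ t₀ = γ₂ t₀) : γ₁ =ᶠ[𝓝 t₀] γ₂ := by
  obtain ⟨K, s, hs, hK⟩ := (hV.contDiffAt (x := γ₁ t₀)).exists_lipschitzOnWith
  refine ODE_solution_unique_of_eventually (v := fun _ => V) (s := fun _ => s) (K := K)
    (Eventually.of_forall fun _ => hK) (h₁.and (h₁.self_of_nhds.continuousAt hs))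
    (h₂.and (h₂.self_of_nhds.continuousAt ?_)) h0
  rwa [← h0]

/-- The set of times near which the two curves agree is open, and relatively closed in `s` by
continuity and local uniqueness. -/
lemma integralCurve_unique {V : E → E} (hV : ContDiff ℝ 1 V) {γ₁ γ₂ : ℝ → E} {s : Set ℝ}
    (hs : IsPreconnected s) (hso : IsOpen s) {t₀ : ℝ} (ht₀ : t₀ ∈ s)
    (h₁ : ∀ t ∈ s, HasDerivAt γ₁ (V (γ₁ t)) t) (h₂ : ∀ t ∈ s, HasDerivAt γ₂ (V (γ₂ t)) t)
    (h0 : γ₁ t₀ = γ₂ t₀) : EqOn γ₁ γ₂ s := by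
  have hloc : ∀ t ∈ s, γ₁ t = γ₂ t → γ₁ =ᶠ[𝓝 t] γ₂ := fun t ht h =>
    integralCurve_eventuallyEq hV (eventually_of_mem (hso.mem_nhds ht) h₁)
      (eventually_of_mem (hso.mem_nhds ht) h₂) h
  have hsub : s ⊆ {t | γ₁ =ᶠ[𝓝 t] γ₂} := by
    refine hs.subset_of_closure_inter_subset isOpen_setOfPred_eventually_nhds
      ⟨t₀, ht₀, hloc t₀ ht₀ h0⟩ fun t ht => hloc t ht.2 ?_
    by_contra hne
    have h1 : ∀ᶠ r in 𝓝 t, γ₁ r ≠ γ₂ r :=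
      (((h₁ t ht.2).continuousAt.sub (h₂ t ht.2).continuousAt).eventually_ne
        (sub_ne_zero.2 hne)).mono fun r hr => sub_ne_zero.1 hr
    obtain ⟨r, hr1, hr2⟩ := (mem_closure_iff_frequently.1 ht.1).and_eventually h1 |>.exists
    exact hr2 (EventuallyEq.eq_of_nhds hr1)
  exact fun t ht => (hsub ht).eq_of_nhds

/-- A smooth vector field has a flow which is smooth on a neighbourhood of `{0} × E`. -/
theorem exists_flow {V : E → E} (hV : ContDiff ℝ ∞ V) :
    ∃ (Fl : ℝ × E → E) (D : Set (ℝ × E)), IsOpen D ∧ (∀ x, ((0 : ℝ), x) ∈ D) ∧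
      ContDiffOn ℝ ∞ Fl D ∧ (∀ x, Fl (0, x) = x) ∧
      (∀ t x, (t, x) ∈ D → HasDerivAt (fun s => Fl (s, x)) (V (Fl (t, x))) t) ∧
      ∀ t x, (t, x) ∈ D → ∀ s, |s| ≤ |t| → (s, x) ∈ D := by
  choose δ hδ Fl₀ hsm hinit hode using fun x => exists_localFlow hV x
  let B : E → Set (ℝ × E) := fun x₀ => Ioo (-δ x₀) (δ x₀) ×ˢ Metric.ball x₀ (δ x₀)
  have hB : ∀ x₀, IsOpen (B x₀) := fun x₀ => isOpen_Ioo.prod Metric.isOpen_ball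
  have hagree : ∀ x₀ x₁ q, q ∈ B x₀ → q ∈ B x₁ → Fl₀ x₀ q = Fl₀ x₁ q := by
    rintro x₀ x₁ ⟨t, x⟩ ⟨h0t, h0x⟩ ⟨h1t, h1x⟩
    have hset : ∀ s ∈ Ioo (-δ x₀) (δ x₀) ∩ Ioo (-δ x₁) (δ x₁),
      s ∈ Ioo (-δ x₀) (δ x₀) ∧ s ∈ Ioo (-δ x₁) (δ x₁) := fun s hs => hs
    refine integralCurve_unique (hV.of_le (by simp)) (γ₁ := fun s => Fl₀ x₀ (s, x))
      (γ₂ := fun s => Fl₀ x₁ (s, x)) (s := Ioo (-δ x₀) (δ x₀) ∩ Ioo (-δ x₁) (δ x₁)) (t₀ := 0)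
      (by rw [Ioo_inter_Ioo]; exact isPreconnected_Ioo) (isOpen_Ioo.inter isOpen_Ioo)
      ⟨by simpa using hδ x₀, by simpa using hδ x₁⟩
      (fun s hs => hode x₀ s hs.1 x h0x) (fun s hs => hode x₁ s hs.2 x h1x)
      (by rw [hinit x₀ x h0x, hinit x₁ x h1x]) ⟨h0t, h1t⟩
  classical
  -- The local flows are glued by an arbitrary choice. They agree on overlaps by uniqueness of
  -- integral curves, since two of the time intervals always meet in an interval around 0.
  let Fl : ℝ × E → E := fun q => if h : ∃ x₀, q ∈ B x₀ then Fl₀ h.choose q else q.2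
  have hFl : ∀ x₀, ∀ q ∈ B x₀, Fl q = Fl₀ x₀ q := fun x₀ q hq => by
    have h : ∃ x₀, q ∈ B x₀ := ⟨x₀, hq⟩
    simp only [Fl, dif_pos h]
    exact hagree _ _ q h.choose_spec hq
  have hself : ∀ x, ((0 : ℝ), x) ∈ B x := fun x =>
    ⟨by simpa using hδ x, Metric.mem_ball_self (hδ x)⟩
  refine ⟨Fl, ⋃ x₀, B x₀, isOpen_iUnion hB, fun x => mem_iUnion.2 ⟨x, hself x⟩, ?_, fun x => ?_,
    ?_, ?_⟩
  · intro q hq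
    obtain ⟨x₀, hx₀⟩ := mem_iUnion.1 hq
    refine ContDiffAt.contDiffWithinAt ?_
    exact ((hsm x₀).contDiffAt ((hB x₀).mem_nhds hx₀)).congr_of_eventuallyEq
      (eventually_of_mem ((hB x₀).mem_nhds hx₀) (hFl x₀))
  · rw [hFl x _ (hself x), hinit x x (hself x).2]
  · intro t x hq
    obtain ⟨x₀, hx₀⟩ := mem_iUnion.1 hq
    rw [hFl x₀ _ hx₀]
    refine (hode x₀ t hx₀.1 x hx₀.2).congr_of_eventuallyEq ?_
    filter_upwards [isOpen_Ioo.mem_nhds hx₀.1] with s hs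
    exact hFl x₀ _ ⟨hs, hx₀.2⟩
  · intro t x hq s hs
    obtain ⟨x₀, hx₀⟩ := mem_iUnion.1 hq
    exact mem_iUnion.2 ⟨x₀, abs_lt.1 (hs.trans_lt (abs_lt.2 hx₀.1)), hx₀.2⟩

end Flow

/-! ### The Hamiltonian flow of the inverse metric -/

section Hamiltonian

variable {k l : ℕ}

/-- The inverse metric. -/
def invMetric (h : (Fin k → ℝ) → Matrix (Fin k) (Fin k) ℝ) :
    (Fin k → ℝ) → Matrix (Fin k) (Fin k) ℝ := fun x => (h x)⁻¹

/-- The velocity `∂H/∂p` of the Hamiltonian `H(x, p) = q^{αβ}(x) p_α p_β / 2`. -/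
def velocity (q : (Fin k → ℝ) → Matrix (Fin k) (Fin k) ℝ) (x p : Fin k → ℝ) : Fin k → ℝ :=
  q x *ᵥ p

/-- The force `-∂H/∂x` of the Hamiltonian `H(x, p) = q^{αβ}(x) p_α p_β / 2`. -/
def force (q : (Fin k → ℝ) → Matrix (Fin k) (Fin k) ℝ) (x p : Fin k → ℝ) : Fin k → ℝ :=
  fun α => -(1 / 2) * dip q x (Pi.single α 1) p p

/-- The Hamiltonian vector field of `q^{αβ}(x) p_α p_β / 2`. -/
def hamiltonianField (q : (Fin k → ℝ) → Matrix (Fin k) (Fin k) ℝ)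
    (z : (Fin k → ℝ) × (Fin k → ℝ)) : (Fin k → ℝ) × (Fin k → ℝ) :=
  (velocity q z.1 z.2, force q z.1 z.2)

variable {q : (Fin k → ℝ) → Matrix (Fin k) (Fin k) ℝ}

lemma dotProduct_velocity (x u p : Fin k → ℝ) : u ⬝ᵥ velocity q x p = ip q x u p := rfl

lemma force_dotProduct (x p u : Fin k → ℝ) : force q x p ⬝ᵥ u = -(1 / 2) * dip q x u p p := by
  have : dip q x u p p = ∑ γ, u γ * dip q x (Pi.single γ 1) p p := by
    simp only [dip, Finset.mul_sum]
    symm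
    rw [Finset.sum_comm]
    refine Finset.sum_congr rfl fun α _ => ?_
    rw [Finset.sum_comm]
    refine Finset.sum_congr rfl fun β _ => ?_
    rw [fderiv_eq_sum_pd u, Finset.sum_mul, Finset.sum_mul]
    exact Finset.sum_congr rfl fun μ _ => by rw [smul_eq_mul, pd]; ring
  rw [this, Finset.mul_sum]
  exact Finset.sum_congr rfl fun γ _ => by simp only [force]; ring

lemma contDiff_hamiltonianField (hq : ∀ α β, ContDiff ℝ ∞ fun x => q x α β) :
    ContDiff ℝ ∞ (hamiltonianField q) := by
  have h1 : ∀ i, ContDiff ℝ ∞ fun z : (Fin k → ℝ) × (Fin k → ℝ) => z.2 i := fun i => by fun_prop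
  refine ContDiff.prodMk (contDiff_pi.2 fun α => ?_) (contDiff_pi.2 fun α => ?_)
  · simp only [velocity, Matrix.mulVec, dotProduct]
    exact ContDiff.sum fun β _ => ((hq α β).comp contDiff_fst).mul (h1 β)
  · simp only [force, dip]
    refine contDiff_const.mul (ContDiff.sum fun a _ => ContDiff.sum fun b _ => ?_)
    refine ((ContDiff.clm_apply ?_ contDiff_const).mul (h1 a)).mul (h1 b)
    exact ((hq a b).fderiv_right (m := ∞) (by simp)).comp contDiff_fst

/-- Normal coordinates: if `f` moves along bicharacteristics with momentum `P`, starting with unit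
momentum conormal to `{y^n = 0}`, then `P` is conormal to all `{y^n = const}`. -/
theorem gauss_lemma (hq : ∀ α β, ContDiff ℝ ∞ fun x => q x α β) (hqs : ∀ x, (q x).IsSymm)
    {f P : (Fin (l + 1) → ℝ) → (Fin k → ℝ)} {O : Set (Fin (l + 1) → ℝ)} (hO : IsOpen O)
    (hstar : ∀ y ∈ O, ∀ θ ∈ Icc (0 : ℝ) 1,
      Function.update y (Fin.last l) (θ * y (Fin.last l)) ∈ O)
    (hf : ContDiffOn ℝ ∞ f O) (hP : ContDiffOn ℝ ∞ P O)
    (hf' : ∀ y ∈ O, pd f (Fin.last l) y = velocity q (f y) (P y))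
    (hP' : ∀ y ∈ O, pd P (Fin.last l) y = force q (f y) (P y))
    (hunit : ∀ y ∈ O, y (Fin.last l) = 0 → ip q (f y) (P y) (P y) = 1)
    (hnormal : ∀ y ∈ O, y (Fin.last l) = 0 → ∀ a : Fin l, P y ⬝ᵥ pd f a.castSucc y = 0) :
    ∀ y ∈ O, ip q (f y) (P y) (P y) = 1 ∧ ∀ a : Fin l, P y ⬝ᵥ pd f a.castSucc y = 0 := by
  have diff : ∀ {u : (Fin (l + 1) → ℝ) → (Fin k → ℝ)}, ContDiffOn ℝ ∞ u O → ∀ y ∈ O,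
      DifferentiableAt ℝ u y := fun hu y hy =>
    ((hu _ hy).contDiffAt (hO.mem_nhds hy)).differentiableAt (by simp)
  have hen : ∀ y ∈ O, ∀ i, pd (fun z => ip q (f z) (P z) (P z)) i y =
      dip q (f y) (pd f i y) (P y) (P y) + 2 * (pd P i y ⬝ᵥ velocity q (f y) (P y)) := by
    intro y hy i
    rw [pd_ip hq (diff hf y hy) (diff hP y hy) (diff hP y hy), ip_comm (hqs _) (P y),
      dotProduct_velocity]
    ring
  have hone : ∀ y ∈ O, ip q (f y) (P y) (P y) = 1 := by
    intro y hy
    -- Conservation of energy: the contributions of force and velocity to ∂_n of the Hamiltonian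
    -- cancel, so the bound holds with C = 0.
    have := abs_le_mul_pow_of_pd (f := fun y => ip q (f y) (P y) (P y) - 1) hO Subset.rfl hstar
      (((contDiffOn_ip hq hf hP hP).sub contDiffOn_const).differentiableOn (by simp))
      (fun y hy hy0 => by rw [hunit y hy hy0, sub_self]) le_rfl (j := 0) (fun y hy => by
        have h1 : pd (fun z => ip q (f z) (P z) (P z) - 1) (Fin.last l) y =
            pd (fun z => ip q (f z) (P z) (P z)) (Fin.last l) y := by
          unfold pd; rw [fderiv_sub_const]
        rw [h1, hen y hy, hf' y hy, hP' y hy, force_dotProduct]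
        simp) y hy
    rw [zero_mul] at this
    exact sub_eq_zero.1 (abs_nonpos_iff.1 this)
  refine fun y hy => ⟨hone y hy, fun a => ?_⟩
  have dotsm : ∀ {u v : (Fin (l + 1) → ℝ) → (Fin k → ℝ)}, ContDiffOn ℝ ∞ u O →
      ContDiffOn ℝ ∞ v O → ContDiffOn ℝ ∞ (fun y => u y ⬝ᵥ v y) O := fun hu hv => by
    simp only [dotProduct]
    exact ContDiffOn.sum fun i _ => (contDiffOn_pi.1 hu i).mul (contDiffOn_pi.1 hv i)
  have pd_dot : ∀ {u v : (Fin (l + 1) → ℝ) → (Fin k → ℝ)}, ContDiffOn ℝ ∞ u O →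
      ContDiffOn ℝ ∞ v O → ∀ y ∈ O, ∀ i, pd (fun y => u y ⬝ᵥ v y) i y =
        pd u i y ⬝ᵥ v y + u y ⬝ᵥ pd v i y := fun {u v} hu hv y hy i => by
    have h1 := pd_ip (h := fun _ : Fin k → ℝ => (1 : Matrix (Fin k) (Fin k) ℝ))
      (fun α β => contDiff_const) (diff hu y hy) (diff hu y hy) (diff hv y hy) i
    simpa [ip, dip] using h1
  have hpf := contDiffOn_pd hO hf
  -- ∂_n (P · ∂_a f) = force · ∂_a f + P · ∂_a ∂_n f. Differentiating the constants q(P, P) = 1 and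
  -- P · ∂_n f = 1 in direction a shows that these two terms cancel, so again C = 0.
  have := abs_le_mul_pow_of_pd (f := fun y => P y ⬝ᵥ pd f a.castSucc y) hO Subset.rfl hstar
    ((dotsm hP (hpf _)).differentiableOn (by simp))
    (fun y hy hy0 => hnormal y hy hy0 a) le_rfl (j := 0) (fun y hy => by
      have hconst : ∀ᶠ z in 𝓝 y, ip q (f z) (P z) (P z) = 1 :=
        eventually_of_mem (hO.mem_nhds hy) hone
      have h1 : pd (fun z => ip q (f z) (P z) (P z)) a.castSucc y = 0 := by
        rw [pd_congr (g := fun _ => (1 : ℝ)) hconst]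
        unfold pd; simp
      have h2 : pd (fun z => P z ⬝ᵥ pd f (Fin.last l) z) a.castSucc y = 0 := by
        rw [pd_congr (g := fun _ => (1 : ℝ))]
        · unfold pd; simp
        · filter_upwards [hO.mem_nhds hy] with z hz
          rw [hf' z hz, dotProduct_velocity, hone z hz]
      rw [hen y hy] at h1
      rw [pd_dot hP (hpf _) y hy] at h2 ⊢
      rw [pd_comm hO hf hy a.castSucc, hP' y hy, force_dotProduct]
      rw [hf' y hy] at h2
      rw [zero_mul, abs_nonpos_iff]
      linarith) y hy
  rw [zero_mul] at this
  exact abs_nonpos_iff.1 this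

/-- The coordinate differential of `d`. -/
def differential (d : (Fin k → ℝ) → ℝ) (x : Fin k → ℝ) : Fin k → ℝ := fun α => pd d α x

lemma contDiffOn_differential {d : (Fin k → ℝ) → ℝ} {U : Set (Fin k → ℝ)} (hU : IsOpen U)
    (hd : ContDiffOn ℝ ∞ d U) : ContDiffOn ℝ ∞ (differential d) U :=
  contDiffOn_pi.2 fun α => contDiffOn_pd hU hd α

lemma fderiv_eq_differential (d : (Fin k → ℝ) → ℝ) (x v : Fin k → ℝ) :
    fderiv ℝ d x v = differential d x ⬝ᵥ v := by
  rw [fderiv_eq_sum_pd]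
  exact Finset.sum_congr rfl fun α _ => by rw [smul_eq_mul, differential, mul_comm]

/-- The characteristics of the eikonal equation: along a bicharacteristic which starts with the
differential of a solution, the momentum is the differential of the solution, and the solution grows
at unit speed. -/
theorem eikonal_characteristic (hq : ∀ α β, ContDiff ℝ ∞ fun x => q x α β)
    (hqs : ∀ x, (q x).IsSymm) {U : Set (Fin k → ℝ)} (hU : IsOpen U) {d : (Fin k → ℝ) → ℝ}
    (hd : ContDiffOn ℝ ∞ d U)
    (heik : ∀ x ∈ U, ip q x (differential d x) (differential d x) = 1)
    {γ : ℝ → (Fin k → ℝ) × (Fin k → ℝ)} {J : Set ℝ} (hJ : IsPreconnected J) (hJo : IsOpen J)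
    (h0J : (0 : ℝ) ∈ J) (hγ : ∀ t ∈ J, HasDerivAt γ (hamiltonianField q (γ t)) t)
    (hγU : ∀ t ∈ J, (γ t).1 ∈ U) (hinit : differential d (γ 0).1 = (γ 0).2) :
    ∀ t ∈ J, differential d (γ t).1 = (γ t).2 ∧ HasDerivAt (fun s => d (γ s).1) 1 t := by
  have hV := contDiff_hamiltonianField hq
  have hgrad := contDiffOn_differential hU hd
  have hdiff : ∀ x ∈ U, DifferentiableAt ℝ (differential d) x := fun x hx =>
    ((hgrad x hx).contDiffAt (hU.mem_nhds hx)).differentiableAt (by simp)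
  have hW : ContDiffOn ℝ ∞ (fun x => velocity q x (differential d x)) U :=
    (contDiff_fst.comp hV).comp_contDiffOn (contDiffOn_id.prodMk hgrad)
  -- the lift of an integral curve of the gradient is a bicharacteristic
  have hlift : ∀ (ξ : ℝ → Fin k → ℝ) (t : ℝ), ξ t ∈ U →
      HasDerivAt ξ (velocity q (ξ t) (differential d (ξ t))) t →
      HasDerivAt (fun s => (ξ s, differential d (ξ s)))
        (hamiltonianField q (ξ t, differential d (ξ t))) t := by
    intro ξ t ht hξ
    refine hξ.prodMk ?_
    have h1 := (hdiff _ ht).hasFDerivAt.comp_hasDerivAt t hξ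
    convert! h1 using 1
    ext α
    set x := ξ t with hx
    set p := differential d x with hp
    -- The eikonal equation is differentiated in x^α. Symmetry of the Hessian of `d` turns the
    -- result into the momentum equation with the force on the right.
    have h2 : pd (fun z => ip q z (differential d z) (differential d z)) α x = 0 := by
      rw [pd_congr (g := fun _ => (1 : ℝ)) (eventually_of_mem (hU.mem_nhds ht) heik)]
      unfold pd; simp
    rw [pd_ip (c := fun z => z) hq differentiableAt_fun_id (hdiff x ht) (hdiff x ht),
      ip_comm (hqs _) (differential d x) (pd _ _ _), ← hp] at h2
    have h3 : pd (fun z => z) α x = (Pi.single α 1 : Fin k → ℝ) := by unfold pd; simp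
    have h4 : fderiv ℝ (differential d) x (velocity q x p) α =
        ip q x (pd (differential d) α x) p := by
      rw [← dotProduct_velocity, dotProduct_comm, fderiv_eq_sum_pd, Finset.sum_apply]
      refine Finset.sum_congr rfl fun β _ => ?_
      rw [Pi.smul_apply, smul_eq_mul, ← pd_apply (hdiff x ht), ← pd_apply (hdiff x ht)]
      congr 1
      exact pd_comm hU hd ht α β
    rw [h4]
    simp only [force]
    rw [h3] at h2
    linarith
  -- From a time where differential and momentum agree, follow the integral curve of the gradient of
  -- `d`. Its lift is a bicharacteristic with the same data as γ, so the two coincide nearby.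
  have hloc : ∀ t ∈ J, differential d (γ t).1 = (γ t).2 →
      ∀ᶠ s in 𝓝 t, differential d (γ s).1 = (γ s).2 := by
    intro t ht h
    have htU := hγU t ht
    obtain ⟨ξ, hξ0, ε, hε, hξ⟩ :=
      (((hW _ htU).contDiffAt (hU.mem_nhds htU)).of_le
        (by simp)).exists_forall_mem_closedBall_exists_eq_forall_mem_Ioo_hasDerivAt₀ t
    have hξ' : ∀ᶠ s in 𝓝 t, HasDerivAt ξ (velocity q (ξ s) (differential d (ξ s))) s :=
      eventually_of_mem (Ioo_mem_nhds (by linarith) (by linarith)) hξ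
    have hξU : ∀ᶠ s in 𝓝 t, ξ s ∈ U :=
      hξ'.self_of_nhds.continuousAt (by rw [hξ0]; exact hU.mem_nhds htU)
    have heq := integralCurve_eventuallyEq (hV.of_le (by simp))
      (γ₁ := fun s => (ξ s, differential d (ξ s))) (γ₂ := γ) (t₀ := t)
      (by filter_upwards [hξ', hξU] with s h1 h2 using hlift ξ s h2 h1)
      (eventually_of_mem (hJo.mem_nhds ht) hγ) (by rw [hξ0, h])
    filter_upwards [heq] with s hs
    rw [← hs]
  have hsub : J ⊆ {t | ∀ᶠ s in 𝓝 t, differential d (γ s).1 = (γ s).2} := by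
    refine hJ.subset_of_closure_inter_subset isOpen_setOfPred_eventually_nhds
      ⟨0, h0J, hloc 0 h0J hinit⟩ fun t ht => hloc t ht.2 ?_
    by_contra hne
    have hc := (hγ t ht.2).continuousAt
    have hc1 : ContinuousAt (fun s => differential d (γ s).1) t :=
      ContinuousAt.comp (f := fun s => (γ s).1) (hdiff _ (hγU t ht.2)).continuousAt hc.fst
    have h1 : ∀ᶠ s in 𝓝 t, differential d (γ s).1 ≠ (γ s).2 :=
      ((hc1.sub hc.snd).eventually_ne (sub_ne_zero.2 hne)).mono fun r hr => sub_ne_zero.1 hr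
    obtain ⟨r, hr1, hr2⟩ := ((mem_closure_iff_frequently.1 ht.1).and_eventually h1).exists
    exact hr2 (show ∀ᶠ s in 𝓝 r, differential d (γ s).1 = (γ s).2 from hr1).self_of_nhds
  intro t ht
  have hgt : differential d (γ t).1 = (γ t).2 := (hsub ht).self_of_nhds
  refine ⟨hgt, ?_⟩
  have htU := hγU t ht
  have h1 : HasFDerivAt d (fderiv ℝ d (γ t).1) (γ t).1 :=
    (((hd _ htU).contDiffAt (hU.mem_nhds htU)).differentiableAt (by simp)).hasFDerivAt
  have h2 : HasDerivAt (fun s => (γ s).1) (velocity q (γ t).1 (γ t).2) t :=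
    (hasFDerivAt_fst (p := γ t)).comp_hasDerivAt t (hγ t ht)
  have h3 := h1.comp_hasDerivAt t h2
  rwa [fderiv_eq_differential, dotProduct_velocity, ← hgt, heik _ htU] at h3

end Hamiltonian

/-! ### Local coordinates on `ℝ × M` and `(ℝ × M) × ℝ` -/

section Coordinates

/-- The model with corners of `ℝ × M`. -/
abbrev tanModel (m : ℕ) := 𝓘(ℝ, ℝ).prod (𝓡 m)

/-- The model with corners of `(ℝ × M) × ℝ`. -/
abbrev tubeModel (m : ℕ) := (𝓘(ℝ, ℝ).prod (𝓡 m)).prod 𝓘(ℝ, ℝ)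

variable {m : ℕ} {M : Type*} [TopologicalSpace M]
  (e : OpenPartialHomeomorph M (EuclideanSpace ℝ (Fin m)))

/-- The standard local coordinates of a point of `ℝ × M`. -/
def tanCoord (p : ℝ × M) : Fin (m + 1) → ℝ := Fin.cons p.1 (e p.2).ofLp

/-- The standard local coordinates of a point of `(ℝ × M) × ℝ`. -/
def tubeCoord (q : (ℝ × M) × ℝ) : Fin (m + 2) → ℝ :=
  Fin.snoc (α := fun _ => ℝ) (tanCoord e q.1) q.2

variable {e}

@[simp] lemma init_tubeCoord (q : (ℝ × M) × ℝ) : Fin.init (tubeCoord e q) = tanCoord e q.1 := by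
  simp [tubeCoord]

@[simp] lemma tubeCoord_last (q : (ℝ × M) × ℝ) : tubeCoord e q (Fin.last (m + 1)) = q.2 := by
  simp [tubeCoord]

@[simp] lemma tubeCoord_zero (q : (ℝ × M) × ℝ) : tubeCoord e q 0 = q.1.1 :=
  congrFun (init_tubeCoord (e := e) q) 0

@[simp] lemma toLp_tail_tanCoord (p : ℝ × M) :
    WithLp.toLp 2 (Fin.tail (tanCoord e p)) = e p.2 := by
  simp [tanCoord]

lemma tanPoint_tanCoord {p : ℝ × M} (hp : p.2 ∈ e.source) : tanPoint e (tanCoord e p) = p := by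
  refine Prod.ext rfl ?_
  simp [tanPoint, e.left_inv hp]

lemma tubePoint_tubeCoord {q : (ℝ × M) × ℝ} (hq : q.1.2 ∈ e.source) :
    tubePoint e (tubeCoord e q) = q := by
  simp [tubePoint, tanPoint_tanCoord hq]

lemma tanCoord_tanPoint {y : Fin (m + 1) → ℝ} (hy : WithLp.toLp 2 (Fin.tail y) ∈ e.target) :
    tanCoord e (tanPoint e y) = y := by
  simp [tanCoord, tanPoint, e.right_inv hy]

lemma tubeCoord_tubePoint {y : Fin (m + 2) → ℝ}
    (hy : WithLp.toLp 2 (Fin.tail (Fin.init y)) ∈ e.target) :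
    tubeCoord e (tubePoint e y) = y := by
  simp [tubeCoord, tubePoint, tanCoord_tanPoint hy]

lemma tanPoint_snd_mem {y : Fin (m + 1) → ℝ} (hy : WithLp.toLp 2 (Fin.tail y) ∈ e.target) :
    (tanPoint e y).2 ∈ e.source := e.map_target hy

lemma tubePoint_zeroSection (w : Fin (m + 1) → ℝ) :
    tubePoint e (zeroSection (m + 1) w) = (tanPoint e w, 0) := by
  simp [tubePoint]

lemma tubeCoord_eq_zeroSection (p : ℝ × M) :
    tubeCoord e (p, 0) = zeroSection (m + 1) (tanCoord e p) := by
  rw [← zeroSection_init (tubeCoord_last (e := e) (p, 0)), init_tubeCoord]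

lemma contDiff_toLp_tail :
    ContDiff ℝ ∞ fun y : Fin (m + 1) → ℝ => (WithLp.toLp 2 (Fin.tail y) : EuclideanSpace ℝ (Fin m)) :=
  (PiLp.continuousLinearEquiv 2 ℝ fun _ : Fin m => ℝ).symm.contDiff.comp
    (contDiff_pi.2 fun i => contDiff_apply ℝ ℝ i.succ)

lemma isOpen_tanPoint_preimage {S : Set (ℝ × M)} (hS : IsOpen S) :
    IsOpen {y : Fin (m + 1) → ℝ | WithLp.toLp 2 (Fin.tail y) ∈ e.target ∧ tanPoint e y ∈ S} := by
  have hc := (contDiff_toLp_tail (m := m)).continuous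
  have : ContinuousOn (tanPoint e) {y : Fin (m + 1) → ℝ | WithLp.toLp 2 (Fin.tail y) ∈ e.target} :=
    (continuous_apply 0).continuousOn.prodMk (e.continuousOn_symm.comp hc.continuousOn fun y hy => hy)
  exact this.isOpen_inter_preimage (e.open_target.preimage hc) hS

lemma isOpen_tubePoint_preimage {S : Set ((ℝ × M) × ℝ)} (hS : IsOpen S) :
    IsOpen {y : Fin (m + 2) → ℝ | WithLp.toLp 2 (Fin.tail (Fin.init y)) ∈ e.target ∧ tubePoint e y ∈ S} := by
  have hc := (contDiff_toLp_tail (m := m)).continuous.comp (initL (m + 1)).continuous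
  have : ContinuousOn (tubePoint e)
      {y : Fin (m + 2) → ℝ | WithLp.toLp 2 (Fin.tail (Fin.init y)) ∈ e.target} :=
    ((continuous_apply 0).continuousOn.prodMk
      (e.continuousOn_symm.comp hc.continuousOn fun y hy => hy)).prodMk
      (continuous_apply _).continuousOn
  exact this.isOpen_inter_preimage (e.open_target.preimage hc) hS

lemma isOpen_tubeCoord_preimage {U : Set (Fin (m + 2) → ℝ)} (hU : IsOpen U) :
    IsOpen {q : (ℝ × M) × ℝ | q.1.2 ∈ e.source ∧ tubeCoord e q ∈ U} := by
  have hc : ContinuousOn (tubeCoord e) {q : (ℝ × M) × ℝ | q.1.2 ∈ e.source} := by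
    have h1 : ContinuousOn (fun q : (ℝ × M) × ℝ => (e q.1.2).ofLp)
        {q : (ℝ × M) × ℝ | q.1.2 ∈ e.source} :=
      (PiLp.continuous_ofLp 2 _).comp_continuousOn
        (e.continuousOn.comp (by fun_prop) fun q hq => hq)
    refine continuousOn_pi.2 fun i => ?_
    induction i using Fin.lastCases with
    | last => simpa using continuous_snd.continuousOn
    | cast i =>
      simp only [tubeCoord, Fin.snoc_castSucc]
      induction i using Fin.cases with
      | zero => exact (continuous_fst.comp continuous_fst).continuousOn
      | succ j => exact (continuousOn_pi.1 h1 j)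
  exact hc.isOpen_inter_preimage
    (e.open_source.preimage (continuous_snd.comp continuous_fst)) hU

variable [ChartedSpace (EuclideanSpace ℝ (Fin m)) M] [IsManifold (𝓡 m) ∞ M]
  (he : e ∈ IsManifold.maximalAtlas (𝓡 m) ∞ M)
include he

lemma contMDiffOn_tanPoint :
    ContMDiffOn 𝓘(ℝ, Fin (m + 1) → ℝ) (tanModel m) ∞ (tanPoint e)
      {y : Fin (m + 1) → ℝ | WithLp.toLp 2 (Fin.tail y) ∈ e.target} := by
  refine ContMDiffOn.prodMk ?_ ?_
  · exact (contDiff_apply ℝ ℝ (0 : Fin (m + 1))).contMDiff.contMDiffOn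
  · exact (contMDiffOn_symm_of_mem_maximalAtlas he).comp
      (contDiff_toLp_tail (m := m)).contMDiff.contMDiffOn fun y hy => hy

lemma contMDiffOn_tubePoint :
    ContMDiffOn 𝓘(ℝ, Fin (m + 2) → ℝ) (tubeModel m) ∞ (tubePoint e)
      {y : Fin (m + 2) → ℝ | WithLp.toLp 2 (Fin.tail (Fin.init y)) ∈ e.target} := by
  refine ContMDiffOn.prodMk ?_ ?_
  · exact (contMDiffOn_tanPoint he).comp (initL (m + 1)).contDiff.contMDiff.contMDiffOn
      fun y hy => hy
  · exact (contDiff_apply ℝ ℝ (Fin.last (m + 1))).contMDiff.contMDiffOn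

lemma contMDiffOn_tanCoord :
    ContMDiffOn (tanModel m) 𝓘(ℝ, Fin (m + 1) → ℝ) ∞ (tanCoord e)
      {p : ℝ × M | p.2 ∈ e.source} := by
  refine contMDiffOn_pi_space.2 fun i => ?_
  induction i using Fin.cases with
  | zero => exact contMDiff_fst.contMDiffOn
  | succ j =>
    have h1 : ContDiff ℝ ∞ fun v : EuclideanSpace ℝ (Fin m) => v j := by fun_prop
    exact h1.contMDiff.comp_contMDiffOn ((contMDiffOn_of_mem_maximalAtlas he).comp
      contMDiff_snd.contMDiffOn fun p hp => hp)

lemma contDiffOn_comp_tanPoint {F : Type*} [NormedAddCommGroup F] [NormedSpace ℝ F]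
    {Φ : ℝ × M → F} {S : Set (ℝ × M)} (hΦ : ContMDiffOn (tanModel m) 𝓘(ℝ, F) ∞ Φ S) :
    ContDiffOn ℝ ∞ (Φ ∘ tanPoint e)
      {y : Fin (m + 1) → ℝ | WithLp.toLp 2 (Fin.tail y) ∈ e.target ∧ tanPoint e y ∈ S} :=
  (hΦ.comp ((contMDiffOn_tanPoint he).mono fun _ hy => hy.1) fun _ hy => hy.2).contDiffOn

lemma contDiffOn_comp_tubePoint {F : Type*} [NormedAddCommGroup F] [NormedSpace ℝ F]
    {Φ : (ℝ × M) × ℝ → F} {S : Set ((ℝ × M) × ℝ)}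
    (hΦ : ContMDiffOn (tubeModel m) 𝓘(ℝ, F) ∞ Φ S) :
    ContDiffOn ℝ ∞ (Φ ∘ tubePoint e)
      {y : Fin (m + 2) → ℝ | WithLp.toLp 2 (Fin.tail (Fin.init y)) ∈ e.target ∧ tubePoint e y ∈ S} :=
  (hΦ.comp ((contMDiffOn_tubePoint he).mono fun _ hy => hy.1) fun _ hy => hy.2).contDiffOn

end Coordinates

/-! ### Tubular neighbourhoods -/

section TubularNeighbourhood

variable {m : ℕ} {M : Type*} [TopologicalSpace M] [ChartedSpace (EuclideanSpace ℝ (Fin m)) M]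
  {Φ : (ℝ × M) × ℝ → (Fin (m + 2) → ℝ)}

lemma IsDiffeoOntoImage.mono {W W' : Set ((ℝ × M) × ℝ)} (H : IsDiffeoOntoImage Φ W)
    (hW' : IsOpen W') (hsub : W' ⊆ W) : IsDiffeoOntoImage Φ W' := by
  obtain ⟨ho, hinj, hsm, hinv⟩ := H
  rcases W'.eq_empty_or_nonempty with rfl | hne
  · exact ⟨by simp, by simp, by simp [ContMDiffOn], fun h => absurd h (by simp)⟩
  obtain ⟨φinv, hl, hc⟩ := hinv (hne.mono hsub)
  refine ⟨?_, hinj.mono hsub, hsm.mono hsub, fun _ => ⟨φinv, hl.mono hsub, hc.mono (image_mono hsub)⟩⟩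
  have : Φ '' W' = Φ '' W ∩ φinv ⁻¹' W' := by
    ext x
    constructor
    · rintro ⟨q, hq, rfl⟩
      exact ⟨mem_image_of_mem _ (hsub hq), by rwa [mem_preimage, hl (hsub hq)]⟩
    · rintro ⟨⟨q, hq, rfl⟩, h⟩
      rw [mem_preimage, hl hq] at h
      exact mem_image_of_mem _ h
  rw [this]
  exact hc.continuousOn.isOpen_inter_preimage ho hW'

/-- Injectivity supplies the global inverse. Near each image point it coincides with a local
inverse, so it is smooth. -/
lemma isDiffeoOntoImage_of_local {U : Set ((ℝ × M) × ℝ)} (hU : IsOpen U) (hinj : InjOn Φ U)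
    (hloc : ∀ q ∈ U, ∃ W, IsOpen W ∧ q ∈ W ∧ IsDiffeoOntoImage Φ W) : IsDiffeoOntoImage Φ U := by
  have hloc' : ∀ q ∈ U, ∃ W, IsOpen W ∧ q ∈ W ∧ W ⊆ U ∧ IsDiffeoOntoImage Φ W := fun q hq => by
    obtain ⟨W, hW, hqW, H⟩ := hloc q hq
    exact ⟨W ∩ U, hW.inter hU, ⟨hqW, hq⟩, inter_subset_right,
      H.mono (hW.inter hU) inter_subset_left⟩
  refine ⟨isOpen_iff_mem_nhds.2 ?_, hinj, fun q hq => ?_, fun hne => ?_⟩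
  · rintro _ ⟨q, hq, rfl⟩
    obtain ⟨W, hW, hqW, hWU, H⟩ := hloc' q hq
    exact mem_of_superset (H.1.mem_nhds (mem_image_of_mem _ hqW)) (image_mono hWU)
  · obtain ⟨W, hW, hqW, hWU, H⟩ := hloc' q hq
    exact ((H.2.2.1 q hqW).contMDiffAt (hW.mem_nhds hqW)).contMDiffWithinAt
  · have : Nonempty ((ℝ × M) × ℝ) := ⟨hne.some⟩
    have hl : LeftInvOn (Function.invFunOn Φ U) Φ U := hinj.leftInvOn_invFunOn
    refine ⟨Function.invFunOn Φ U, hl, ?_⟩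
    rintro _ ⟨q, hq, rfl⟩
    obtain ⟨W, hW, hqW, hWU, H⟩ := hloc' q hq
    obtain ⟨φinv, hl', hc⟩ := H.2.2.2 ⟨q, hqW⟩
    have hx : Φ '' W ∈ 𝓝 (Φ q) := H.1.mem_nhds (mem_image_of_mem _ hqW)
    have heq : Function.invFunOn Φ U =ᶠ[𝓝 (Φ q)] φinv := by
      filter_upwards [hx]
      rintro _ ⟨q', hq', rfl⟩
      rw [hl (hWU hq'), hl' hq']
    exact (((hc _ (mem_image_of_mem _ hqW)).contMDiffAt hx).congr_of_eventuallyEq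
      heq).contMDiffWithinAt

/-- The inverse function theorem in local coordinates. -/
lemma exists_isDiffeoOntoImage [IsManifold (𝓡 m) ∞ M]
    {e : OpenPartialHomeomorph M (EuclideanSpace ℝ (Fin m))}
    (he : e ∈ IsManifold.maximalAtlas (𝓡 m) ∞ M) {S : Set ((ℝ × M) × ℝ)} (hS : IsOpen S)
    (hΦ : ContMDiffOn (tubeModel m) 𝓘(ℝ, Fin (m + 2) → ℝ) ∞ Φ S) {q : (ℝ × M) × ℝ} (hq : q ∈ S)
    (hqe : q.1.2 ∈ e.source)
    (hli : LinearIndependent ℝ fun a => pd (Φ ∘ tubePoint e) a (tubeCoord e q)) :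
    ∃ W, IsOpen W ∧ q ∈ W ∧ IsDiffeoOntoImage Φ W := by
  set U : Set (Fin (m + 2) → ℝ) :=
    {y : Fin (m + 2) → ℝ | WithLp.toLp 2 (Fin.tail (Fin.init y)) ∈ e.target ∧ tubePoint e y ∈ S} with hUdef
  have hU : IsOpen U := isOpen_tubePoint_preimage hS
  have hf : ContDiffOn ℝ ∞ (Φ ∘ tubePoint e) U := contDiffOn_comp_tubePoint he hΦ
  have hy : tubeCoord e q ∈ U :=
    ⟨by simpa using e.map_source hqe, by rwa [tubePoint_tubeCoord hqe]⟩
  have hd : DifferentiableAt ℝ (Φ ∘ tubePoint e) (tubeCoord e q) :=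
    ((hf _ hy).contDiffAt (hU.mem_nhds hy)).differentiableAt (by simp)
  have hinj : Function.Injective (fderiv ℝ (Φ ∘ tubePoint e) (tubeCoord e q)) := by
    refine (injective_iff_map_eq_zero _).2 fun v hv => ?_
    rw [fderiv_eq_sum_pd] at hv
    exact funext (Fintype.linearIndependent_iff.1 hli v hv)
  let f' : (Fin (m + 2) → ℝ) ≃L[ℝ] (Fin (m + 2) → ℝ) :=
    (LinearEquiv.ofInjectiveEndo
      (fderiv ℝ (Φ ∘ tubePoint e) (tubeCoord e q)).toLinearMap hinj).toContinuousLinearEquiv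
  have hf' : HasFDerivAt (Φ ∘ tubePoint e) (f' : _ →L[ℝ] _) (tubeCoord e q) := by
    convert! hd.hasFDerivAt using 1
  obtain ⟨P, hqP, hPU, hPf, hPs⟩ := exists_openPartialHomeomorph hU hf hy f' hf'
  set W : Set ((ℝ × M) × ℝ) := {q | q.1.2 ∈ e.source ∧ tubeCoord e q ∈ P.source} with hWdef
  have hW : IsOpen W := isOpen_tubeCoord_preimage P.open_source
  have hWS : W ⊆ S := fun q' hq' => by
    have := (hPU hq'.2).2
    rwa [tubePoint_tubeCoord hq'.1] at this
  have hΦP : ∀ q' ∈ W, Φ q' = P (tubeCoord e q') := fun q' hq' => by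
    rw [hPf, Function.comp_apply, tubePoint_tubeCoord hq'.1]
  have himg : Φ '' W = P.target := by
    ext x
    constructor
    · rintro ⟨q', hq', rfl⟩
      rw [hΦP q' hq']
      exact P.map_source hq'.2
    · intro hx
      have h1 := P.map_target hx
      have h2 := (hPU h1).1
      refine ⟨tubePoint e (P.symm x), ⟨tanPoint_snd_mem h2, ?_⟩, ?_⟩
      · rwa [tubeCoord_tubePoint h2]
      · have := hPf (P.symm x)
        rw [P.right_inv hx] at this
        exact this.symm
  have hl : LeftInvOn (tubePoint e ∘ P.symm) Φ W := fun q' hq' => by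
    rw [Function.comp_apply, hΦP q' hq', P.left_inv hq'.2, tubePoint_tubeCoord hq'.1]
  refine ⟨W, hW, ⟨hqe, hqP⟩, ?_, hl.injOn, hΦ.mono hWS, fun _ => ⟨_, hl, ?_⟩⟩
  · rw [himg]; exact P.open_target
  · rw [himg]
    exact (contMDiffOn_tubePoint he).comp hPs.contMDiffOn fun x hx => (hPU (P.map_target hx)).1

variable (M) in
lemma isOpen_tube (T r : ℝ) : IsOpen (tube M T r) :=
  (isOpen_Ioo.prod isOpen_univ).prod isOpen_Ioo

/-- A neighbourhood of `[-T, T] × M × {0}` contains a tube. -/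
lemma exists_closedTube_subset [CompactSpace M] {S : Set ((ℝ × M) × ℝ)} (hS : IsOpen S) {T : ℝ}
    (h0 : ∀ p : ℝ × M, p.1 ∈ Icc (-T) T → (p, 0) ∈ S) :
    ∃ r > 0, closedTube M T r ⊆ S := by
  have hZ : IsCompact (Icc (-T) T ×ˢ (univ : Set M)) := isCompact_Icc.prod isCompact_univ
  obtain ⟨u, v, hu, hv, hZu, h0v, huv⟩ := generalized_tube_lemma hZ
    (isCompact_singleton (x := (0 : ℝ))) hS (by
      rintro ⟨p, s⟩ ⟨hp, hs⟩
      rw [mem_singleton_iff] at hs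
      subst hs
      exact h0 p hp.1)
  obtain ⟨ε, hε, hb⟩ := Metric.isOpen_iff.1 hv 0 (h0v rfl)
  refine ⟨ε / 2, by positivity, fun q hq => huv ⟨hZu hq.1, hb ?_⟩⟩
  rw [Metric.mem_ball, dist_zero_right, Real.norm_eq_abs]
  have := abs_le.2 hq.2
  linarith

lemma tube_subset_closedTube {T r : ℝ} : tube M T r ⊆ closedTube M T r := fun _ hq =>
  ⟨⟨Ioo_subset_Icc_self hq.1.1, trivial⟩, Ioo_subset_Icc_self hq.2⟩

lemma closedTube_mono {T r r' : ℝ} (h : r ≤ r') : closedTube M T r ⊆ closedTube M T r' :=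
  fun _ hq => ⟨hq.1, ⟨by linarith [hq.2.1], by linarith [hq.2.2]⟩⟩

lemma tube_mono {T r r' : ℝ} (h : r ≤ r') : tube M T r ⊆ tube M T r' :=
  fun _ hq => ⟨hq.1, ⟨by linarith [hq.2.1], by linarith [hq.2.2]⟩⟩

/-- The tubular neighbourhood theorem. -/
theorem exists_tube_isDiffeoOntoImage [CompactSpace M] {T : ℝ}
    (hloc : ∀ p : ℝ × M, p.1 ∈ Icc (-T) T → ∃ W, IsOpen W ∧ (p, 0) ∈ W ∧ IsDiffeoOntoImage Φ W)
    (hinj : ∀ p p' : ℝ × M, p.1 ∈ Icc (-T) T → p'.1 ∈ Icc (-T) T → Φ (p, 0) = Φ (p', 0) → p = p') :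
    ∃ r > 0, IsDiffeoOntoImage Φ (tube M T r) := by
  set A : Set ((ℝ × M) × ℝ) := (Icc (-T) T ×ˢ (univ : Set M)) ×ˢ {0} with hA
  have hAc : IsCompact A := (isCompact_Icc.prod isCompact_univ).prod isCompact_singleton
  have hA' : ∀ q ∈ A, q.1.1 ∈ Icc (-T) T ∧ q = (q.1, 0) := fun q hq =>
    ⟨hq.1.1, Prod.ext rfl hq.2⟩
  have hcont : ∀ q ∈ A, ContinuousAt Φ q := fun q hq => by
    obtain ⟨h1, h2⟩ := hA' q hq
    obtain ⟨W, hW, hqW, H⟩ := hloc q.1 h1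
    rw [← h2] at hqW
    exact H.2.2.1.continuousOn.continuousAt (hW.mem_nhds hqW)
  -- Near a pair with distinct images continuity keeps the images distinct; near a diagonal pair
  -- local injectivity applies. No other pairs occur in `A ×ˢ A`, since `Φ` is injective on `A`.
  have hev : ∀ᶠ z in 𝓝ˢ (A ×ˢ A), Φ z.1 = Φ z.2 → z.1 = z.2 := by
    refine eventually_nhdsSet_iff_forall.2 ?_
    rintro ⟨a, b⟩ ⟨ha, hb⟩
    obtain ⟨ha1, ha2⟩ := hA' a ha
    obtain ⟨hb1, hb2⟩ := hA' b hb
    by_cases hab : Φ a = Φ b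
    · have h1 : a.1 = b.1 := hinj _ _ ha1 hb1 (by rw [← ha2, ← hb2, hab])
      have h2 : b = a := by rw [ha2, hb2, h1]
      subst h2
      obtain ⟨W, hW, hqW, H⟩ := hloc b.1 hb1
      rw [← hb2] at hqW
      filter_upwards [(hW.prod hW).mem_nhds (show ((b, b) : _ × _) ∈ W ×ˢ W from ⟨hqW, hqW⟩)]
        with z hz h using H.2.1 hz.1 hz.2 h
    · have h1 : ContinuousAt (fun z : ((ℝ × M) × ℝ) × ((ℝ × M) × ℝ) => Φ z.1 - Φ z.2) (a, b) :=
        ((hcont a ha).comp_of_eq continuousAt_fst rfl).sub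
          ((hcont b hb).comp_of_eq continuousAt_snd rfl)
      filter_upwards [h1.eventually_ne (sub_ne_zero.2 hab)] with z hz h
      exact absurd (sub_eq_zero.2 h) hz
  -- By compactness of `A`, a neighbourhood of A × A contains the square of a neighbourhood of A,
  -- and `Φ` is injective on the latter.
  rw [hAc.nhdsSet_prod_eq hAc] at hev
  obtain ⟨V, hV, hVV⟩ :=
    (eventually_prod_self_iff (r := fun q q' => Φ q = Φ q' → q = q')).1 hev
  obtain ⟨V', hV'o, hAV', hV'V⟩ := mem_nhdsSet_iff_exists.1 hV
  set G : Set ((ℝ × M) × ℝ) := ⋃₀ {W | IsOpen W ∧ IsDiffeoOntoImage Φ W} with hG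
  have hGo : IsOpen G := isOpen_sUnion fun W hW => hW.1
  obtain ⟨r, hr, hsub⟩ := exists_closedTube_subset (S := V' ∩ G) (hV'o.inter hGo) (T := T)
    fun p hp => ⟨hAV' ⟨⟨hp, trivial⟩, rfl⟩, by
      obtain ⟨W, hW, hpW, H⟩ := hloc p hp
      exact mem_sUnion.2 ⟨W, ⟨hW, H⟩, hpW⟩⟩
  have hsub' := (tube_subset_closedTube (M := M) (T := T) (r := r)).trans hsub
  refine ⟨r, hr, isDiffeoOntoImage_of_local (isOpen_tube M T r) ?_ fun q hq => ?_⟩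
  · exact fun q hq q' hq' h => hVV q (hV'V (hsub' hq).1) q' (hV'V (hsub' hq').1) h
  · obtain ⟨W, hW, hqW⟩ := mem_sUnion.1 (hsub' hq).2
    exact ⟨W, hW.1, hqW, hW.2⟩

end TubularNeighbourhood

/-! ### Normal vectors -/

section NormalAlgebra

variable {k : ℕ} {h : (Fin k → ℝ) → Matrix (Fin k) (Fin k) ℝ} {x : Fin k → ℝ}

lemma eq_zero_of_ip_eq_zero (hdet : (h x).det ≠ 0) {u : Fin k → ℝ} (hu : ∀ v, ip h x u v = 0) :
    u = 0 := by
  have h1 : u ᵥ* h x = 0 := by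
    ext α
    have := hu (Pi.single α 1)
    rwa [ip, Matrix.dotProduct_mulVec, dotProduct_single_one] at this
  have h2 : u ᵥ* (h x * (h x)⁻¹) = 0 := by
    rw [← Matrix.vecMul_vecMul, h1, Matrix.zero_vecMul]
  rwa [Matrix.mul_nonsing_inv _ (isUnit_iff_ne_zero.2 hdet), Matrix.vecMul_one] at h2

/-- Pairing a linear relation with `n` isolates the last coefficient. Transversality of the last
vector is enough; it need not be the normal itself. -/
lemma linearIndependent_of_normal {l : ℕ} {t : Fin (l + 1) → (Fin k → ℝ)} {n : Fin k → ℝ}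
    (ht : LinearIndependent ℝ fun a : Fin l => t a.castSucc)
    (hn : ip h x n (t (Fin.last l)) ≠ 0)
    (horth : ∀ a : Fin l, ip h x n (t a.castSucc) = 0) : LinearIndependent ℝ t := by
  refine Fintype.linearIndependent_iff.2 fun g hg => ?_
  have h1 : ip h x n (∑ i, g i • t i) = 0 := by rw [hg]; simp [ip]
  rw [Fin.sum_univ_castSucc, ip_add_right, ip_sum_right, ip_smul_right] at h1
  simp only [ip_smul_right, horth, mul_zero, Finset.sum_const_zero, zero_add] at h1
  have h2 : g (Fin.last l) = 0 := (mul_eq_zero.1 h1).resolve_right hn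
  rw [Fin.sum_univ_castSucc, h2, zero_smul, add_zero] at hg
  intro i
  induction i using Fin.lastCases with
  | last => exact h2
  | cast a => exact Fintype.linearIndependent_iff.1 ht _ hg a

/-- A hyperplane has only one unit normal up to sign. -/
lemma unit_normal_eq_or_eq_neg {l : ℕ} {h : (Fin (l + 1) → ℝ) → Matrix (Fin (l + 1)) (Fin (l + 1)) ℝ}
    {x : Fin (l + 1) → ℝ} (hdet : (h x).det ≠ 0)
    {t : Fin l → (Fin (l + 1) → ℝ)} (ht : LinearIndependent ℝ t) {n n' : Fin (l + 1) → ℝ}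
    (hn : ip h x n n = 1) (hno : ∀ a, ip h x n (t a) = 0)
    (hn' : ip h x n' n' = 1) (hno' : ∀ a, ip h x n' (t a) = 0) : n' = n ∨ n' = -n := by
  set b : Fin (l + 1) → (Fin (l + 1) → ℝ) := Fin.snoc (α := fun _ => Fin (l + 1) → ℝ) t n with hb
  have hbl : b (Fin.last l) = n := by simp [hb]
  have hbc : ∀ a : Fin l, b a.castSucc = t a := fun a => by simp [hb]
  have hli : LinearIndependent ℝ b := by
    refine linearIndependent_of_normal (h := h) (x := x) (n := n) ?_ (by rw [hbl, hn]; exact one_ne_zero)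
      fun a => by rw [hbc]; exact hno a
    simpa only [hbc] using ht
  have hspan := hli.span_eq_top_of_card_eq_finrank' (by simp)
  set c := ip h x n' n with hc
  have hu : n' + (-c) • n = 0 := by
    refine eq_zero_of_ip_eq_zero hdet fun v => ?_
    have hv : v ∈ Submodule.span ℝ (range b) := by rw [hspan]; trivial
    induction hv using Submodule.span_induction with
    | mem v hv =>
      obtain ⟨i, rfl⟩ := hv
      induction i using Fin.lastCases with
      | last => rw [hbl, ip_add_left, ip_smul_left, hn, ← hc]; ring
      | cast a => rw [hbc, ip_add_left, ip_smul_left, hno, hno']; ring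
    | zero => simp [ip]
    | add v w _ _ h1 h2 => rw [ip_add_right, h1, h2, add_zero]
    | smul r v _ h1 => rw [ip_smul_right, h1, mul_zero]
  have heq : n' = c • n := by
    rw [neg_smul, ← sub_eq_add_neg, sub_eq_zero] at hu
    exact hu
  have hc2 : c * c = 1 := by
    rw [heq, ip_smul_left, ip_smul_right, hn, mul_one] at hn'
    exact hn'
  rcases mul_self_eq_one_iff.1 hc2 with h1 | h1
  · left; rw [heq, h1, one_smul]
  · right; rw [heq, h1, neg_one_smul]

/-- The covector `v ↦ det (A, v)`. -/
def crossCovector {l : ℕ} (A : Fin l → (Fin (l + 1) → ℝ)) : Fin (l + 1) → ℝ := fun α =>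
  (Matrix.of (Fin.snoc (α := fun _ => Fin (l + 1) → ℝ) A 0)).adjugate α (Fin.last l)

/-- Laplace expansion along the last row. The last column of the adjugate does not depend on that
row, so the placeholder 0 in the definition is harmless. -/
lemma crossCovector_dotProduct {l : ℕ} (A : Fin l → (Fin (l + 1) → ℝ)) (v : Fin (l + 1) → ℝ) :
    crossCovector A ⬝ᵥ v =
      (Matrix.of (Fin.snoc (α := fun _ => Fin (l + 1) → ℝ) A v)).det := by
  have h1 : Matrix.of (Fin.snoc (α := fun _ => Fin (l + 1) → ℝ) A v) =
      (Matrix.of (Fin.snoc (α := fun _ => Fin (l + 1) → ℝ) A 0)).updateRow (Fin.last l) v := by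
    ext i j
    induction i using Fin.lastCases with
    | last => simp
    | cast a => simp
  rw [h1, ← Matrix.cramer_transpose_apply, Matrix.cramer_eq_adjugate_mulVec,
    ← Matrix.adjugate_transpose]
  rfl

lemma crossCovector_orthogonal {l : ℕ} (A : Fin l → (Fin (l + 1) → ℝ)) (a : Fin l) :
    crossCovector A ⬝ᵥ A a = 0 := by
  rw [crossCovector_dotProduct]
  refine Matrix.det_zero_of_row_eq (Fin.castSucc_lt_last a).ne ?_
  ext j
  simp

lemma crossCovector_ne_zero {l : ℕ} {A : Fin l → (Fin (l + 1) → ℝ)} (hA : LinearIndependent ℝ A) :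
    crossCovector A ≠ 0 := by
  have hlt : Submodule.span ℝ (range A) ≠ ⊤ := by
    intro htop
    have h1 := finrank_span_eq_card hA
    rw [htop, finrank_top] at h1
    simp at h1
  obtain ⟨v, -, hv⟩ := SetLike.exists_of_lt (lt_top_iff_ne_top.2 hlt)
  have hli : LinearIndependent ℝ (Fin.snoc (α := fun _ => Fin (l + 1) → ℝ) A v) :=
    linearIndependent_finSnoc.2 ⟨hA, hv⟩
  intro h0
  have h1 := crossCovector_dotProduct A v
  rw [h0, zero_dotProduct] at h1
  have h2 : IsUnit (Matrix.of (Fin.snoc (α := fun _ => Fin (l + 1) → ℝ) A v)) :=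
    Matrix.linearIndependent_rows_iff_isUnit.1 hli
  rw [Matrix.isUnit_iff_isUnit_det, ← h1] at h2
  exact not_isUnit_zero h2

end NormalAlgebra

/-! ### The two sides of a hypersurface -/

section Sides

variable {Z X : Type*} [TopologicalSpace Z] [TopologicalSpace X]

/-- Away from the frontier, `I` and the complement of its closure are disjoint open sets that cover
`s`. -/
lemma subset_or_disjoint_of_disjoint_frontier {s I : Set X} (hs : IsPreconnected s) (hI : IsOpen I)
    (hd : Disjoint s (frontier I)) : s ⊆ I ∨ Disjoint s I := by
  have h := hs.subset_or_subset hI isClosed_closure.isOpen_compl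
    (disjoint_compl_right_iff_subset.2 subset_closure) (v := (closure I)ᶜ) fun x hx => by
      by_cases hxI : x ∈ I
      · exact Or.inl hxI
      · refine Or.inr fun hc => disjoint_left.1 hd hx ?_
        rw [hI.frontier_eq]
        exact ⟨hc, hxI⟩
  exact h.imp id fun h => disjoint_left.2 fun x hx hxI => h hx (subset_closure hxI)

/-- If `Φ` maps `O × {0}` to the frontier of `I` and the two open sides to its complement, then
exactly one of the sides is mapped into `I`. -/
lemma exists_side {Φ : Z × ℝ → X} {I : Set X} (hI : IsOpen I) {O : Set Z} (hO : IsPreconnected O)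
    {z : Z} (hz : z ∈ O) {δ : ℝ} (hδ : 0 < δ) (hΦ : ContinuousOn Φ (O ×ˢ Ioo (-δ) δ))
    (hopen : IsOpen (Φ '' (O ×ˢ Ioo (-δ) δ))) (h0 : ∀ w ∈ O, Φ (w, 0) ∈ frontier I)
    (hne : ∀ w ∈ O, ∀ t ∈ Ioo (-δ) δ, t ≠ 0 → Φ (w, t) ∉ frontier I)
    (hside : Φ (z, 0) ∉ interior (closure I)) :
    (∀ w ∈ O, ∀ t ∈ Ioo 0 δ, Φ (w, t) ∈ I ∧ Φ (w, -t) ∉ I) ∨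
      (∀ w ∈ O, ∀ t ∈ Ioo 0 δ, Φ (w, t) ∉ I ∧ Φ (w, -t) ∈ I) := by
  have hsub₁ : O ×ˢ Ioo 0 δ ⊆ O ×ˢ Ioo (-δ) δ :=
    prod_mono_right (Ioo_subset_Ioo_left (by linarith))
  have hsub₂ : O ×ˢ Ioo (-δ) 0 ⊆ O ×ˢ Ioo (-δ) δ := prod_mono_right (Ioo_subset_Ioo_right hδ.le)
  have h₁ : Φ '' (O ×ˢ Ioo 0 δ) ⊆ I ∨ Disjoint (Φ '' (O ×ˢ Ioo 0 δ)) I := by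
    refine subset_or_disjoint_of_disjoint_frontier
      ((hO.prod isPreconnected_Ioo).image _ (hΦ.mono hsub₁)) hI (disjoint_left.2 ?_)
    rintro _ ⟨q, hq, rfl⟩
    exact hne q.1 hq.1 q.2 (hsub₁ hq).2 hq.2.1.ne'
  have h₂ : Φ '' (O ×ˢ Ioo (-δ) 0) ⊆ I ∨ Disjoint (Φ '' (O ×ˢ Ioo (-δ) 0)) I := by
    refine subset_or_disjoint_of_disjoint_frontier
      ((hO.prod isPreconnected_Ioo).image _ (hΦ.mono hsub₂)) hI (disjoint_left.2 ?_)
    rintro _ ⟨q, hq, rfl⟩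
    exact hne q.1 hq.1 q.2 (hsub₂ hq).2 hq.2.2.ne
  have hcover : ∀ q ∈ O ×ˢ Ioo (-δ) δ, q.2 = 0 ∨ q ∈ O ×ˢ Ioo 0 δ ∨ q ∈ O ×ˢ Ioo (-δ) 0 := by
    intro q hq
    rcases lt_trichotomy q.2 0 with h | h | h
    · exact Or.inr (Or.inr ⟨hq.1, hq.2.1, h⟩)
    · exact Or.inl h
    · exact Or.inr (Or.inl ⟨hq.1, h, hq.2.2⟩)
  have hz0 : (z, (0 : ℝ)) ∈ O ×ˢ Ioo (-δ) δ := ⟨hz, by simpa using hδ⟩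
  have hneg : ∀ {t : ℝ}, t ∈ Ioo 0 δ → -t ∈ Ioo (-δ) 0 := fun ht =>
    ⟨neg_lt_neg ht.2, neg_lt_zero.2 ht.1⟩
  -- Two cases are impossible. If both sides lay in `I`, the open image would lie in the closure of
  -- `I`, against `hside`; if neither did, the frontier point would have a neighbourhood disjoint
  -- from `I`.
  rcases h₁ with h₁ | h₁ <;> rcases h₂ with h₂ | h₂
  · exfalso
    apply hside
    refine mem_interior.2 ⟨_, ?_, hopen, mem_image_of_mem _ hz0⟩
    rintro _ ⟨q, hq, rfl⟩
    rcases hcover q hq with h | h | h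
    · have := h0 q.1 hq.1
      rw [show (q.1, (0 : ℝ)) = q from Prod.ext rfl h.symm] at this
      exact frontier_subset_closure this
    · exact subset_closure (h₁ (mem_image_of_mem _ h))
    · exact subset_closure (h₂ (mem_image_of_mem _ h))
  · exact Or.inl fun w hw t ht => ⟨h₁ (mem_image_of_mem _ ⟨hw, ht⟩),
      disjoint_left.1 h₂ (mem_image_of_mem _ ⟨hw, hneg ht⟩)⟩
  · exact Or.inr fun w hw t ht => ⟨disjoint_left.1 h₁ (mem_image_of_mem _ ⟨hw, ht⟩),
      h₂ (mem_image_of_mem _ ⟨hw, hneg ht⟩)⟩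
  · exfalso
    have hcl := frontier_subset_closure (h0 z hz)
    obtain ⟨_, ⟨q, hq, rfl⟩, hxI⟩ := mem_closure_iff.1 hcl _ hopen (mem_image_of_mem _ hz0)
    rcases hcover q hq with h | h | h
    · have := h0 q.1 hq.1
      rw [show (q.1, (0 : ℝ)) = q from Prod.ext rfl h.symm, hI.frontier_eq] at this
      exact this.2 hxI
    · exact disjoint_left.1 h₁ (mem_image_of_mem _ h) hxI
    · exact disjoint_left.1 h₂ (mem_image_of_mem _ h) hxI

end Sides

/-! ### Normal vectors along a parametrized hypersurface -/

section Normal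

variable {m : ℕ} {M : Type*} [TopologicalSpace M]
  {e : OpenPartialHomeomorph M (EuclideanSpace ℝ (Fin m))}
  {h : (Fin (m + 2) → ℝ) → Matrix (Fin (m + 2)) (Fin (m + 2)) ℝ}
  {Ψ : ℝ × M → (Fin (m + 2) → ℝ)} {Φ : (ℝ × M) × ℝ → (Fin (m + 2) → ℝ)}
  {S : Set ((ℝ × M) × ℝ)}

lemma tanCoord_mem_tanDomain {T : ℝ} {p : ℝ × M} (hp : p ∈ cylinder M T) (hpe : p.2 ∈ e.source) :
    tanCoord e p ∈ tanDomain e T :=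
  ⟨abs_lt.2 hp.1, by simpa using e.map_source hpe⟩

lemma tanPoint_mem_cylinder {T : ℝ} {y : Fin (m + 1) → ℝ} (hy : y ∈ tanDomain e T) :
    tanPoint e y ∈ cylinder M T :=
  ⟨abs_lt.1 hy.1, trivial⟩

variable (M) in
lemma isOpen_cylinder (T : ℝ) : IsOpen (cylinder M T) := isOpen_Ioo.prod isOpen_univ

variable [ChartedSpace (EuclideanSpace ℝ (Fin m)) M]

lemma isOpen_tanDomain (T : ℝ) : IsOpen (tanDomain e T) := by
  convert! isOpen_tanPoint_preimage (e := e) (isOpen_cylinder M T) using 1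
  ext y
  exact ⟨fun hy => ⟨hy.2, tanPoint_mem_cylinder hy⟩, fun hy => ⟨abs_lt.2 hy.2.1, hy.1⟩⟩

/-- The coordinates of points of `S` over points of the zero section in `S`. -/
def chartDomain (e : OpenPartialHomeomorph M (EuclideanSpace ℝ (Fin m))) (S : Set ((ℝ × M) × ℝ)) :
    Set (Fin (m + 2) → ℝ) :=
  {y | WithLp.toLp 2 (Fin.tail (Fin.init y)) ∈ e.target ∧
    tubePoint e y ∈ S ∩ (fun q => (q.1, 0)) ⁻¹' S}

lemma isOpen_chartDomain (hS : IsOpen S) : IsOpen (chartDomain e S) :=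
  isOpen_tubePoint_preimage (hS.inter (hS.preimage (by fun_prop)))

lemma tubeCoord_mem_chartDomain {q : (ℝ × M) × ℝ} (hq : q ∈ S) (hq0 : (q.1, (0 : ℝ)) ∈ S)
    (hqe : q.1.2 ∈ e.source) : tubeCoord e q ∈ chartDomain e S :=
  ⟨by simpa using e.map_source hqe, by rw [tubePoint_tubeCoord hqe]; exact ⟨hq, hq0⟩⟩

variable [IsManifold (𝓡 m) ∞ M]

lemma isTubeChart_comp (he : e ∈ IsManifold.maximalAtlas (𝓡 m) ∞ M) (hS : IsOpen S)
    (hΦ : ContMDiffOn (tubeModel m) 𝓘(ℝ, Fin (m + 2) → ℝ) ∞ Φ S)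
    (h0 : ∀ z, (z, (0 : ℝ)) ∈ S → Φ (z, 0) = Ψ z) :
    IsTubeChart (Ψ ∘ tanPoint e) (Φ ∘ tubePoint e) (chartDomain e S) where
  isOpen := isOpen_chartDomain hS
  smooth := (contDiffOn_comp_tubePoint he hΦ).mono fun _ hy => ⟨hy.1, hy.2.1⟩
  zero_mem y hy := by
    refine ⟨by simpa using hy.1, ?_⟩
    rw [tubePoint_zeroSection]
    exact ⟨hy.2.2, hy.2.2⟩
  eq_zeroSection w hw := by
    have h1 := hw.2.2
    rw [mem_preimage, tubePoint_zeroSection] at h1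
    rw [Function.comp_apply, Function.comp_apply, tubePoint_zeroSection, h0 _ h1]

lemma hasDerivAt_normal {F : Type*} [NormedAddCommGroup F] [NormedSpace ℝ F]
    {Φ : (ℝ × M) × ℝ → F} {y : Fin (m + 2) → ℝ}
    (hd : DifferentiableAt ℝ (Φ ∘ tubePoint e) y) :
    HasDerivAt (fun t => Φ (tanPoint e (Fin.init y), t))
      (pd (Φ ∘ tubePoint e) (Fin.last (m + 1)) y) (y (Fin.last (m + 1))) := by
  have h1 : DifferentiableAt ℝ (Φ ∘ tubePoint e)
      (Function.update y (Fin.last (m + 1)) (y (Fin.last (m + 1)))) := by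
    rwa [Function.update_eq_self]
  have h2 := hasDerivAt_update h1
  rw [Function.update_eq_self] at h2
  refine h2.congr_of_eventuallyEq (Eventually.of_forall fun t => ?_)
  simp [tubePoint]

/-- `n` is a unit normal at `Ψ p` of the hypersurface parametrized by `Ψ`. -/
structure IsUnitNormal (h : (Fin (m + 2) → ℝ) → Matrix (Fin (m + 2)) (Fin (m + 2)) ℝ)
    (Ψ : ℝ × M → (Fin (m + 2) → ℝ)) (p : ℝ × M) (n : Fin (m + 2) → ℝ) : Prop where
  unit : ip h (Ψ p) n n = 1
  orth : ∀ e ∈ IsManifold.maximalAtlas (𝓡 m) ∞ M, p.2 ∈ e.source → ∀ a,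
    ip h (Ψ p) n (pd (Ψ ∘ tanPoint e) a (tanCoord e p)) = 0

/-- Chain rule for the change of charts. It shows that the tangent space, and hence normality, does
not depend on the chart. -/
lemma pd_comp_tanPoint {e' : OpenPartialHomeomorph M (EuclideanSpace ℝ (Fin m))}
    (he : e ∈ IsManifold.maximalAtlas (𝓡 m) ∞ M) (he' : e' ∈ IsManifold.maximalAtlas (𝓡 m) ∞ M)
    {T : ℝ} (hΨ : ContMDiffOn (tanModel m) 𝓘(ℝ, Fin (m + 2) → ℝ) ∞ Ψ (cylinder M T)) {p : ℝ × M}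
    (hp : p ∈ cylinder M T) (hpe : p.2 ∈ e.source) (hpe' : p.2 ∈ e'.source) (a : Fin (m + 1)) :
    ∃ c : Fin (m + 1) → ℝ, pd (Ψ ∘ tanPoint e') a (tanCoord e' p) =
      ∑ b, c b • pd (Ψ ∘ tanPoint e) b (tanCoord e p) := by
  set U : Set (Fin (m + 1) → ℝ) :=
    {y | WithLp.toLp 2 (Fin.tail y) ∈ e'.target ∧ tanPoint e' y ∈ {p : ℝ × M | p.2 ∈ e.source}}
    with hU
  have hUo : IsOpen U := isOpen_tanPoint_preimage (e.open_source.preimage continuous_snd)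
  have hyU : tanCoord e' p ∈ U :=
    ⟨by simpa using e'.map_source hpe', by rwa [tanPoint_tanCoord hpe']⟩
  have hτ : ContDiffOn ℝ ∞ (tanCoord e ∘ tanPoint e') U :=
    contDiffOn_comp_tanPoint he' (contMDiffOn_tanCoord he)
  have hdτ : DifferentiableAt ℝ (tanCoord e ∘ tanPoint e') (tanCoord e' p) :=
    ((hτ _ hyU).contDiffAt (hUo.mem_nhds hyU)).differentiableAt (by simp)
  have hτp : (tanCoord e ∘ tanPoint e') (tanCoord e' p) = tanCoord e p := by
    rw [Function.comp_apply, tanPoint_tanCoord hpe']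
  have hD := isOpen_tanPoint_preimage (e := e) (isOpen_cylinder M T)
  have hyD : tanCoord e p ∈ {y : Fin (m + 1) → ℝ | WithLp.toLp 2 (Fin.tail y) ∈ e.target ∧
      tanPoint e y ∈ cylinder M T} :=
    ⟨by simpa using e.map_source hpe, by rwa [tanPoint_tanCoord hpe]⟩
  have hdg : DifferentiableAt ℝ (Ψ ∘ tanPoint e) ((tanCoord e ∘ tanPoint e') (tanCoord e' p)) := by
    rw [hτp]
    exact ((contDiffOn_comp_tanPoint he hΨ _ hyD).contDiffAt
      (hD.mem_nhds hyD)).differentiableAt (by simp)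
  have heq : Ψ ∘ tanPoint e' =ᶠ[𝓝 (tanCoord e' p)]
      (Ψ ∘ tanPoint e) ∘ (tanCoord e ∘ tanPoint e') := by
    filter_upwards [hUo.mem_nhds hyU] with y hy
    simp only [Function.comp_apply]
    rw [tanPoint_tanCoord hy.2]
  refine ⟨pd (tanCoord e ∘ tanPoint e') a (tanCoord e' p), ?_⟩
  rw [pd_congr heq, ← fderiv_eq_sum_pd, ← hτp]
  unfold pd
  rw [fderiv_comp _ hdg hdτ]
  rfl

lemma isUnitNormal_of_chart (he : e ∈ IsManifold.maximalAtlas (𝓡 m) ∞ M) {T : ℝ}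
    (hΨ : ContMDiffOn (tanModel m) 𝓘(ℝ, Fin (m + 2) → ℝ) ∞ Ψ (cylinder M T)) {p : ℝ × M}
    (hp : p ∈ cylinder M T) (hpe : p.2 ∈ e.source) {n : Fin (m + 2) → ℝ}
    (hn : ip h (Ψ p) n n = 1)
    (horth : ∀ a, ip h (Ψ p) n (pd (Ψ ∘ tanPoint e) a (tanCoord e p)) = 0) :
    IsUnitNormal h Ψ p n := by
  refine ⟨hn, fun e' he' hpe' a => ?_⟩
  obtain ⟨c, hc⟩ := pd_comp_tanPoint he he' hΨ hp hpe hpe' a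
  rw [hc, ip_sum_right]
  exact Finset.sum_eq_zero fun b _ => by rw [ip_smul_right, horth, mul_zero]

lemma IsUnitNormal.neg {p : ℝ × M} {n : Fin (m + 2) → ℝ} (H : IsUnitNormal h Ψ p n) :
    IsUnitNormal h Ψ p (-n) :=
  ⟨by rw [ip_neg_left, ip_neg_right, neg_neg, H.unit],
    fun e he hpe a => by rw [ip_neg_left, H.orth e he hpe, neg_zero]⟩

/-- A map which extends `Ψ` transversally is a local diffeomorphism. -/
lemma exists_isDiffeoOntoImage_of_transversal (hS : IsOpen S)
    (hΦ : ContMDiffOn (tubeModel m) 𝓘(ℝ, Fin (m + 2) → ℝ) ∞ Φ S)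
    (h0 : ∀ z, (z, (0 : ℝ)) ∈ S → Φ (z, 0) = Ψ z) {p : ℝ × M} (hp : (p, (0 : ℝ)) ∈ S)
    (himm : ∀ e ∈ IsManifold.maximalAtlas (𝓡 m) ∞ M, p.2 ∈ e.source →
      LinearIndependent ℝ fun a => pd (Ψ ∘ tanPoint e) a (tanCoord e p))
    {n v : Fin (m + 2) → ℝ} (hn : IsUnitNormal h Ψ p n)
    (hv : HasDerivAt (fun t => Φ (p, t)) v 0) (hnv : ip h (Ψ p) n v ≠ 0) :
    ∃ W, IsOpen W ∧ (p, 0) ∈ W ∧ IsDiffeoOntoImage Φ W := by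
  set e := chartAt (EuclideanSpace ℝ (Fin m)) p.2
  have he : e ∈ IsManifold.maximalAtlas (𝓡 m) ∞ M := IsManifold.chart_mem_maximalAtlas p.2
  have hpe : p.2 ∈ e.source := mem_chart_source _ _
  have H := isTubeChart_comp (Ψ := Ψ) he hS hΦ h0
  have hy : tubeCoord e (p, 0) ∈ chartDomain e S := tubeCoord_mem_chartDomain hp hp hpe
  have hd : DifferentiableAt ℝ (Φ ∘ tubePoint e) (tubeCoord e (p, 0)) :=
    ((H.smooth _ hy).contDiffAt (H.isOpen.mem_nhds hy)).differentiableAt (by simp)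
  have hlast : pd (Φ ∘ tubePoint e) (Fin.last (m + 1)) (tubeCoord e (p, 0)) = v := by
    have h1 := hasDerivAt_normal hd
    rw [init_tubeCoord, tanPoint_tanCoord hpe, tubeCoord_last] at h1
    exact h1.unique hv
  have hcast : ∀ a : Fin (m + 1), pd (Φ ∘ tubePoint e) a.castSucc (tubeCoord e (p, 0)) =
      pd (Ψ ∘ tanPoint e) a (tanCoord e p) := fun a => by
    rw [tubeCoord_eq_zeroSection] at hy ⊢
    exact (H.pd_eq hy a).symm
  refine exists_isDiffeoOntoImage he hS hΦ hp hpe ?_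
  refine linearIndependent_of_normal (h := h) (x := Ψ p) (n := n) ?_ (by rwa [hlast])
    fun a => by rw [hcast]; exact hn.orth e he hpe a
  simpa only [hcast] using himm e he hpe

/-- The unit normal is smooth in local coordinates. -/
lemma exists_local_unit_normal (hh : IsAdmissibleMetric h) {T : ℝ}
    (hΨ : ContMDiffOn (tanModel m) 𝓘(ℝ, Fin (m + 2) → ℝ) ∞ Ψ (cylinder M T))
    (himm : ∀ e ∈ IsManifold.maximalAtlas (𝓡 m) ∞ M, ∀ y ∈ tanDomain e T,
      LinearIndependent ℝ fun a => pd (Ψ ∘ tanPoint e) a y)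
    (htime : IsTimelike h T Ψ) {p : ℝ × M} (hp : p ∈ cylinder M T) :
    ∃ (O : Set (ℝ × M)) (n : ℝ × M → (Fin (m + 2) → ℝ)), IsOpen O ∧ p ∈ O ∧ O ⊆ cylinder M T ∧
      ContMDiffOn (tanModel m) 𝓘(ℝ, Fin (m + 2) → ℝ) ∞ n O ∧
      ∀ w ∈ O, IsUnitNormal h Ψ w (n w) := by
  set e := chartAt (EuclideanSpace ℝ (Fin m)) p.2
  have he : e ∈ IsManifold.maximalAtlas (𝓡 m) ∞ M := IsManifold.chart_mem_maximalAtlas p.2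
  have hpe : p.2 ∈ e.source := mem_chart_source _ _
  have hdet : ∀ x, (h x).det ≠ 0 := fun x => (hh.det_neg x).ne
  set g := Ψ ∘ tanPoint e with hg
  set D := tanDomain e T with hD
  have hDo : IsOpen D := isOpen_tanDomain T
  have hgs : ContDiffOn ℝ ∞ g D := (contDiffOn_comp_tanPoint he hΨ).mono fun y hy =>
    ⟨hy.2, tanPoint_mem_cylinder hy⟩
  -- The covector v ↦ det(∂_a Ψ, v) annihilates the tangent space and is smooth. Raising its index
  -- gives a nonzero normal, orthogonal to a timelike tangent vector and hence spacelike, so it can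
  -- be normalized.
  set cc : (Fin (m + 1) → ℝ) → (Fin (m + 2) → ℝ) := fun y => crossCovector fun a => pd g a y with hcc
  have hccs : ContDiffOn ℝ ∞ cc D := contDiffOn_pi.2 fun α => by
    simp only [hcc, crossCovector, Matrix.adjugate_apply]
    refine contDiffOn_det fun i j => ?_
    induction i using Fin.lastCases with
    | last => simpa using contDiffOn_const
    | cast a =>
      simpa [Matrix.updateRow_ne (Fin.castSucc_lt_last a).ne] using
        contDiffOn_pi.1 (contDiffOn_pd hDo hgs a) j
  set N : (Fin (m + 1) → ℝ) → (Fin (m + 2) → ℝ) := fun y => (h (g y))⁻¹ *ᵥ cc y with hN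
  have hNs : ContDiffOn ℝ ∞ N D := contDiffOn_pi.2 fun α => by
    simp only [hN, Matrix.mulVec, dotProduct]
    refine ContDiffOn.sum fun β _ => ContDiffOn.mul ?_ (contDiffOn_pi.1 hccs β)
    exact contDiffOn_inv_apply (fun i j => (hh.smooth i j).comp_contDiffOn hgs)
      (fun x _ => hdet _) α β
  have hhN : ∀ y, h (g y) *ᵥ N y = cc y := fun y => by
    simp only [hN, Matrix.mulVec_mulVec, Matrix.mul_nonsing_inv _ (isUnit_iff_ne_zero.2 (hdet _)),
      Matrix.one_mulVec]
  have hipN : ∀ y v, ip h (g y) (N y) v = cc y ⬝ᵥ v := fun y v => by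
    rw [ip_comm (hh.symm _), ip, hhN, dotProduct_comm]
  have horth : ∀ y a, ip h (g y) (N y) (pd g a y) = 0 := fun y a => by
    rw [hipN]; exact crossCovector_orthogonal (fun a => pd g a y) a
  have hpos : ∀ y ∈ D, 0 < ip h (g y) (N y) (N y) := fun y hy => by
    obtain ⟨v, hv, hvv⟩ := htime e he y hy
    refine hh.ip_self_pos hvv (fun h0 => ?_) ?_
    · have := hhN y
      rw [h0, Matrix.mulVec_zero] at this
      exact crossCovector_ne_zero (himm e he y hy) this.symm
    · clear hvv
      induction hv using Submodule.span_induction with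
      | mem v hv => obtain ⟨a, rfl⟩ := hv; exact horth y a
      | zero => simp [ip]
      | add v w _ _ h1 h2 => rw [ip_add_right, h1, h2, add_zero]
      | smul r v _ h1 => rw [ip_smul_right, h1, mul_zero]
  set ñ : (Fin (m + 1) → ℝ) → (Fin (m + 2) → ℝ) := fun y =>
    (Real.sqrt (ip h (g y) (N y) (N y)))⁻¹ • N y with hñ
  have hñs : ContDiffOn ℝ ∞ ñ D := by
    refine ContDiffOn.smul (ContDiffOn.inv (ContDiffOn.sqrt ?_ fun y hy => (hpos y hy).ne')
      fun y hy => (Real.sqrt_pos.2 (hpos y hy)).ne') hNs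
    exact contDiffOn_ip hh.smooth hgs hNs hNs
  refine ⟨{w | w.2 ∈ e.source} ∩ cylinder M T, ñ ∘ tanCoord e,
    (e.open_source.preimage continuous_snd).inter (isOpen_cylinder M T), ⟨hpe, hp⟩,
    inter_subset_right, ?_, ?_⟩
  · exact hñs.contMDiffOn.comp ((contMDiffOn_tanCoord he).mono inter_subset_left)
      fun w hw => tanCoord_mem_tanDomain hw.2 hw.1
  · rintro w ⟨hwe, hw⟩
    have hy := tanCoord_mem_tanDomain hw hwe
    have hgw : g (tanCoord e w) = Ψ w := by rw [hg, Function.comp_apply, tanPoint_tanCoord hwe]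
    have hs := Real.sqrt_pos.2 (hpos _ hy)
    refine isUnitNormal_of_chart he hΨ hw hwe ?_ fun a => ?_
    · rw [Function.comp_apply, hñ, ip_smul_left, ip_smul_right, ← hgw, ← mul_assoc]
      have := Real.mul_self_sqrt (hpos _ hy).le
      field_simp
      rw [sq]; exact this.symm
    · rw [Function.comp_apply, hñ, ip_smul_left, ← hgw, horth, mul_zero]

end Normal

/-! ### The inward normal -/

section Inward

variable {m : ℕ} {M : Type*} [TopologicalSpace M] [ChartedSpace (EuclideanSpace ℝ (Fin m)) M]
  {h : (Fin (m + 2) → ℝ) → Matrix (Fin (m + 2)) (Fin (m + 2)) ℝ}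
  {Ψ : ℝ × M → (Fin (m + 2) → ℝ)} {Φ : (ℝ × M) × ℝ → (Fin (m + 2) → ℝ)}
  {I : Set (Fin (m + 2) → ℝ)} {T : ℝ}

lemma isOpen_slab (m : ℕ) (T : ℝ) : IsOpen (slab m T) :=
  isOpen_lt (continuous_apply 0).abs continuous_const

/-! ### Which side of the hypersurface lies in `I`. -/

namespace IsAdaptedParametrization

variable (hΨ : IsAdaptedParametrization h T (lateralBoundary I T) Ψ) {p : ℝ × M}
  {W : Set ((ℝ × M) × ℝ)}
include hΨ

lemma mem_frontier (hp : p ∈ cylinder M T) : Ψ p ∈ frontier I :=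
  (hΨ.image_eq ▸ mem_image_of_mem Ψ hp : Ψ p ∈ lateralBoundary I T).1

lemma mem_slab (hp : p ∈ cylinder M T) : Ψ p ∈ slab m T :=
  (hΨ.image_eq ▸ mem_image_of_mem Ψ hp : Ψ p ∈ lateralBoundary I T).2

/-- Embeddedness prevents distant parts of the hypersurface from returning close to Ψ p. -/
lemma exists_mem_nhds (hp : p ∈ cylinder M T) {A : Set (ℝ × M)} (hA : A ∈ 𝓝 p) :
    ∃ V ∈ 𝓝 (Ψ p), ∀ w ∈ cylinder M T, Ψ w ∈ V → w ∈ A := by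
  have h1 : Subtype.val ⁻¹' A ∈ 𝓝 (⟨p, hp⟩ : cylinder M T) :=
    continuous_subtype_val.continuousAt.preimage_mem_nhds hA
  rw [hΨ.embedding.isInducing.nhds_eq_comap] at h1
  obtain ⟨V, hV, hVA⟩ := mem_comap.1 h1
  exact ⟨V, hV, fun w hw hwV => hVA (a := ⟨w, hw⟩) hwV⟩

lemma injOn : InjOn Ψ (cylinder M T) := fun p hp q hq hpq =>
  congrArg Subtype.val (hΨ.embedding.injective (a₁ := ⟨p, hp⟩) (a₂ := ⟨q, hq⟩) hpq)

/-- A frontier point near Ψ p lies in the slab, so it is Ψ w for some w; embeddedness puts w near p.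
Injectivity of `Φ` then identifies q with (w, 0). -/
lemma eventually_notMem_frontier (hp : p ∈ cylinder M T) (hW : IsOpen W) (hpW : (p, (0 : ℝ)) ∈ W)
    (hinj : InjOn Φ W) (hc : ContinuousAt Φ (p, 0))
    (h0 : ∀ z ∈ cylinder M T, (z, (0 : ℝ)) ∈ W → Φ (z, 0) = Ψ z) :
    ∀ᶠ q in 𝓝 (p, (0 : ℝ)), q.2 ≠ 0 → Φ q ∉ frontier I := by
  have hA : {w : ℝ × M | (w, (0 : ℝ)) ∈ W} ∈ 𝓝 p :=
    (hW.preimage (by fun_prop : Continuous fun w : ℝ × M => (w, (0 : ℝ)))).mem_nhds hpW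
  obtain ⟨V, hV, hVA⟩ := hΨ.exists_mem_nhds hp hA
  have hΦp := h0 p hp hpW
  have h1 : ∀ᶠ q in 𝓝 (p, (0 : ℝ)), Φ q ∈ V ∩ slab m T := by
    refine hc.preimage_mem_nhds ?_
    rw [hΦp]
    exact inter_mem hV ((isOpen_slab m T).mem_nhds (hΨ.mem_slab hp))
  filter_upwards [h1, hW.mem_nhds hpW] with q hq hqW hq0 hqf
  obtain ⟨w, hw, hwq⟩ : Φ q ∈ Ψ '' cylinder M T := by
    rw [hΨ.image_eq]; exact ⟨hqf, hq.2⟩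
  have hwW : (w, (0 : ℝ)) ∈ W := hVA w hw (hwq ▸ hq.1)
  exact hq0 (congrArg Prod.snd (hinj hqW hwW (by rw [h0 w hw hwW, hwq])))

/-- A local diffeomorphism which extends `Ψ` maps exactly one of the two sides into `I`. -/
lemma eventually_side (hI : IsOpen I)
    (hside : Disjoint (lateralBoundary I T) (interior (closure I)))
    (hp : p ∈ cylinder M T) (hW : IsOpen W) (hpW : (p, (0 : ℝ)) ∈ W)
    (hΦ : IsDiffeoOntoImage Φ W)
    (h0 : ∀ z ∈ cylinder M T, (z, (0 : ℝ)) ∈ W → Φ (z, 0) = Ψ z) :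
    (∀ᶠ q in 𝓝 (p, (0 : ℝ)), q.2 ≠ 0 → Φ q ∉ frontier I ∧ (Φ q ∈ I ↔ 0 < q.2)) ∨
      ∀ᶠ q in 𝓝 (p, (0 : ℝ)), q.2 ≠ 0 → Φ q ∉ frontier I ∧ (Φ q ∈ I ↔ q.2 < 0) := by
  have : LocallyConnectedSpace M :=
    ChartedSpace.locallyConnectedSpace (EuclideanSpace ℝ (Fin m)) M
  have hc : ContinuousAt Φ (p, 0) := hΦ.2.2.1.continuousOn.continuousAt (hW.mem_nhds hpW)
  have h1 := hΨ.eventually_notMem_frontier hp hW hpW hΦ.2.1 hc h0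
  have h2 : ∀ᶠ q in 𝓝 (p, (0 : ℝ)), q.1 ∈ cylinder M T :=
    continuousAt_fst.preimage_mem_nhds ((isOpen_cylinder M T).mem_nhds hp)
  obtain ⟨U, hU, J, hJ, hUJ⟩ := mem_nhds_prod_iff.1 (h1.and (h2.and (hW.mem_nhds hpW)))
  -- A connected base makes each of the two half-boxes connected, as `exists_side` needs.
  obtain ⟨O, hOU, hOo, hpO, hOc⟩ :=
    locallyConnectedSpace_iff_subsets_isOpen_isConnected.1 inferInstance p U hU
  obtain ⟨δ, hδ, hδJ⟩ := Metric.mem_nhds_iff.1 hJ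
  rw [Real.ball_eq_Ioo, zero_sub, zero_add] at hδJ
  have hN : O ×ˢ Ioo (-δ) δ ⊆ _ := (prod_mono hOU hδJ).trans hUJ
  have hNo : IsOpen (O ×ˢ Ioo (-δ) δ) := hOo.prod isOpen_Ioo
  have h0δ : (0 : ℝ) ∈ Ioo (-δ) δ := ⟨neg_lt_zero.2 hδ, hδ⟩
  have hNW : O ×ˢ Ioo (-δ) δ ⊆ W := fun q hq => (hN hq).2.2
  have hz : ∀ w ∈ O, Φ (w, 0) = Ψ w ∧ w ∈ cylinder M T := fun w hw => by
    have := hN (mk_mem_prod hw h0δ)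
    exact ⟨h0 w this.2.1 this.2.2, this.2.1⟩
  have hmem : O ×ˢ Ioo (-δ) δ ∈ 𝓝 (p, (0 : ℝ)) := hNo.mem_nhds ⟨hpO, h0δ⟩
  have key := exists_side (Φ := Φ) hI hOc.isPreconnected hpO hδ
    (hΦ.2.2.1.continuousOn.mono hNW) (hΦ.mono hNo hNW).1
    (fun w hw => by rw [(hz w hw).1]; exact hΨ.mem_frontier (hz w hw).2)
    (fun w hw t ht ht0 => (hN (mk_mem_prod hw ht)).1 ht0)
    (by
      rw [(hz p hpO).1]
      exact disjoint_left.1 hside ⟨hΨ.mem_frontier hp, hΨ.mem_slab hp⟩)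
  refine key.imp (fun key => ?_) (fun key => ?_)
  all_goals
    filter_upwards [hmem] with q hq hq0
    refine ⟨(hN hq).1 hq0, ?_⟩
    rcases lt_or_gt_of_ne hq0 with hlt | hlt
    · have := (key q.1 hq.1 (-q.2) ⟨by linarith, by linarith [hq.2.1]⟩).2
      rw [neg_neg] at this
      first
        | exact iff_of_false this hlt.not_gt
        | exact iff_of_true this hlt
    · have := (key q.1 hq.1 q.2 ⟨hlt, hq.2.2⟩).1
      first
        | exact iff_of_true this hlt
        | exact iff_of_false this hlt.not_gt

end IsAdaptedParametrization

/-- A straight line in the direction of the normal derivative enters the side `{q.2 > 0}`. -/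
lemma eventually_exists_eq_add_smul {W : Set ((ℝ × M) × ℝ)} {p : ℝ × M} (hW : IsOpen W)
    (hpW : (p, (0 : ℝ)) ∈ W) (hΦ : IsDiffeoOntoImage Φ W) {v : Fin (m + 2) → ℝ}
    (hv : HasDerivAt (fun t => Φ (p, t)) v 0) {P : (ℝ × M) × ℝ → Prop}
    (hP : ∀ᶠ q in 𝓝 (p, (0 : ℝ)), P q) :
    ∀ᶠ s in 𝓝[>] (0 : ℝ), ∃ q, 0 < q.2 ∧ P q ∧ Φ q = Φ (p, 0) + s • v := by
  obtain ⟨Ξ, hl, hΞ⟩ := hΦ.2.2.2 ⟨_, hpW⟩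
  have hx : Φ '' W ∈ 𝓝 (Φ (p, 0)) := hΦ.1.mem_nhds (mem_image_of_mem _ hpW)
  have hd : DifferentiableAt ℝ (fun x => (Ξ x).2) (Φ (p, 0)) := by
    have h1 := (hΞ _ (mem_image_of_mem _ hpW)).contMDiffAt hx
    have h2 : ContMDiffAt 𝓘(ℝ, Fin (m + 2) → ℝ) 𝓘(ℝ, ℝ) ∞ (fun x => (Ξ x).2) (Φ (p, 0)) := h1.snd
    exact h2.contDiffAt.differentiableAt (by simp)
  -- Along the curve t ↦ Φ(p, t) the height is t, so its derivative in the direction v is 1. Hence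
  -- the height is also positive just after 0 along the straight line.
  have hfd : fderiv ℝ (fun x => (Ξ x).2) (Φ (p, 0)) v = 1 := by
    have h1 := hd.hasFDerivAt.comp_hasDerivAt_of_eq (0 : ℝ) hv rfl
    have h2 : (fun t => (Ξ (Φ (p, t))).2) =ᶠ[𝓝 0] fun t => t := by
      have : ∀ᶠ t in 𝓝 (0 : ℝ), (p, t) ∈ W :=
        (hW.preimage (by fun_prop : Continuous fun t : ℝ => (p, t))).mem_nhds hpW
      filter_upwards [this] with t ht
      rw [hl ht]
    exact (h1.congr_of_eventuallyEq h2.symm).unique (hasDerivAt_id 0)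
  have hline : HasDerivAt (fun s : ℝ => Φ (p, 0) + s • v) v 0 := by
    simpa using ((hasDerivAt_id (0 : ℝ)).smul_const v).const_add (Φ (p, 0))
  have hτ : HasDerivAt (fun s : ℝ => (Ξ (Φ (p, 0) + s • v)).2) 1 0 := by
    rw [← hfd]
    exact hd.hasFDerivAt.comp_hasDerivAt_of_eq (0 : ℝ) hline (by simp)
  have hpos : ∀ᶠ s in 𝓝[>] (0 : ℝ), 0 < (Ξ (Φ (p, 0) + s • v)).2 := by
    have h1 := (hasDerivAt_iff_tendsto_slope.1 hτ).eventually (lt_mem_nhds one_pos)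
    filter_upwards [nhdsWithin_mono 0 (fun s (hs : 0 < s) => hs.ne') h1, self_mem_nhdsWithin]
      with s hs hs0
    rw [slope_def_field, zero_smul, add_zero, hl hpW, sub_zero, sub_zero] at hs
    exact (div_pos_iff_of_pos_right hs0).1 hs
  have hct : Tendsto (fun s : ℝ => Φ (p, 0) + s • v) (𝓝[>] 0) (𝓝 (Φ (p, 0))) := by
    have := hline.continuousAt.tendsto
    rw [zero_smul, add_zero] at this
    exact this.mono_left nhdsWithin_le_nhds
  have hΞt : Tendsto Ξ (𝓝 (Φ (p, 0))) (𝓝 (p, 0)) := by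
    have := (hΞ.continuousOn.continuousAt hx).tendsto
    rwa [hl hpW] at this
  filter_upwards [hpos, (hΞt.comp hct).eventually hP, hct.eventually hx] with s h1 h2 h3
  refine ⟨_, h1, h2, ?_⟩
  obtain ⟨q, hq, hqs⟩ := h3
  rw [← hqs, hl hq]

variable [IsManifold (𝓡 m) ∞ M]

/-- `n` is the unit normal at `Ψ p` of the hypersurface parametrized by `Ψ`, pointing into `I`. -/
def IsInwardUnitNormal (h : (Fin (m + 2) → ℝ) → Matrix (Fin (m + 2)) (Fin (m + 2)) ℝ)
    (I : Set (Fin (m + 2) → ℝ)) (Ψ : ℝ × M → (Fin (m + 2) → ℝ)) (p : ℝ × M)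
    (n : Fin (m + 2) → ℝ) : Prop :=
  IsUnitNormal h Ψ p n ∧ ∀ᶠ s : ℝ in 𝓝[>] 0, Ψ p + s • n ∈ I

namespace IsAdaptedParametrization

variable (hΨ : IsAdaptedParametrization h T (lateralBoundary I T) Ψ) {p : ℝ × M}
include hΨ

lemma linearIndependent_pd (hp : p ∈ cylinder M T)
    (e : OpenPartialHomeomorph M (EuclideanSpace ℝ (Fin m)))
    (he : e ∈ IsManifold.maximalAtlas (𝓡 m) ∞ M) (hpe : p.2 ∈ e.source) :
    LinearIndependent ℝ fun a => pd (Ψ ∘ tanPoint e) a (tanCoord e p) :=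
  hΨ.immersion e he _ (tanCoord_mem_tanDomain hp hpe)

lemma eq_or_eq_neg (hh : IsAdmissibleMetric h) (hp : p ∈ cylinder M T) {n n' : Fin (m + 2) → ℝ}
    (hn : IsUnitNormal h Ψ p n) (hn' : IsUnitNormal h Ψ p n') : n' = n ∨ n' = -n := by
  have he : chartAt (EuclideanSpace ℝ (Fin m)) p.2 ∈ IsManifold.maximalAtlas (𝓡 m) ∞ M :=
    IsManifold.chart_mem_maximalAtlas p.2
  have hpe := mem_chart_source (EuclideanSpace ℝ (Fin m)) p.2
  exact unit_normal_eq_or_eq_neg (hh.det_neg _).ne (hΨ.linearIndependent_pd hp _ he hpe)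
    hn.unit (hn.orth _ he hpe) hn'.unit (hn'.orth _ he hpe)

/-- The map Ψ + t n with a smooth local normal n is a local diffeomorphism, so exactly one of its
sides lies in `I`. The sign this forces on n is the same throughout a neighbourhood, which preserves
smoothness, and the opposite normal leaves `I`. -/
lemma exists_local_inward_normal (hh : IsAdmissibleMetric h) (hI : IsOpen I)
    (hside : Disjoint (lateralBoundary I T) (interior (closure I)))
    (htime : IsTimelike h T Ψ) (hp : p ∈ cylinder M T) :
    ∃ n : ℝ × M → (Fin (m + 2) → ℝ), ContMDiffAt (tanModel m) 𝓘(ℝ, Fin (m + 2) → ℝ) ∞ n p ∧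
      ∀ᶠ w in 𝓝 p, IsInwardUnitNormal h I Ψ w (n w) ∧
        ∀ n', IsInwardUnitNormal h I Ψ w n' → n' = n w := by
  obtain ⟨O, n, hO, hpO, hOT, hn, hnn⟩ :=
    exists_local_unit_normal hh hΨ.smooth hΨ.immersion htime hp
  set Φ : (ℝ × M) × ℝ → (Fin (m + 2) → ℝ) := fun q => Ψ q.1 + q.2 • n q.1 with hΦdef
  have hΦs : ContMDiffOn (tubeModel m) 𝓘(ℝ, Fin (m + 2) → ℝ) ∞ Φ (O ×ˢ univ) := by
    refine ContMDiffOn.add ?_ (ContMDiffOn.smul contMDiffOn_snd ?_)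
    · exact (hΨ.smooth.mono hOT).comp contMDiffOn_fst fun q hq => hq.1
    · exact hn.comp contMDiffOn_fst fun q hq => hq.1
  have h0 : ∀ z, Φ (z, 0) = Ψ z := fun z => by simp [hΦdef]
  have hline : ∀ w, HasDerivAt (fun t => Φ (w, t)) (n w) 0 := fun w => by
    simpa [hΦdef] using ((hasDerivAt_id (0 : ℝ)).smul_const (n w)).const_add (Ψ w)
  obtain ⟨W, hW, hpW, hdiff⟩ := exists_isDiffeoOntoImage_of_transversal (h := h)
    (hO.prod isOpen_univ) hΦs (fun z _ => h0 z) (mk_mem_prod hpO trivial)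
    (hΨ.linearIndependent_pd hp) (hnn p hpO) (hline p) (by rw [(hnn p hpO).unit]; exact one_ne_zero)
  have hOn : O ∈ 𝓝 p := hO.mem_nhds hpO
  have hpos : ∀ᶠ s in 𝓝[>] (0 : ℝ), 0 < s := self_mem_nhdsWithin
  rcases hΨ.eventually_side hI hside hp hW hpW hdiff fun z _ _ => h0 z with hs | hs
  · refine ⟨n, hn.contMDiffAt hOn, ?_⟩
    filter_upwards [hOn, hs.curry_nhds] with w hw hws
    refine ⟨⟨hnn w hw, ?_⟩, fun n' hn' => ?_⟩
    · filter_upwards [hpos, nhdsWithin_le_nhds hws] with s hs0 hs1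
      exact (hs1 (ne_of_gt hs0)).2.2 hs0
    · refine (hΨ.eq_or_eq_neg hh (hOT hw) (hnn w hw) hn'.1).resolve_right fun heq => ?_
      have hneg : Tendsto (fun s : ℝ => -s) (𝓝[>] 0) (𝓝 0) := by
        simpa using (continuous_neg.tendsto (0 : ℝ)).mono_left nhdsWithin_le_nhds
      obtain ⟨s, hs0, hs1, hs2⟩ := (hpos.and ((hneg.eventually hws).and hn'.2)).exists
      have hs0' : 0 < s := hs0
      have h1 : Φ (w, -s) ∈ I := by simpa [hΦdef, heq] using hs2
      exact absurd ((hs1 (by simpa using hs0'.ne')).2.1 h1) (by simpa using hs0'.le)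
  · refine ⟨fun w => -n w, (hn.contMDiffAt hOn).neg, ?_⟩
    filter_upwards [hOn, hs.curry_nhds] with w hw hws
    refine ⟨⟨(hnn w hw).neg, ?_⟩, fun n' hn' => ?_⟩
    · have hneg : Tendsto (fun s : ℝ => -s) (𝓝[>] 0) (𝓝 0) := by
        simpa using (continuous_neg.tendsto (0 : ℝ)).mono_left nhdsWithin_le_nhds
      filter_upwards [hpos, hneg.eventually hws] with s hs0 hs1
      have hs0' : 0 < s := hs0
      have := (hs1 (by simpa using hs0'.ne')).2.2 (by simpa using hs0')
      simpa [hΦdef] using this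
    · refine (hΨ.eq_or_eq_neg hh (hOT hw) (hnn w hw) hn'.1).resolve_left fun heq => ?_
      obtain ⟨s, hs0, hs1, hs2⟩ :=
        (hpos.and ((hws.filter_mono nhdsWithin_le_nhds).and hn'.2)).exists
      have hs0' : 0 < s := hs0
      have h1 : Φ (w, s) ∈ I := by simpa [hΦdef, heq] using hs2
      exact absurd ((hs1 hs0'.ne').2.1 h1) hs0'.not_gt

/-- The inward unit normal is smooth. -/
theorem exists_inward_normal (hh : IsAdmissibleMetric h) (hI : IsOpen I)
    (hside : Disjoint (lateralBoundary I T) (interior (closure I)))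
    (htime : IsTimelike h T Ψ) :
    ∃ ν : ℝ × M → (Fin (m + 2) → ℝ),
      ContMDiffOn (tanModel m) 𝓘(ℝ, Fin (m + 2) → ℝ) ∞ ν (cylinder M T) ∧
      ∀ p ∈ cylinder M T, IsInwardUnitNormal h I Ψ p (ν p) := by
  have hloc := fun p hp => hΨ.exists_local_inward_normal hh hI hside htime (p := p) hp
  have hex : ∀ p : ℝ × M, ∃ n, p ∈ cylinder M T → IsInwardUnitNormal h I Ψ p n := fun p => by
    by_cases hp : p ∈ cylinder M T
    · obtain ⟨n, -, hn⟩ := hloc p hp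
      exact ⟨n p, fun _ => hn.self_of_nhds.1⟩
    · exact ⟨0, fun h => absurd h hp⟩
  choose ν hν using hex
  refine ⟨ν, fun p hp => ?_, hν⟩
  -- By uniqueness the pointwise choice coincides with the smooth local normal near p.
  obtain ⟨n, hn, hev⟩ := hloc p hp
  refine (hn.congr_of_eventuallyEq ?_).contMDiffWithinAt
  filter_upwards [hev, (isOpen_cylinder M T).mem_nhds hp] with w hw hwT
  exact hw.2 _ (hν w hwT)

/-- A local diffeomorphism which extends `Ψ`, with the inward unit normal as its normal derivative,
maps `{q.2 > 0}` to `I`. -/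
lemma eventually_mem_iff (hI : IsOpen I)
    (hside : Disjoint (lateralBoundary I T) (interior (closure I)))
    (hp : p ∈ cylinder M T) {W : Set ((ℝ × M) × ℝ)} (hW : IsOpen W) (hpW : (p, (0 : ℝ)) ∈ W)
    (hΦ : IsDiffeoOntoImage Φ W)
    (h0 : ∀ z ∈ cylinder M T, (z, (0 : ℝ)) ∈ W → Φ (z, 0) = Ψ z) {v : Fin (m + 2) → ℝ}
    (hv : HasDerivAt (fun t => Φ (p, t)) v 0) (hvI : IsInwardUnitNormal h I Ψ p v) :
    ∀ᶠ q in 𝓝 (p, (0 : ℝ)), q.2 ≠ 0 → Φ q ∉ frontier I ∧ (Φ q ∈ I ↔ 0 < q.2) := by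
  refine (hΨ.eventually_side hI hside hp hW hpW hΦ h0).resolve_right fun hs => ?_
  obtain ⟨s, ⟨q, hq0, hq, hqs⟩, hsI⟩ :=
    ((eventually_exists_eq_add_smul hW hpW hΦ hv hs).and hvI.2).exists
  rw [← h0 p hp hpW, ← hqs] at hsI
  exact hq0.not_gt ((hq hq0.ne').2.1 hsI)

omit [IsManifold (𝓡 m) ∞ M] in
-- y ↦ Ψ(0, y) embeds `M` onto frontier I ∩ {x^0 = 0}, which is closed and bounded.
lemma compactSpace (hT : 0 < T) (hbdd : Bornology.IsBounded I) : CompactSpace M := by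
  have hmem : ∀ y : M, ((0 : ℝ), y) ∈ cylinder M T := fun y => ⟨⟨neg_lt_zero.2 hT, hT⟩, trivial⟩
  have hind : IsInducing fun y : M => Ψ (0, y) := by
    have h1 : IsInducing fun y : M => (⟨(0, y), hmem y⟩ : cylinder M T) := by
      refine IsInducing.of_comp ?_ continuous_subtype_val (?_ : IsInducing fun y : M => ((0 : ℝ), y))
      · fun_prop
      · exact (isEmbedding_prodMkRight (0 : ℝ)).isInducing
    exact hΨ.embedding.isInducing.comp h1
  have himg : (fun y : M => Ψ (0, y)) '' univ = frontier I ∩ {x | x 0 = 0} := by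
    ext x
    constructor
    · rintro ⟨y, -, rfl⟩
      exact ⟨hΨ.mem_frontier (hmem y), hΨ.time_eq _ (hmem y)⟩
    · rintro ⟨hx, hx0⟩
      obtain ⟨w, hw, rfl⟩ : x ∈ Ψ '' cylinder M T := by
        rw [hΨ.image_eq]
        have hx0' : x 0 = 0 := hx0
        exact ⟨hx, show |x 0| < T by rwa [hx0', abs_zero]⟩
      have : w.1 = 0 := by rw [← hΨ.time_eq w hw]; exact hx0
      exact ⟨w.2, trivial, by rw [← this]⟩
  rw [← isCompact_univ_iff, hind.isCompact_iff, himg]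
  refine IsCompact.inter_right ?_ (isClosed_eq (continuous_apply 0) continuous_const)
  exact (Metric.isCompact_of_isClosed_isBounded isClosed_closure hbdd.closure).of_isClosed_subset
    isClosed_frontier frontier_subset_closure

end IsAdaptedParametrization
end Inward

/-! ### The normal geodesic flow of a hypersurface -/

section NormalFlow

variable {m : ℕ} {h : (Fin (m + 2) → ℝ) → Matrix (Fin (m + 2)) (Fin (m + 2)) ℝ}

lemma pd_coord {k : ℕ} (i a : Fin k) (y : Fin k → ℝ) :
    pd (fun z : Fin k → ℝ => z i) a y = if i = a then 1 else 0 := by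
  have h1 : HasFDerivAt (fun z : Fin k → ℝ => z i)
      (ContinuousLinearMap.proj (R := ℝ) (φ := fun _ : Fin k => ℝ) i) y := hasFDerivAt_apply i y
  rw [pd, h1.fderiv]
  simp [Pi.single_apply]

lemma contDiff_velocity {k : ℕ} {q : (Fin k → ℝ) → Matrix (Fin k) (Fin k) ℝ}
    (hq : ∀ α β, ContDiff ℝ ∞ fun x => q x α β) :
    ContDiff ℝ ∞ fun z : (Fin k → ℝ) × (Fin k → ℝ) => velocity q z.1 z.2 :=
  (contDiff_hamiltonianField hq).fst

namespace IsAdmissibleMetric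

variable (hh : IsAdmissibleMetric h)
include hh

lemma contDiff_invMetric (α β : Fin (m + 2)) : ContDiff ℝ ∞ fun x => invMetric h x α β :=
  contDiffOn_univ.1 (contDiffOn_inv_apply (fun i j => (hh.smooth i j).contDiffOn)
    (fun x _ => (hh.det_neg x).ne) α β)

lemma invMetric_isSymm (x : Fin (m + 2) → ℝ) : (invMetric h x).IsSymm := (hh.symm x).inv

lemma velocity_invMetric (x v : Fin (m + 2) → ℝ) : velocity (invMetric h) x (h x *ᵥ v) = v := by
  rw [velocity, invMetric, Matrix.mulVec_mulVec,
    Matrix.nonsing_inv_mul _ (isUnit_iff_ne_zero.2 (hh.det_neg x).ne), Matrix.one_mulVec]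

lemma mulVec_velocity (x p : Fin (m + 2) → ℝ) : h x *ᵥ velocity (invMetric h) x p = p := by
  rw [velocity, invMetric, Matrix.mulVec_mulVec,
    Matrix.mul_nonsing_inv _ (isUnit_iff_ne_zero.2 (hh.det_neg x).ne), Matrix.one_mulVec]

lemma ip_velocity (x p v : Fin (m + 2) → ℝ) :
    ip h x (velocity (invMetric h) x p) v = p ⬝ᵥ v := by
  rw [ip_comm (hh.symm x), ip, hh.mulVec_velocity, dotProduct_comm]

end IsAdmissibleMetric

variable {M : Type*} [TopologicalSpace M] [ChartedSpace (EuclideanSpace ℝ (Fin m)) M]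
  {Ψ ν : ℝ × M → (Fin (m + 2) → ℝ)} {E P : (ℝ × M) × ℝ → (Fin (m + 2) → ℝ)}
  {S : Set ((ℝ × M) × ℝ)} {T : ℝ} {Φ : (ℝ × M) × ℝ → (Fin (m + 2) → ℝ)}

/-- `t ↦ (E (z, t), P (z, t))` is the geodesic, with its momentum, which starts at `Ψ z` with the
velocity `ν z`. -/
structure IsNormalFlow (h : (Fin (m + 2) → ℝ) → Matrix (Fin (m + 2)) (Fin (m + 2)) ℝ)
    (Ψ ν : ℝ × M → (Fin (m + 2) → ℝ)) (T : ℝ) (E P : (ℝ × M) × ℝ → (Fin (m + 2) → ℝ))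
    (S : Set ((ℝ × M) × ℝ)) : Prop where
  isOpen : IsOpen S
  mem_cylinder : ∀ q ∈ S, q.1 ∈ cylinder M T
  zero_mem : ∀ z ∈ cylinder M T, (z, (0 : ℝ)) ∈ S
  star : ∀ q ∈ S, ∀ s : ℝ, |s| ≤ |q.2| → (q.1, s) ∈ S
  smooth : ContMDiffOn (tubeModel m) 𝓘(ℝ, Fin (m + 2) → ℝ) ∞ E S
  smooth_momentum : ContMDiffOn (tubeModel m) 𝓘(ℝ, Fin (m + 2) → ℝ) ∞ P S
  zero : ∀ z ∈ cylinder M T, E (z, 0) = Ψ z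
  momentum_zero : ∀ z ∈ cylinder M T, P (z, 0) = h (Ψ z) *ᵥ ν z
  ode : ∀ q ∈ S, HasDerivAt (fun t => (E (q.1, t), P (q.1, t)))
    (hamiltonianField (invMetric h) (E q, P q)) q.2

theorem exists_normalFlow (hh : IsAdmissibleMetric h)
    (hΨ : ContMDiffOn (tanModel m) 𝓘(ℝ, Fin (m + 2) → ℝ) ∞ Ψ (cylinder M T))
    (hν : ContMDiffOn (tanModel m) 𝓘(ℝ, Fin (m + 2) → ℝ) ∞ ν (cylinder M T)) :
    ∃ E P S, IsNormalFlow h Ψ ν T E P S := by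
  obtain ⟨Fl, D, hD, h0D, hFl, hFl0, hode, hstar⟩ :=
    exists_flow (contDiff_hamiltonianField hh.contDiff_invMetric)
  -- `velocity h` serves here only as multiplication by the matrix `h`: it lowers the index of ν to
  -- give the initial momentum.
  set c : (ℝ × M) × ℝ → ℝ × ((Fin (m + 2) → ℝ) × (Fin (m + 2) → ℝ)) := fun q =>
    (q.2, (Ψ q.1, velocity h (Ψ q.1) (ν q.1))) with hc
  have hcs : ContMDiffOn (tubeModel m) 𝓘(ℝ, ℝ × ((Fin (m + 2) → ℝ) × (Fin (m + 2) → ℝ))) ∞ c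
      (cylinder M T ×ˢ univ) := by
    have h1 := hΨ.comp (contMDiffOn_fst (s := cylinder M T ×ˢ (univ : Set ℝ)) (J := 𝓘(ℝ, ℝ)))
      fun q hq => hq.1
    have h2 := hν.comp (contMDiffOn_fst (s := cylinder M T ×ˢ (univ : Set ℝ)) (J := 𝓘(ℝ, ℝ)))
      fun q hq => hq.1
    have h3 := (contDiff_velocity hh.smooth).contMDiff.comp_contMDiffOn (h1.prodMk_space h2)
    exact contMDiffOn_snd.prodMk_space (h1.prodMk_space h3)
  set S := (cylinder M T ×ˢ univ) ∩ c ⁻¹' D with hS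
  have hFlc : ContMDiffOn (tubeModel m) 𝓘(ℝ, (Fin (m + 2) → ℝ) × (Fin (m + 2) → ℝ)) ∞ (Fl ∘ c) S :=
    hFl.contMDiffOn.comp (hcs.mono inter_subset_left) fun q hq => hq.2
  refine ⟨fun q => (Fl (c q)).1, fun q => (Fl (c q)).2, S, ?_, fun q hq => hq.1.1,
    fun z hz => ⟨⟨hz, trivial⟩, h0D _⟩, fun q hq s hs => ⟨⟨hq.1.1, trivial⟩, hstar _ _ hq.2 s hs⟩,
    ?_, ?_, fun z _ => ?_, fun z _ => ?_, fun q hq => ?_⟩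
  · exact hcs.continuousOn.isOpen_inter_preimage ((isOpen_cylinder M T).prod isOpen_univ) hD
  · exact contDiff_fst.contMDiff.comp_contMDiffOn hFlc
  · exact contDiff_snd.contMDiff.comp_contMDiffOn hFlc
  · simp [hc, hFl0]
  · simp [hc, hFl0, velocity]
  · exact hode _ _ hq.2

/-- The inverse of a diffeomorphism has an injective differential. -/
lemma IsDiffeoOntoImage.linearIndependent_pd [IsManifold (𝓡 m) ∞ M]
    {e : OpenPartialHomeomorph M (EuclideanSpace ℝ (Fin m))}
    (he : e ∈ IsManifold.maximalAtlas (𝓡 m) ∞ M) {W : Set ((ℝ × M) × ℝ)} (hW : IsOpen W)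
    (hΦ : IsDiffeoOntoImage Φ W) {q : (ℝ × M) × ℝ} (hq : q ∈ W) (hqe : q.1.2 ∈ e.source) :
    LinearIndependent ℝ fun a => pd (Φ ∘ tubePoint e) a (tubeCoord e q) := by
  obtain ⟨Ξ, hl, hΞ⟩ := hΦ.2.2.2 ⟨_, hq⟩
  set y := tubeCoord e q with hy
  have hty : tubePoint e y = q := tubePoint_tubeCoord hqe
  have hyt : WithLp.toLp 2 (Fin.tail (Fin.init y)) ∈ e.target := by
    simpa [hy] using e.map_source hqe
  have hU := isOpen_tubePoint_preimage (e := e) (S := W ∩ {q | q.1.2 ∈ e.source})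
    (hW.inter (e.open_source.preimage (continuous_snd.comp continuous_fst)))
  have hyU := hU.mem_nhds (show y ∈ _ from ⟨hyt, by rw [hty]; exact ⟨hq, hqe⟩⟩)
  have hd : DifferentiableAt ℝ (Φ ∘ tubePoint e) y := by
    refine ContDiffAt.differentiableAt (n := ∞) (((contDiffOn_comp_tubePoint he hΦ.2.2.1) y
      ⟨hyt, by rwa [hty]⟩).contDiffAt ?_) (by simp)
    exact mem_of_superset hyU fun z hz => ⟨hz.1, hz.2.1⟩
  have hx : Φ '' W ∈ 𝓝 (Φ q) := hΦ.1.mem_nhds (mem_image_of_mem _ hq)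
  have hΞq : Ξ (Φ q) = q := hl hq
  have hdc : DifferentiableAt ℝ (tubeCoord e ∘ Ξ) ((Φ ∘ tubePoint e) y) := by
    rw [Function.comp_apply, hty]
    have h1 : ContMDiffAt 𝓘(ℝ, Fin (m + 2) → ℝ) (tubeModel m) ∞ Ξ (Φ q) :=
      (hΞ _ (mem_image_of_mem _ hq)).contMDiffAt hx
    have hn : {p : ℝ × M | p.2 ∈ e.source} ∈ 𝓝 (Ξ (Φ q)).1 := by
      rw [hΞq]
      exact (e.open_source.preimage continuous_snd).mem_nhds hqe
    have h2 := ((contMDiffOn_tanCoord he).contMDiffAt hn).comp (Φ q) h1.fst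
    refine ContDiffAt.differentiableAt (n := ∞) (contMDiffAt_iff_contDiffAt.1 ?_) (by simp)
    refine contMDiffAt_pi_space.2 fun i => ?_
    induction i using Fin.lastCases with
    | last =>
      have h3 := h1.snd
      simpa [Function.comp_def] using h3
    | cast i =>
      have h3 := contMDiffAt_pi_space.1 h2 i
      simpa [Function.comp_def, tubeCoord] using h3
  have hcomp : (tubeCoord e ∘ Ξ) ∘ (Φ ∘ tubePoint e) =ᶠ[𝓝 y] id := by
    filter_upwards [hyU] with z hz
    simp only [Function.comp_apply, id]
    rw [hl hz.2.1, tubeCoord_tubePoint hz.1]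
  have hfd := fderiv_comp y hdc hd
  rw [hcomp.fderiv_eq, fderiv_id] at hfd
  refine Fintype.linearIndependent_iff.2 fun g hg i => ?_
  rw [← fderiv_eq_sum_pd] at hg
  have h1 := DFunLike.congr_fun hfd g
  rw [ContinuousLinearMap.comp_apply, hg, map_zero] at h1
  exact congrFun h1 i

namespace IsNormalFlow

variable (H : IsNormalFlow h Ψ ν T E P S)
include H

lemma hasDerivAt {q : (ℝ × M) × ℝ} (hq : q ∈ S) :
    HasDerivAt (fun t => E (q.1, t)) (velocity (invMetric h) (E q) (P q)) q.2 :=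
  (hasFDerivAt_fst (𝕜 := ℝ) (p := (E q, P q))).comp_hasDerivAt_of_eq q.2 (H.ode q hq) rfl

lemma hasDerivAt_momentum {q : (ℝ × M) × ℝ} (hq : q ∈ S) :
    HasDerivAt (fun t => P (q.1, t)) (force (invMetric h) (E q) (P q)) q.2 :=
  (hasFDerivAt_snd (𝕜 := ℝ) (p := (E q, P q))).comp_hasDerivAt_of_eq q.2 (H.ode q hq) rfl

lemma hasDerivAt_zero (hh : IsAdmissibleMetric h) {z : ℝ × M} (hz : z ∈ cylinder M T) :
    HasDerivAt (fun t => E (z, t)) (ν z) 0 := by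
  have h1 := H.hasDerivAt (H.zero_mem z hz)
  rwa [H.zero z hz, H.momentum_zero z hz, hh.velocity_invMetric] at h1

variable [IsManifold (𝓡 m) ∞ M]

/-- The geodesics are orthogonal to the parallel hypersurfaces. -/
lemma dotProduct_pd (hh : IsAdmissibleMetric h) (hν : ∀ p ∈ cylinder M T, IsUnitNormal h Ψ p (ν p))
    {e : OpenPartialHomeomorph M (EuclideanSpace ℝ (Fin m))}
    (he : e ∈ IsManifold.maximalAtlas (𝓡 m) ∞ M) {q : (ℝ × M) × ℝ} (hq : q ∈ S)
    (hqe : q.1.2 ∈ e.source) :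
    ip (invMetric h) (E q) (P q) (P q) = 1 ∧
      (∀ a : Fin (m + 1), P q ⬝ᵥ pd (E ∘ tubePoint e) a.castSucc (tubeCoord e q) = 0) ∧
      P q ⬝ᵥ pd (E ∘ tubePoint e) (Fin.last (m + 1)) (tubeCoord e q) = 1 := by
  have h0S : ∀ q ∈ S, (q.1, (0 : ℝ)) ∈ S := fun q hq => H.zero_mem _ (H.mem_cylinder q hq)
  have hchart := isTubeChart_comp (Ψ := Ψ) he H.isOpen H.smooth
    fun z hz => H.zero z (H.mem_cylinder _ hz)
  have hchartP := isTubeChart_comp (Ψ := fun z => P (z, 0)) he H.isOpen H.smooth_momentum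
    fun z hz => rfl
  have hdiff : ∀ {f : (Fin (m + 2) → ℝ) → (Fin (m + 2) → ℝ)} {y : Fin (m + 2) → ℝ},
      ContDiffOn ℝ ∞ f (chartDomain e S) → y ∈ chartDomain e S → DifferentiableAt ℝ f y :=
    fun hf hy => ((hf _ hy).contDiffAt (hchart.isOpen.mem_nhds hy)).differentiableAt (by simp)
  have hf' : ∀ y ∈ chartDomain e S, pd (E ∘ tubePoint e) (Fin.last (m + 1)) y =
      velocity (invMetric h) ((E ∘ tubePoint e) y) ((P ∘ tubePoint e) y) := fun y hy =>
    (hasDerivAt_normal (hdiff hchart.smooth hy)).unique (H.hasDerivAt hy.2.1)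
  have hP' : ∀ y ∈ chartDomain e S, pd (P ∘ tubePoint e) (Fin.last (m + 1)) y =
      force (invMetric h) ((E ∘ tubePoint e) y) ((P ∘ tubePoint e) y) := fun y hy =>
    (hasDerivAt_normal (hdiff hchartP.smooth hy)).unique (H.hasDerivAt_momentum hy.2.1)
  have hyzero : ∀ y ∈ chartDomain e S, y (Fin.last (m + 1)) = 0 →
      tubePoint e y = (tanPoint e (Fin.init y), 0) ∧ tanPoint e (Fin.init y) ∈ cylinder M T :=
    fun y hy hy0 => ⟨by simp [tubePoint, hy0], H.mem_cylinder _ hy.2.1⟩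
  have key := gauss_lemma hh.contDiff_invMetric hh.invMetric_isSymm hchart.isOpen ?_ hchart.smooth
    hchartP.smooth hf' hP' ?_ ?_ (tubeCoord e q)
    (tubeCoord_mem_chartDomain hq (h0S q hq) hqe)
  · have h1 := hf' _ (tubeCoord_mem_chartDomain hq (h0S q hq) hqe)
    simp only [Function.comp_apply, tubePoint_tubeCoord hqe] at key h1
    refine ⟨key.1, key.2, ?_⟩
    rw [h1, dotProduct_velocity, key.1]
  · intro y hy θ hθ
    have hinit : Fin.init (Function.update y (Fin.last (m + 1)) (θ * y (Fin.last (m + 1)))) =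
        Fin.init y := by simp
    have htp : tubePoint e (Function.update y (Fin.last (m + 1)) (θ * y (Fin.last (m + 1)))) =
        (tanPoint e (Fin.init y), θ * y (Fin.last (m + 1))) := by simp [tubePoint]
    refine ⟨by rw [hinit]; exact hy.1, ?_⟩
    rw [htp]
    refine ⟨H.star _ hy.2.1 _ ?_, hy.2.2⟩
    rw [abs_mul, abs_of_nonneg hθ.1]
    exact mul_le_of_le_one_left (abs_nonneg _) hθ.2
  · intro y hy hy0
    obtain ⟨h1, h2⟩ := hyzero y hy hy0
    rw [Function.comp_apply, Function.comp_apply, h1, H.zero _ h2, H.momentum_zero _ h2,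
      ← dotProduct_velocity, hh.velocity_invMetric, dotProduct_comm]
    exact (hν _ h2).unit
  · intro y hy hy0 a
    obtain ⟨h1, h2⟩ := hyzero y hy hy0
    have h3 : (tanPoint e (Fin.init y)).2 ∈ e.source := tanPoint_snd_mem hy.1
    have h4 := hchart.pd_eq (hchart.zero_mem y hy) a
    rw [zeroSection_init hy0] at h4
    have h5 := (hν _ h2).orth e he h3 a
    rw [tanCoord_tanPoint hy.1, ip_comm (hh.symm _)] at h5
    rw [Function.comp_apply, h1, H.momentum_zero _ h2, ← h4, dotProduct_comm]
    exact h5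

/-- The momentum is the differential of the distance from the hypersurface. -/
lemma differential_eq (hh : IsAdmissibleMetric h)
    (hν : ∀ p ∈ cylinder M T, IsUnitNormal h Ψ p (ν p)) {W : Set ((ℝ × M) × ℝ)} (hW : IsOpen W)
    (hWS : W ⊆ S) (hE : IsDiffeoOntoImage E W) {d : (Fin (m + 2) → ℝ) → ℝ}
    (hd : ContDiffOn ℝ ∞ d (E '' W)) (hdE : ∀ q ∈ W, d (E q) = q.2) {q : (ℝ × M) × ℝ}
    (hq : q ∈ W) : differential d (E q) = P q := by
  set e := chartAt (EuclideanSpace ℝ (Fin m)) q.1.2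
  have he : e ∈ IsManifold.maximalAtlas (𝓡 m) ∞ M := IsManifold.chart_mem_maximalAtlas q.1.2
  have hqe : q.1.2 ∈ e.source := mem_chart_source _ _
  set y := tubeCoord e q with hy
  have hty : tubePoint e y = q := tubePoint_tubeCoord hqe
  have hyt : WithLp.toLp 2 (Fin.tail (Fin.init y)) ∈ e.target := by
    simpa [hy] using e.map_source hqe
  have hU := isOpen_tubePoint_preimage (e := e) hW
  have hyU : y ∈ _ := show y ∈ {y : Fin (m + 2) → ℝ | WithLp.toLp 2 (Fin.tail (Fin.init y)) ∈
    e.target ∧ tubePoint e y ∈ W} from ⟨hyt, by rwa [hty]⟩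
  have hfd : DifferentiableAt ℝ (E ∘ tubePoint e) y :=
    ((contDiffOn_comp_tubePoint he hE.2.2.1 y hyU).contDiffAt (hU.mem_nhds hyU)).differentiableAt
      (by simp)
  have hdd : DifferentiableAt ℝ d ((E ∘ tubePoint e) y) := by
    rw [Function.comp_apply, hty]
    exact ((hd _ (mem_image_of_mem _ hq)).contDiffAt
      (hE.1.mem_nhds (mem_image_of_mem _ hq))).differentiableAt (by simp)
  have hcomp : d ∘ (E ∘ tubePoint e) =ᶠ[𝓝 y] fun z => z (Fin.last (m + 1)) := by
    filter_upwards [hU.mem_nhds hyU] with z hz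
    exact hdE _ hz.2
  have hpd : ∀ α, differential d (E q) ⬝ᵥ pd (E ∘ tubePoint e) α y =
      if Fin.last (m + 1) = α then 1 else 0 := fun α => by
    have h1 := DFunLike.congr_fun (fderiv_comp y hdd hfd) (Pi.single α 1)
    rw [hcomp.fderiv_eq, ContinuousLinearMap.comp_apply, fderiv_eq_differential d,
      Function.comp_apply, hty] at h1
    exact h1.symm.trans (pd_coord _ _ _)
  -- The differential and the momentum both vanish on the tangential coordinate vectors and equal 1
  -- on the last one, and these vectors span.
  obtain ⟨-, h2, h3⟩ := H.dotProduct_pd hh hν he (hWS hq) hqe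
  have hli := hE.linearIndependent_pd he hW hq hqe
  have hspan := hli.span_eq_top_of_card_eq_finrank' (by simp)
  have heq : ∀ v, (differential d (E q) - P q) ⬝ᵥ v = 0 := fun v => by
    have hv : v ∈ Submodule.span ℝ (range fun a => pd (E ∘ tubePoint e) a y) := by
      rw [hspan]; trivial
    induction hv using Submodule.span_induction with
    | mem v hv =>
      obtain ⟨α, rfl⟩ := hv
      rw [sub_dotProduct, hpd]
      induction α using Fin.lastCases with
      | last => rw [if_pos rfl, h3, sub_self]
      | cast a => rw [if_neg (Fin.castSucc_lt_last a).ne', h2, sub_self]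
    | zero => simp
    | add v w _ _ h1 h2 => rw [dotProduct_add, h1, h2, add_zero]
    | smul r v _ h1 => rw [dotProduct_smul, h1, smul_zero]
  exact sub_eq_zero.1 (dotProduct_eq_zero _ heq)

/-- The derivative of `E` along curves which are transversal to the hypersurface. -/
lemma exists_hasDerivAt_curve (hh : IsAdmissibleMetric h)
    (htime : ∀ p ∈ cylinder M T, Ψ p 0 = p.1) {p : ℝ × M} (hp : p ∈ cylinder M T)
    (hν : IsUnitNormal h Ψ p (ν p)) :
    ∃ w : Fin (m + 2) → ℝ, ip h (Ψ p) (ν p) w = 0 ∧ w 0 = 1 ∧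
      ∀ (α : ℝ → ℝ) (α' : ℝ), α 0 = p.1 → HasDerivAt α α' 0 →
        HasDerivAt (fun t => E ((α t, p.2), t)) (α' • w + ν p) 0 := by
  set e := chartAt (EuclideanSpace ℝ (Fin m)) p.2
  have he : e ∈ IsManifold.maximalAtlas (𝓡 m) ∞ M := IsManifold.chart_mem_maximalAtlas p.2
  have hpe : p.2 ∈ e.source := mem_chart_source _ _
  have hchart := isTubeChart_comp (Ψ := Ψ) he H.isOpen H.smooth
    fun z hz => H.zero z (H.mem_cylinder _ hz)
  have hpS := H.zero_mem p hp
  have hy : tubeCoord e (p, 0) ∈ chartDomain e S := tubeCoord_mem_chartDomain hpS hpS hpe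
  have hd : DifferentiableAt ℝ (E ∘ tubePoint e) (tubeCoord e (p, 0)) :=
    ((hchart.smooth _ hy).contDiffAt (hchart.isOpen.mem_nhds hy)).differentiableAt (by simp)
  have hz := tubeCoord_eq_zeroSection (e := e) p
  have hw : pd (Ψ ∘ tanPoint e) 0 (tanCoord e p) =
      pd (E ∘ tubePoint e) 0 (tubeCoord e (p, 0)) := by
    have := hchart.pd_eq (by rwa [hz] at hy) 0
    rwa [← hz] at this
  have hlast : pd (E ∘ tubePoint e) (Fin.last (m + 1)) (tubeCoord e (p, 0)) = ν p := by
    have h1 := hasDerivAt_normal hd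
    rw [init_tubeCoord, tanPoint_tanCoord hpe, tubeCoord_last] at h1
    exact h1.unique (H.hasDerivAt_zero hh hp)
  -- The vector w is ∂_0 Ψ: it is tangent to the hypersurface, and its time component is 1 because Ψ
  -- preserves the time coordinate.
  refine ⟨pd (Ψ ∘ tanPoint e) 0 (tanCoord e p), hν.orth e he hpe 0, ?_, fun α α' hα hα' => ?_⟩
  · have hdΨ : DifferentiableAt ℝ (Ψ ∘ tanPoint e) (tanCoord e p) :=
      hchart.differentiableAt (by rwa [hz] at hy)
    rw [← pd_apply hdΨ, pd_congr (g := fun y => y 0)]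
    · rw [pd_coord, if_pos rfl]
    · filter_upwards [(isOpen_tanDomain T).mem_nhds (tanCoord_mem_tanDomain hp hpe)] with y hy
      exact htime _ (tanPoint_mem_cylinder hy)
  · set c : ℝ → (Fin (m + 2) → ℝ) := fun t => tubeCoord e ((α t, p.2), t) with hc
    have hc0 : c 0 = tubeCoord e (p, 0) := by simp [hc, hα]
    have hc' : HasDerivAt c (α' • Pi.single 0 1 + Pi.single (Fin.last (m + 1)) 1) 0 := by
      refine hasDerivAt_pi.2 fun i => ?_
      induction i using Fin.lastCases with
      | last => simpa [hc] using! hasDerivAt_id' (0 : ℝ)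
      | cast i =>
        induction i using Fin.cases with
        | zero => simpa [hc] using hα'
        | succ j =>
          have h1 : (α' • Pi.single 0 1 + Pi.single (Fin.last (m + 1)) 1 : Fin (m + 2) → ℝ)
              j.succ.castSucc = 0 := by
            simp
          have h2 : ∀ t, c t j.succ.castSucc = e p.2 j := fun t => by
            change Fin.init (tubeCoord e ((α t, p.2), t)) j.succ = _
            rw [init_tubeCoord]; rfl
          simp only [h1, h2]
          exact hasDerivAt_const _ _
    have h1 := hd.hasFDerivAt.comp_hasDerivAt_of_eq (0 : ℝ) hc' hc0.symm
    rw [map_add, map_smul] at h1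
    change HasDerivAt _ (α' • pd (E ∘ tubePoint e) 0 (tubeCoord e (p, 0)) +
      pd (E ∘ tubePoint e) (Fin.last (m + 1)) (tubeCoord e (p, 0))) 0 at h1
    rw [← hw, hlast] at h1
    refine h1.congr_of_eventuallyEq (Eventually.of_forall fun t => ?_)
    simp only [hc, Function.comp_apply]
    rw [tubePoint_tubeCoord (q := ((α t, p.2), t)) hpe]

end IsNormalFlow
end NormalFlow

/-! ### Normal coordinates and the eikonal equation -/

section NormalCoordinates

variable {m : ℕ} {h : (Fin (m + 2) → ℝ) → Matrix (Fin (m + 2)) (Fin (m + 2)) ℝ}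
  {M : Type*} [TopologicalSpace M] [ChartedSpace (EuclideanSpace ℝ (Fin m)) M]
  {Ψ ν : ℝ × M → (Fin (m + 2) → ℝ)} {E P : (ℝ × M) × ℝ → (Fin (m + 2) → ℝ)}
  {S : Set ((ℝ × M) × ℝ)} {T : ℝ} {I : Set (Fin (m + 2) → ℝ)}

/-- Applied to the geodesic tube `E`, this last coordinate of the inverse becomes the distance
function of the theorem. -/
lemma exists_height {Φ : (ℝ × M) × ℝ → (Fin (m + 2) → ℝ)} {W : Set ((ℝ × M) × ℝ)}
    (hΦ : IsDiffeoOntoImage Φ W) :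
    ∃ d : (Fin (m + 2) → ℝ) → ℝ, ContDiffOn ℝ ∞ d (Φ '' W) ∧ ∀ q ∈ W, d (Φ q) = q.2 := by
  rcases W.eq_empty_or_nonempty with rfl | hne
  · exact ⟨0, contDiffOn_const, by simp⟩
  obtain ⟨Ξ, hl, hΞ⟩ := hΦ.2.2.2 hne
  have h1 : ContMDiffOn 𝓘(ℝ, Fin (m + 2) → ℝ) 𝓘(ℝ, ℝ) ∞ (fun x => (Ξ x).2) (Φ '' W) :=
    fun x hx => (hΞ x hx).snd
  exact ⟨fun x => (Ξ x).2, h1.contDiffOn, fun q hq => congrArg Prod.snd (hl hq)⟩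

lemma sum_inv_mul_pd_mul_pd (d : (Fin (m + 2) → ℝ) → ℝ) (x : Fin (m + 2) → ℝ) :
    ∑ α, ∑ β, (h x)⁻¹ α β * pd d α x * pd d β x =
      ip (invMetric h) x (differential d x) (differential d x) := by
  rw [ip_eq_sum]; rfl

/-- The deviation of `g_nn` from `1` is quadratic in the deviation of `∂_n f` from the gradient of a
solution `y^n` of the eikonal equation. -/
lemma pd_pullback_last_last_eq_zero (hh : IsAdmissibleMetric h)
    {f Q : (Fin (m + 2) → ℝ) → (Fin (m + 2) → ℝ)} {O : Set (Fin (m + 2) → ℝ)} (hO : IsOpen O)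
    (hf : ContDiffOn ℝ ∞ f O) (hQ : ContDiffOn ℝ ∞ Q O)
    (hQ1 : ∀ y ∈ O, ip (invMetric h) (f y) (Q y) (Q y) = 1)
    (hQf : ∀ y ∈ O, Q y ⬝ᵥ pd f (Fin.last (m + 1)) y = 1) {y : Fin (m + 2) → ℝ} (hy : y ∈ O)
    (hy0 : pd f (Fin.last (m + 1)) y = velocity (invMetric h) (f y) (Q y)) :
    pd (fun z => pullback h f z (Fin.last (m + 1)) (Fin.last (m + 1))) (Fin.last (m + 1)) y = 0 := by
  have hdiff : ∀ {g : (Fin (m + 2) → ℝ) → (Fin (m + 2) → ℝ)},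
      ContDiffOn ℝ ∞ g O → DifferentiableAt ℝ g y :=
    fun hg => ((hg _ hy).contDiffAt (hO.mem_nhds hy)).differentiableAt (by simp)
  set v : (Fin (m + 2) → ℝ) → (Fin (m + 2) → ℝ) := fun y => velocity (invMetric h) (f y) (Q y)
    with hv
  -- With v the gradient, h(v, ·) = Q and Q · ∂_n f = Q · v = 1, so h(w, w) = g_nn - 2 + 1. As w
  -- vanishes at y, so does the first derivative of h(w, w).
  set w : (Fin (m + 2) → ℝ) → (Fin (m + 2) → ℝ) := fun y =>
    pd f (Fin.last (m + 1)) y + -v y with hw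
  have hws : ContDiffOn ℝ ∞ w O :=
    (contDiffOn_pd hO hf _).add
      ((contDiff_velocity hh.contDiff_invMetric).comp_contDiffOn (hf.prodMk hQ)).neg
  have hw0 : w y = 0 := by simp only [hw, hv, hy0, add_neg_cancel]
  have heq : (fun z => pullback h f z (Fin.last (m + 1)) (Fin.last (m + 1)))
      =ᶠ[𝓝 y] fun z => 1 + ip h (f z) (w z) (w z) := by
    filter_upwards [hO.mem_nhds hy] with z hz
    have h1 := hQf z hz
    have h2 := hQ1 z hz
    rw [← dotProduct_velocity] at h2
    have h3 : ∀ u, ip h (f z) (v z) u = Q z ⬝ᵥ u := fun u => hh.ip_velocity _ _ _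
    rw [pullback_apply]
    simp only [hw, ip_add_left, ip_add_right, ip_neg_left, ip_neg_right]
    rw [ip_comm (hh.symm _) (pd f _ z) (v z), h3, h3, h1, show Q z ⬝ᵥ v z = 1 from h2]
    ring
  have hpdip := pd_ip (h := h) hh.smooth (hdiff hf) (hdiff hws) (hdiff hws) (Fin.last (m + 1))
  rw [hw0] at hpdip
  rw [pd_congr heq]
  have h3 : pd (fun z => 1 + ip h (f z) (w z) (w z)) (Fin.last (m + 1)) y =
      pd (fun z => ip h (f z) (w z) (w z)) (Fin.last (m + 1)) y := by
    unfold pd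
    rw [fderiv_const_add]
  rw [h3, hpdip]
  simp [dip, ip]

variable [IsManifold (𝓡 m) ∞ M]

/-- Coordinates which extend `Ψ` with the normal derivative `ν`, and whose last coordinate is a
solution of the eikonal equation with momentum `Q`. -/
lemma isNormalTubeChart_comp (hh : IsAdmissibleMetric h) {κ : (Fin (m + 2) → ℝ) → ℝ}
    (hcurv : HasPrescribedMeanCurvature h κ T I Ψ)
    {φ Q : (ℝ × M) × ℝ → (Fin (m + 2) → ℝ)} (hS : IsOpen S) (hST : ∀ q ∈ S, q.1 ∈ cylinder M T)
    (hφ : IsDiffeoOntoImage φ S) (h0 : ∀ z, (z, (0 : ℝ)) ∈ S → φ (z, 0) = Ψ z)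
    (hν : ∀ z ∈ cylinder M T, IsInwardUnitNormal h I Ψ z (ν z))
    (hφν : ∀ z, (z, (0 : ℝ)) ∈ S → HasDerivAt (fun t => φ (z, t)) (ν z) 0)
    (hQ : ContMDiffOn (tubeModel m) 𝓘(ℝ, Fin (m + 2) → ℝ) ∞ Q S)
    (hQ0 : ∀ z, (z, (0 : ℝ)) ∈ S → Q (z, 0) = h (Ψ z) *ᵥ ν z)
    (hQ1 : ∀ q ∈ S, ip (invMetric h) (φ q) (Q q) (Q q) = 1)
    {d : (Fin (m + 2) → ℝ) → ℝ} (hd : ContDiffOn ℝ ∞ d (φ '' S)) (hdφ : ∀ q ∈ S, d (φ q) = q.2)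
    (hdQ : ∀ q ∈ S, differential d (φ q) = Q q)
    {e : OpenPartialHomeomorph M (EuclideanSpace ℝ (Fin m))}
    (he : e ∈ IsManifold.maximalAtlas (𝓡 m) ∞ M) :
    IsNormalTubeChart h κ (Ψ ∘ tanPoint e) (φ ∘ tubePoint e) (chartDomain e S) := by
  have hchart := isTubeChart_comp (Ψ := Ψ) he hS hφ.2.2.1 h0
  have hchartQ := isTubeChart_comp (Ψ := fun z => Q (z, 0)) he hS hQ fun z _ => rfl
  have hO := hchart.isOpen
  have hdiff : ∀ {f : (Fin (m + 2) → ℝ) → (Fin (m + 2) → ℝ)} {y : Fin (m + 2) → ℝ},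
      ContDiffOn ℝ ∞ f (chartDomain e S) → y ∈ chartDomain e S → DifferentiableAt ℝ f y :=
    fun hf hy => ((hf _ hy).contDiffAt (hO.mem_nhds hy)).differentiableAt (by simp)
  have hyzero : ∀ y ∈ chartDomain e S, y (Fin.last (m + 1)) = 0 →
      tubePoint e y = (tanPoint e (Fin.init y), 0) := fun y hy hy0 => by simp [tubePoint, hy0]
  have hlast : ∀ y ∈ chartDomain e S, y (Fin.last (m + 1)) = 0 →
      pd (φ ∘ tubePoint e) (Fin.last (m + 1)) y = ν (tanPoint e (Fin.init y)) := fun y hy hy0 => by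
    have h1 := hasDerivAt_normal (hdiff hchart.smooth hy)
    rw [hy0] at h1
    exact h1.unique (hφν _ hy.2.2)
  have hf0 : ∀ y ∈ chartDomain e S, y (Fin.last (m + 1)) = 0 →
      (φ ∘ tubePoint e) y = Ψ (tanPoint e (Fin.init y)) := fun y hy hy0 => by
    rw [Function.comp_apply, hyzero y hy hy0]; exact h0 _ hy.2.2
  have hnormal : ∀ y ∈ chartDomain e S,
      IsInwardUnitNormal h I Ψ (tanPoint e (Fin.init y)) (ν (tanPoint e (Fin.init y))) :=
    fun y hy => hν _ (hST _ hy.2.1)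
  have horth : ∀ y ∈ chartDomain e S, ∀ a, ip h (Ψ (tanPoint e (Fin.init y)))
      (ν (tanPoint e (Fin.init y))) (pd (Ψ ∘ tanPoint e) a (Fin.init y)) = 0 := fun y hy a => by
    have h1 := (hnormal y hy).1.orth e he (tanPoint_snd_mem hy.1) a
    rwa [tanCoord_tanPoint hy.1] at h1
  -- Q · ∂_n φ is the normal derivative of d ∘ φ = y^n.
  have hone : ∀ y ∈ chartDomain e S,
      (Q ∘ tubePoint e) y ⬝ᵥ pd (φ ∘ tubePoint e) (Fin.last (m + 1)) y = 1 := fun y hy => by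
    have hdd : DifferentiableAt ℝ d ((φ ∘ tubePoint e) y) :=
      ((hd _ (mem_image_of_mem _ hy.2.1)).contDiffAt
        (hφ.1.mem_nhds (mem_image_of_mem _ hy.2.1))).differentiableAt (by simp)
    have hcomp : d ∘ (φ ∘ tubePoint e) =ᶠ[𝓝 y] fun z => z (Fin.last (m + 1)) := by
      filter_upwards [hO.mem_nhds hy] with z hz
      exact hdφ _ hz.2.1
    have h1 := DFunLike.congr_fun (fderiv_comp y hdd (hdiff hchart.smooth hy))
      (Pi.single (Fin.last (m + 1)) 1)
    rw [hcomp.fderiv_eq, ContinuousLinearMap.comp_apply, fderiv_eq_differential d,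
      Function.comp_apply, hdQ _ hy.2.1] at h1
    refine h1.symm.trans ((pd_coord _ _ _).trans (if_pos rfl))
  refine { toIsTubeChart := hchart, orth := ?_, unit := ?_, unit_deriv := ?_, det_neg := ?_,
           curvature := ?_ }
  · intro y hy hy0 a
    have h4 := hchart.pd_eq (hchart.zero_mem y hy) a
    rw [zeroSection_init hy0] at h4
    rw [hlast y hy hy0, hf0 y hy hy0, ← h4]
    exact horth y hy a
  · intro y hy hy0
    rw [hlast y hy hy0, hf0 y hy hy0]
    exact (hnormal y hy).1.unit
  · intro y hy hy0
    refine pd_pullback_last_last_eq_zero hh hO hchart.smooth hchartQ.smooth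
      (fun z hz => hQ1 _ hz.2.1) hone hy ?_
    have h1 : (Q ∘ tubePoint e) y = h (Ψ (tanPoint e (Fin.init y))) *ᵥ ν (tanPoint e (Fin.init y)) := by
      rw [Function.comp_apply, hyzero y hy hy0]
      exact hQ0 _ hy.2.2
    rw [hlast y hy hy0, hf0 y hy hy0, h1, hh.velocity_invMetric]
  · intro y hy
    have hqe : (tubePoint e y).1.2 ∈ e.source := tanPoint_snd_mem hy.1
    have hli := hφ.linearIndependent_pd he hS hy.2.1 hqe
    rw [tubeCoord_tubePoint hy.1] at hli
    rw [det_pullback]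
    have hu := Matrix.linearIndependent_rows_iff_isUnit
      (A := Matrix.of fun a α => pd (φ ∘ tubePoint e) a y α).1 hli
    have hne := ((Matrix.isUnit_iff_isUnit_det _).1 hu).ne_zero
    exact mul_neg_of_neg_of_pos (hh.det_neg _) (by positivity)
  · intro w hw
    have hw1 := hw.1
    rw [init_zeroSection] at hw1
    have hw2 := hST _ hw.2.1
    rw [tubePoint_zeroSection] at hw2
    have hn := hnormal _ hw
    have ho := horth _ hw
    rw [init_zeroSection] at hn ho
    rw [hlast _ hw (zeroSection_last w), init_zeroSection]
    exact hcurv e he w ⟨abs_lt.2 hw2.1, hw1⟩ _ ⟨hn.1.unit, ho, hn.2⟩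

/-! ### Time shift onto the initial surface, and uniqueness of the distance. -/

namespace IsNormalFlow

variable (H : IsNormalFlow h Ψ ν T E P S)
include H

lemma exists_tube [CompactSpace M] (hh : IsAdmissibleMetric h)
    (hΨ : IsAdaptedParametrization h T (lateralBoundary I T) Ψ)
    (hν : ∀ p ∈ cylinder M T, IsUnitNormal h Ψ p (ν p)) {T₁ : ℝ} (hT₁ : T₁ < T) :
    ∃ r > 0, IsDiffeoOntoImage E (tube M T₁ r) ∧ closedTube M T₁ r ⊆ S := by
  have hcyl : ∀ p : ℝ × M, p.1 ∈ Icc (-T₁) T₁ → p ∈ cylinder M T := fun p hp =>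
    ⟨⟨by linarith [hp.1], by linarith [hp.2]⟩, trivial⟩
  obtain ⟨r, hr, hE⟩ := exists_tube_isDiffeoOntoImage (Φ := E) (T := T₁)
    (fun p hp => exists_isDiffeoOntoImage_of_transversal (h := h) H.isOpen H.smooth
      (fun z hz => H.zero z (H.mem_cylinder _ hz)) (H.zero_mem p (hcyl p hp))
      (hΨ.linearIndependent_pd (hcyl p hp)) (hν p (hcyl p hp)) (H.hasDerivAt_zero hh (hcyl p hp))
      (by rw [(hν p (hcyl p hp)).unit]; exact one_ne_zero))
    (fun p p' hp hp' hpp => hΨ.injOn (hcyl p hp) (hcyl p' hp')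
      (by rwa [H.zero _ (hcyl p hp), H.zero _ (hcyl p' hp')] at hpp))
  obtain ⟨r', hr', hsub⟩ := exists_closedTube_subset H.isOpen (T := T₁)
    fun p hp => H.zero_mem p (hcyl p hp)
  exact ⟨min r r', lt_min hr hr', hE.mono (isOpen_tube M _ _) (tube_mono (min_le_left _ _)),
    (closedTube_mono (min_le_right _ _)).trans hsub⟩

/-- The points of the geodesics on the initial surface. -/
lemma exists_time_shift [CompactSpace M] (hh : IsAdmissibleMetric h)
    (hΨ : IsAdaptedParametrization h T (lateralBoundary I T) Ψ)
    (hν : ∀ p ∈ cylinder M T, IsUnitNormal h Ψ p (ν p)) (hT : 0 < T)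
    (hν0 : ∀ y : M, ν (0, y) 0 = 0) :
    ∃ k : M × ℝ → ℝ, ∃ r > 0,
      ContMDiffOn (tubeModel m) 𝓘(ℝ, ℝ) ∞ (fun q : (ℝ × M) × ℝ => k (q.1.2, q.2))
        (univ ×ˢ Ioo (-r) r) ∧
      (∀ y s, |s| < r → E ((k (y, s), y), s) 0 = 0) ∧
      (∀ y, k (y, 0) = 0) ∧ ∀ y, HasDerivAt (fun t => k (y, t)) 0 0 := by
  have hcyl : ∀ {T' : ℝ}, T' < T → ∀ p : ℝ × M, p.1 ∈ Icc (-T') T' → p ∈ cylinder M T :=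
    fun hT' p hp => ⟨⟨by linarith [hp.1], by linarith [hp.2]⟩, trivial⟩
  have h0 : ∀ z, (z, (0 : ℝ)) ∈ S → E (z, 0) = Ψ z := fun z hz => H.zero z (H.mem_cylinder _ hz)
  obtain ⟨r₁, hr₁, hE, hE'⟩ := H.exists_tube hh hΨ hν (T₁ := T / 2) (by linarith)
  -- Θ replaces the parameter y^0 by the time E^0, so k is the time coordinate of Θ⁻¹((0, y), s). To
  -- invert with values in Euclidean space, E ∘ Θ is inverted at E((0, y), s); injectivity of E on
  -- its tube then removes the outer E.
  set Θ : (ℝ × M) × ℝ → (ℝ × M) × ℝ := fun q => ((E q 0, q.1.2), q.2) with hΘ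
  have hΘs : ContMDiffOn (tubeModel m) (tubeModel m) ∞ Θ S := by
    refine ContMDiffOn.prodMk (ContMDiffOn.prodMk ?_ ?_) contMDiffOn_snd
    · exact contMDiffOn_pi_space.1 H.smooth 0
    · exact (contMDiff_snd.comp contMDiff_fst).contMDiffOn
  have hΘ0 : ∀ z ∈ cylinder M T, Θ (z, 0) = (z, 0) := fun z hz => by
    simp only [hΘ]
    rw [H.zero z hz, hΨ.time_eq z hz]
  -- On `B` the values of Θ stay within |y^0| < T/2, where `E` is injective. Θ is the identity on
  -- the zero section, so `B` contains that section over |y^0| ≤ T/4.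
  set B : Set ((ℝ × M) × ℝ) := S ∩ Θ ⁻¹' (S ∩ {q | |q.1.1| < T / 2}) with hB
  have hBo : IsOpen B := by
    refine hΘs.continuousOn.isOpen_inter_preimage H.isOpen (H.isOpen.inter ?_)
    exact isOpen_lt (continuous_fst.comp continuous_fst).abs continuous_const
  have hB0 : ∀ p : ℝ × M, p.1 ∈ Icc (-(T / 4)) (T / 4) → (p, (0 : ℝ)) ∈ B := fun p hp => by
    have hpc := hcyl (by linarith) p hp
    refine ⟨H.zero_mem p hpc, ?_⟩
    rw [mem_preimage, hΘ0 p hpc]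
    exact ⟨H.zero_mem p hpc, (abs_le.2 hp).trans_lt (by linarith)⟩
  have hBc : ∀ z, (z, (0 : ℝ)) ∈ B → z ∈ cylinder M T := fun z hz => H.mem_cylinder _ hz.1
  have hR0 : ∀ z ∈ cylinder M T, (E ∘ Θ) (z, 0) = Ψ z := fun z hz => by
    rw [Function.comp_apply, hΘ0 z hz, H.zero z hz]
  have hRs : ContMDiffOn (tubeModel m) 𝓘(ℝ, Fin (m + 2) → ℝ) ∞ (E ∘ Θ) B :=
    H.smooth.comp (hΘs.mono inter_subset_left) fun q hq => hq.2.1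
  obtain ⟨r₂, hr₂, hR⟩ := exists_tube_isDiffeoOntoImage (Φ := E ∘ Θ) (T := T / 4)
    (fun p hp => by
      have hpc := hcyl (by linarith) p hp
      obtain ⟨w, hw, hw0, hcurve⟩ := H.exists_hasDerivAt_curve hh hΨ.time_eq hpc (hν p hpc)
      have hα : HasDerivAt (fun t => E (p, t) 0) (ν p 0) 0 :=
        hasDerivAt_pi.1 (H.hasDerivAt_zero hh hpc) 0
      -- The normal derivative of E ∘ Θ is ν^0 w + ν with w tangent; its product with ν is 1, so it
      -- is transversal.
      have h1 := hcurve (fun t => E (p, t) 0) (ν p 0)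
        (by rw [H.zero p hpc, hΨ.time_eq p hpc]) hα
      exact exists_isDiffeoOntoImage_of_transversal (h := h) hBo hRs (fun z hz => hR0 z (hBc z hz))
        (hB0 p hp) (hΨ.linearIndependent_pd hpc) (hν p hpc) h1 (by
          rw [ip_add_right, ip_smul_right, hw, (hν p hpc).unit]; norm_num))
    (fun p p' hp hp' hpp => by
      have hpc := hcyl (by linarith) p hp
      have hpc' := hcyl (by linarith) p' hp'
      exact hΨ.injOn hpc hpc' (by rwa [hR0 p hpc, hR0 p' hpc'] at hpp))
  obtain ⟨r₃, hr₃, hB₃⟩ := exists_closedTube_subset hBo hB0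
  set V := tube M (T / 4) (min r₂ (min r₃ r₁)) with hV
  have hVR : IsDiffeoOntoImage (E ∘ Θ) V :=
    hR.mono (isOpen_tube M _ _) (tube_mono (min_le_left _ _))
  have hVB : V ⊆ B := (tube_mono ((min_le_right _ _).trans (min_le_left _ _))).trans
    (tube_subset_closedTube.trans hB₃)
  have h0V : ∀ y : M, (((0 : ℝ), y), (0 : ℝ)) ∈ V := fun y =>
    ⟨⟨⟨by simp only; linarith, by simp only; linarith⟩, trivial⟩,
      ⟨by simp [hr₁, hr₂, hr₃], by simp [hr₁, hr₂, hr₃]⟩⟩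
  have hmem0 : ∀ y : M, ((0 : ℝ), y) ∈ cylinder M T := fun y =>
    ⟨⟨neg_lt_zero.2 hT, hT⟩, trivial⟩
  -- The closed tube with T = 0 lies over the single time 0, the only slice where the inverse is
  -- evaluated.
  obtain ⟨r₄, hr₄, hC₄⟩ := exists_closedTube_subset (T := 0) (M := M)
    (H.smooth.continuousOn.isOpen_inter_preimage H.isOpen hVR.1) fun p hp => by
      have hp0 : p = ((0 : ℝ), p.2) := Prod.ext (le_antisymm hp.2 (by simpa using hp.1)) rfl
      rw [hp0]
      refine ⟨H.zero_mem _ (hmem0 _), _, h0V p.2, ?_⟩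
      rw [hR0 _ (hmem0 _), H.zero _ (hmem0 _)]
  have hC : ∀ (y : M) (s : ℝ), |s| < min r₄ r₁ →
      (((0 : ℝ), y), s) ∈ S ∧ E ((0, y), s) ∈ (E ∘ Θ) '' V := fun y s hs => by
    have h1 := abs_le.1 (hs.le.trans (min_le_left _ _))
    exact hC₄ ⟨⟨⟨by simp, le_rfl⟩, trivial⟩, h1⟩
  rcases isEmpty_or_nonempty M with hM | ⟨⟨y₀⟩⟩
  · exact ⟨fun _ => 0, 1, one_pos, contMDiffOn_const, fun y => isEmptyElim y,
      fun y => isEmptyElim y, fun y => isEmptyElim y⟩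
  obtain ⟨Ξ, hl, hΞ⟩ := hVR.2.2.2 ⟨_, h0V y₀⟩
  set k : M × ℝ → ℝ := fun z => (Ξ (E ((0, z.1), z.2))).1.1 with hk
  have hks : ContMDiffOn (tubeModel m) 𝓘(ℝ, ℝ) ∞ (fun q : (ℝ × M) × ℝ => k (q.1.2, q.2))
      (univ ×ˢ Ioo (-(min r₄ r₁)) (min r₄ r₁)) := by
    have h1 : ContMDiff (tubeModel m) (tubeModel m) ∞
        fun q : (ℝ × M) × ℝ => (((0 : ℝ), q.1.2), q.2) :=
      (contMDiff_const.prodMk (contMDiff_snd.comp contMDiff_fst)).prodMk contMDiff_snd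
    have h2 := H.smooth.comp (h1.contMDiffOn (s := univ ×ˢ Ioo (-(min r₄ r₁)) (min r₄ r₁)))
      fun q hq => (hC q.1.2 q.2 (abs_lt.2 hq.2)).1
    have h3 := hΞ.comp h2 fun q hq => (hC q.1.2 q.2 (abs_lt.2 hq.2)).2
    exact fun q hq => (h3 q hq).fst.fst
  have hkE : ∀ y s, |s| < min r₄ r₁ → E ((k (y, s), y), s) 0 = 0 := fun y s hs => by
    obtain ⟨q, hq, hqE⟩ := (hC y s hs).2
    have hΘq : Θ q ∈ tube M (T / 2) r₁ :=
      ⟨⟨abs_lt.1 (hVB hq).2.2, trivial⟩,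
        Ioo_subset_Ioo (neg_le_neg ((min_le_right _ _).trans (min_le_right _ _)))
          ((min_le_right _ _).trans (min_le_right _ _)) hq.2⟩
    have h0q : (((0 : ℝ), y), s) ∈ tube M (T / 2) r₁ :=
      ⟨⟨⟨by simp only; linarith, by simp only; linarith⟩, trivial⟩,
        abs_lt.1 (hs.trans_le (min_le_right _ _))⟩
    have heq : Θ q = ((0, y), s) := hE.2.1 hΘq h0q hqE
    have hkq : k (y, s) = q.1.1 := by
      simp only [hk]
      rw [← hqE, hl hq]
    have hq' : q = ((k (y, s), y), s) := by
      rw [hkq]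
      exact Prod.ext (Prod.ext rfl (congrArg (fun q => q.1.2) heq)) (congrArg (fun q => q.2) heq)
    rw [← hq']
    exact congrArg (fun q => q.1.1) heq
  have hk0 : ∀ y, k (y, 0) = 0 := fun y => by
    have h1 : E ((0, y), 0) = (E ∘ Θ) ((0, y), 0) := by
      rw [hR0 _ (hmem0 y), H.zero _ (hmem0 y)]
    simp only [hk]
    rw [h1, hl (h0V y)]
  have hr : 0 < min r₄ r₁ := lt_min hr₄ hr₁
  refine ⟨k, min r₄ r₁, hr, hks, hkE, hk0, fun y => ?_⟩
  have hdk : DifferentiableAt ℝ (fun t => k (y, t)) 0 := by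
    have h1 : ContMDiff 𝓘(ℝ, ℝ) (tubeModel m) ∞ fun t : ℝ => (((0 : ℝ), y), t) :=
      contMDiff_const.prodMk contMDiff_id
    have h2 := hks.comp (h1.contMDiffOn (s := Ioo (-(min r₄ r₁)) (min r₄ r₁)))
      fun t ht => ⟨trivial, ht⟩
    exact (h2.contDiffOn.contDiffAt (isOpen_Ioo.mem_nhds ⟨neg_lt_zero.2 hr, hr⟩)).differentiableAt
      (by simp)
  obtain ⟨w, -, hw0, hcurve⟩ :=
    H.exists_hasDerivAt_curve hh hΨ.time_eq (hmem0 y) (hν _ (hmem0 y))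
  -- Differentiating E^0((k(y, t), y), t) = 0 at t = 0 gives k' w^0 + ν^0 = 0, where w^0 = 1 and ν^0
  -- = 0 on the initial surface.
  have h1 := hasDerivAt_pi.1 (hcurve (fun t => k (y, t)) _ (hk0 y) hdk.hasDerivAt) 0
  have h2 : (fun t => E ((k (y, t), y), t) 0) =ᶠ[𝓝 0] fun _ => 0 := by
    filter_upwards [Ioo_mem_nhds (neg_lt_zero.2 hr) hr] with t ht
    exact hkE y t (abs_lt.2 ht)
  have h3 := (h1.congr_of_eventuallyEq h2.symm).unique (hasDerivAt_const (0 : ℝ) (0 : ℝ))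
  have h4 : deriv (fun t => k (y, t)) 0 = 0 := by
    simpa [hw0, hν0] using h3
  have h5 := hdk.hasDerivAt
  rwa [h4] at h5

/-- Uniqueness for the eikonal equation on a tube, by the method of characteristics. -/
lemma eq_of_isEikonalSolution (hh : IsAdmissibleMetric h)
    (hΨ : IsAdaptedParametrization h T (lateralBoundary I T) Ψ)
    (hν : ∀ p ∈ cylinder M T, IsInwardUnitNormal h I Ψ p (ν p)) {T₁ r : ℝ}
    (hS : tube M T₁ r ⊆ S) (hE : IsDiffeoOntoImage E (tube M T₁ r))
    {d : (Fin (m + 2) → ℝ) → ℝ}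
    (hd : IsEikonalSolution h (lateralBoundary I T) I (E '' tube M T₁ r) d)
    {q : (ℝ × M) × ℝ} (hq : q ∈ tube M T₁ r) : d (E q) = q.2 := by
  have hr : 0 < r := by linarith [hq.2.1, hq.2.2]
  have h0J : (0 : ℝ) ∈ Ioo (-r) r := ⟨neg_lt_zero.2 hr, hr⟩
  set z := q.1 with hz
  have hzT : z ∈ cylinder M T := H.mem_cylinder q (hS hq)
  have hzt : ∀ t ∈ Ioo (-r) r, (z, t) ∈ tube M T₁ r := fun t ht => ⟨hq.1, ht⟩
  have hz0 := hzt 0 h0J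
  have hxU : E '' tube M T₁ r ∈ 𝓝 (Ψ z) := by
    rw [← H.zero z hzT]; exact hE.1.mem_nhds (mem_image_of_mem _ hz0)
  have heik : ∀ x ∈ E '' tube M T₁ r,
      ip (invMetric h) x (differential d x) (differential d x) = 1 := fun x hx => by
    rw [← sum_inv_mul_pd_mul_pd]; exact hd.eikonal x hx
  have hxm : Ψ z ∈ E '' tube M T₁ r := mem_of_mem_nhds hxU
  have hdx : DifferentiableAt ℝ d (Ψ z) :=
    ((hd.smooth _ hxm).contDiffAt hxU).differentiableAt (by simp)
  have hΓ : ∀ w ∈ cylinder M T, Ψ w ∈ lateralBoundary I T := fun w hw =>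
    ⟨hΨ.mem_frontier hw, hΨ.mem_slab hw⟩
  -- The gradient of `d` at Ψ z has unit length by the eikonal equation and is normal because `d`
  -- vanishes on the hypersurface.
  set n := velocity (invMetric h) (Ψ z) (differential d (Ψ z)) with hn
  have hipn : ∀ v, ip h (Ψ z) n v = differential d (Ψ z) ⬝ᵥ v := fun v => hh.ip_velocity _ _ _
  have hunit : IsUnitNormal h Ψ z n := by
    refine ⟨?_, fun e he hze a => ?_⟩
    · rw [hipn, dotProduct_velocity]; exact heik _ hxm
    · rw [hipn]
      have hg : ContDiffOn ℝ ∞ (Ψ ∘ tanPoint e) (tanDomain e T) :=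
        (contDiffOn_comp_tanPoint he hΨ.smooth).mono fun y hy => ⟨hy.2, tanPoint_mem_cylinder hy⟩
      have hy := tanCoord_mem_tanDomain hzT hze
      have hgd : DifferentiableAt ℝ (Ψ ∘ tanPoint e) (tanCoord e z) :=
        ((hg _ hy).contDiffAt ((isOpen_tanDomain T).mem_nhds hy)).differentiableAt (by simp)
      have hgz : (Ψ ∘ tanPoint e) (tanCoord e z) = Ψ z := by
        rw [Function.comp_apply, tanPoint_tanCoord hze]
      have hzero : d ∘ (Ψ ∘ tanPoint e) =ᶠ[𝓝 (tanCoord e z)] fun _ => 0 := by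
        filter_upwards [(isOpen_tanDomain T).mem_nhds hy,
          hgd.continuousAt.preimage_mem_nhds (by rw [hgz]; exact hxU)] with y hy hyU
        exact hd.zero _ ⟨hΓ _ (tanPoint_mem_cylinder hy), hyU⟩
      have h1 := DFunLike.congr_fun (fderiv_comp (tanCoord e z) (g := d) (by rwa [hgz]) hgd)
        (Pi.single a 1)
      rw [hzero.fderiv_eq, ContinuousLinearMap.comp_apply, fderiv_eq_differential d, hgz] at h1
      refine h1.symm.trans ?_
      simp
  have hnν : n = ν z := by
    -- Were the gradient -ν, `d` would decrease from 0 at rate 1 along ν, hence be negative at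
    -- points of `I`.
    refine (hΨ.eq_or_eq_neg hh hzT (hν z hzT).1 hunit).resolve_right fun hneg => ?_
    have hline : HasDerivAt (fun s : ℝ => Ψ z + s • ν z) (ν z) 0 := by
      simpa using ((hasDerivAt_id (0 : ℝ)).smul_const (ν z)).const_add (Ψ z)
    have h1 : HasDerivAt (fun s : ℝ => d (Ψ z + s • ν z)) (-1) 0 := by
      have h2 := hdx.hasFDerivAt.comp_hasDerivAt_of_eq (0 : ℝ) hline (by simp)
      rw [fderiv_eq_differential, ← hipn, hneg, ip_neg_left, (hν z hzT).1.unit] at h2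
      exact h2
    have h2 := ((hasDerivAt_iff_tendsto_slope.1 h1).eventually
      (gt_mem_nhds (show (-1 : ℝ) < 0 by norm_num))).filter_mono
        (nhdsWithin_mono 0 fun s (hs : 0 < s) => hs.ne')
    have h3 : ∀ᶠ s in 𝓝[>] (0 : ℝ), Ψ z + s • ν z ∈ E '' tube M T₁ r :=
      nhdsWithin_le_nhds (hline.continuousAt.preimage_mem_nhds (by simpa using hxU))
    have hpos : ∀ᶠ s in 𝓝[>] (0 : ℝ), 0 < s := self_mem_nhdsWithin
    obtain ⟨s, hs0, hs1, hs2, hs3⟩ := (hpos.and (h2.and (h3.and (hν z hzT).2))).exists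
    rw [slope_def_field, zero_smul, add_zero, hd.zero _ ⟨hΓ z hzT, hxm⟩, sub_zero, sub_zero] at hs1
    exact (hd.pos _ ⟨hs3, hs2⟩).not_gt (by
      have := (div_neg_iff.1 hs1).resolve_left fun h => h.2.not_gt hs0
      exact this.1)
  have hchar := eikonal_characteristic hh.contDiff_invMetric hh.invMetric_isSymm hE.1 hd.smooth heik
    (γ := fun t => (E (z, t), P (z, t))) isPreconnected_Ioo isOpen_Ioo h0J
    (fun t ht => H.ode _ (hS (hzt t ht))) (fun t ht => mem_image_of_mem _ (hzt t ht)) (by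
      simp only
      rw [H.zero z hzT, H.momentum_zero z hzT, ← hnν, hn, hh.mulVec_velocity])
  have hconst := isOpen_Ioo.is_const_of_deriv_eq_zero (f := fun t => d (E (z, t)) - t)
    isPreconnected_Ioo
    (fun t ht => ((hchar t ht).2.fun_sub (hasDerivAt_id' t)).differentiableAt.differentiableWithinAt)
    (fun t ht => by
      have := ((hchar t ht).2.fun_sub (hasDerivAt_id' t)).deriv
      simpa using this) hq.2 h0J
  rw [H.zero z hzT, hd.zero _ ⟨hΓ z hzT, hxm⟩, sub_zero, sub_eq_zero] at hconst
  exact hconst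

end IsNormalFlow
end NormalCoordinates

/-! ### Adapted coordinates -/

section AdaptedCoordinates

variable {m : ℕ} {h : (Fin (m + 2) → ℝ) → Matrix (Fin (m + 2)) (Fin (m + 2)) ℝ}
  {M : Type*} [TopologicalSpace M] [ChartedSpace (EuclideanSpace ℝ (Fin m)) M]
  {Ψ ν : ℝ × M → (Fin (m + 2) → ℝ)} {E P : (ℝ × M) × ℝ → (Fin (m + 2) → ℝ)}
  {S : Set ((ℝ × M) × ℝ)} {T : ℝ} {I : Set (Fin (m + 2) → ℝ)}

/-- The shift in time by `χ k`. -/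
def timeShift (χ : ℝ → ℝ) (k : M × ℝ → ℝ) (q : (ℝ × M) × ℝ) : (ℝ × M) × ℝ :=
  ((q.1.1 + χ q.1.1 * k (q.1.2, q.2), q.1.2), q.2)

lemma timeShift_zero {χ : ℝ → ℝ} {k : M × ℝ → ℝ} (hk : ∀ y, k (y, 0) = 0) (z : ℝ × M) :
    timeShift χ k (z, 0) = (z, 0) := by
  simp [timeShift, hk]

lemma contMDiffOn_timeShift {χ : ℝ → ℝ} (hχ : ContDiff ℝ ∞ χ) {k : M × ℝ → ℝ}
    {A : Set ((ℝ × M) × ℝ)}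
    (hk : ContMDiffOn (tubeModel m) 𝓘(ℝ, ℝ) ∞ (fun q : (ℝ × M) × ℝ => k (q.1.2, q.2)) A) :
    ContMDiffOn (tubeModel m) (tubeModel m) ∞ (timeShift χ k) A := by
  have h1 : ContMDiff (tubeModel m) 𝓘(ℝ, ℝ) ∞ fun q : (ℝ × M) × ℝ => q.1.1 :=
    contMDiff_fst.comp contMDiff_fst
  refine ContMDiffOn.prodMk (ContMDiffOn.prodMk ?_ ?_) contMDiffOn_snd
  · exact h1.contMDiffOn.add ((hχ.contMDiff.comp h1).contMDiffOn.mul hk)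
  · exact (contMDiff_snd.comp contMDiff_fst).contMDiffOn

/-- The time shift maps a tube onto itself. -/
lemma image_timeShift {χ : ℝ → ℝ} (hχ : Continuous χ) (hχ01 : ∀ t, χ t ∈ Icc (0 : ℝ) 1) {T r : ℝ}
    (hT : 0 < T) (hχT : ∀ t, T / 2 ≤ |t| → χ t = 0) {k : M × ℝ → ℝ}
    (hk : ∀ y : M, ∀ s ∈ Ioo (-r) r, |k (y, s)| < T / 2) :
    timeShift χ k '' tube M T r = tube M T r := by
  apply Subset.antisymm
  · rintro _ ⟨q, hq, rfl⟩
    refine ⟨⟨abs_lt.1 ?_, trivial⟩, hq.2⟩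
    change |q.1.1 + χ q.1.1 * k (q.1.2, q.2)| < T
    rcases le_or_gt (T / 2) |q.1.1| with h1 | h1
    · rw [hχT _ h1, zero_mul, add_zero]
      exact abs_lt.2 hq.1.1
    · have h2 := hk q.1.2 q.2 hq.2
      have h3 : |χ q.1.1 * k (q.1.2, q.2)| ≤ |k (q.1.2, q.2)| := by
        rw [abs_mul, abs_of_nonneg (hχ01 _).1]
        exact mul_le_of_le_one_left (abs_nonneg _) (hχ01 _).2
      linarith [abs_add_le q.1.1 (χ q.1.1 * k (q.1.2, q.2))]
  · rintro ⟨⟨a, y⟩, s⟩ ⟨⟨ha, -⟩, hs⟩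
    have ha' : -T < a ∧ a < T := ha
    have hT' : T / 2 ≤ |T| := by rw [abs_of_pos hT]; linarith
    -- Surjectivity by the intermediate value theorem: the shift fixes both ends ±T because χ
    -- vanishes there.
    have hc : ContinuousOn (fun t => t + χ t * k (y, s)) (Icc (-T) T) := by fun_prop
    have hl : -T + χ (-T) * k (y, s) = -T := by
      rw [hχT (-T) (by rwa [abs_neg]), zero_mul, add_zero]
    have hr : T + χ T * k (y, s) = T := by rw [hχT T hT', zero_mul, add_zero]
    have hsub := intermediate_value_Ioo (by linarith) hc
    simp only [hl, hr] at hsub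
    obtain ⟨t, ht, hta⟩ := hsub ha'
    exact ⟨((t, y), s), ⟨⟨ht, trivial⟩, hs⟩, Prod.ext (Prod.ext hta rfl) rfl⟩

lemma isCompact_coordBox {e : OpenPartialHomeomorph M (EuclideanSpace ℝ (Fin m))} {K : Set M}
    (hK : IsCompact K) (hKe : K ⊆ e.source) (T r : ℝ) :
    IsCompact {y : Fin (m + 2) → ℝ | |y 0| ≤ T ∧
      WithLp.toLp 2 (Fin.tail (Fin.init y)) ∈ e '' K ∧ |y (Fin.last (m + 1))| ≤ r} := by
  have hc : IsCompact ((Icc (-T) T ×ˢ (e '' K)) ×ˢ Icc (-r) r) :=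
    (isCompact_Icc.prod (hK.image_of_continuousOn (e.continuousOn.mono hKe))).prod isCompact_Icc
  have hg : Continuous fun z : (ℝ × EuclideanSpace ℝ (Fin m)) × ℝ =>
      (Fin.snoc (α := fun _ => ℝ) (Fin.cons z.1.1 z.1.2.ofLp : Fin (m + 1) → ℝ) z.2 :
        Fin (m + 2) → ℝ) := by
    refine continuous_pi fun i => ?_
    induction i using Fin.lastCases with
    | last => simpa using continuous_snd
    | cast i =>
      simp only [Fin.snoc_castSucc]
      induction i using Fin.cases with
      | zero => exact continuous_fst.comp continuous_fst
      | succ j =>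
        simp only [Fin.cons_succ]
        fun_prop
  convert! hc.image hg using 1
  ext y
  constructor
  · rintro ⟨h1, h2, h3⟩
    refine ⟨((y 0, WithLp.toLp 2 (Fin.tail (Fin.init y))), y (Fin.last (m + 1))),
      ⟨⟨abs_le.1 h1, h2⟩, abs_le.1 h3⟩, ?_⟩
    have h4 : (Fin.cons (y 0) (Fin.tail (Fin.init y)) : Fin (m + 1) → ℝ) = Fin.init y :=
      Fin.cons_self_tail (Fin.init y)
    simp only
    rw [h4, Fin.snoc_init_self]
  · rintro ⟨z, ⟨⟨h1, h2⟩, h3⟩, rfl⟩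
    refine ⟨?_, ?_, ?_⟩
    · have : (Fin.snoc (α := fun _ => ℝ) (Fin.cons z.1.1 z.1.2.ofLp : Fin (m + 1) → ℝ) z.2 :
          Fin (m + 2) → ℝ) 0 = z.1.1 := by
        rw [← Fin.castSucc_zero, Fin.snoc_castSucc]; rfl
      exact (congrArg abs this).le.trans (abs_le.2 h1)
    · simpa using h2
    · simpa using abs_le.2 h3

variable [IsManifold (𝓡 m) ∞ M]

namespace IsNormalFlow

variable (H : IsNormalFlow h Ψ ν T E P S)
include H

/-- Since k vanishes to second order, the shift does not affect the first normal derivative of `E`.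
-/
lemma hasDerivAt_comp_timeShift (hh : IsAdmissibleMetric h)
    (htime : ∀ p ∈ cylinder M T, Ψ p 0 = p.1) {p : ℝ × M} (hp : p ∈ cylinder M T)
    (hν : IsUnitNormal h Ψ p (ν p)) (χ : ℝ → ℝ) {k : M × ℝ → ℝ} (hk : k (p.2, 0) = 0)
    (hk' : HasDerivAt (fun t => k (p.2, t)) 0 0) :
    HasDerivAt (fun t => E (timeShift χ k (p, t))) (ν p) 0 := by
  obtain ⟨w, -, -, hcurve⟩ := H.exists_hasDerivAt_curve hh htime hp hν
  have h1 := hcurve (fun t => p.1 + χ p.1 * k (p.2, t)) 0 (by simp [hk])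
    (by simpa using (hk'.const_mul (χ p.1)).const_add p.1)
  rwa [zero_smul, zero_add] at h1

/-- The distance from the hypersurface solves the eikonal equation. -/
lemma isEikonalSolution (hh : IsAdmissibleMetric h) (hI : IsOpen I)
    (hΨ : IsAdaptedParametrization h T (lateralBoundary I T) Ψ)
    (hν : ∀ p ∈ cylinder M T, IsUnitNormal h Ψ p (ν p)) {W W' : Set ((ℝ × M) × ℝ)}
    (hW : IsOpen W) (hWS : W ⊆ S) (hE : IsDiffeoOntoImage E W) (hW' : W' ⊆ W)
    (hside : ∀ q ∈ W', q.2 ≠ 0 → E q ∉ frontier I ∧ (E q ∈ I ↔ 0 < q.2))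
    {d : (Fin (m + 2) → ℝ) → ℝ} (hd : ContDiffOn ℝ ∞ d (E '' W)) (hdE : ∀ q ∈ W, d (E q) = q.2) :
    IsEikonalSolution h (lateralBoundary I T) I (E '' W') d where
  smooth := hd.mono (image_mono hW')
  zero := by
    rintro _ ⟨hx, q, hq, rfl⟩
    rw [hdE q (hW' hq)]
    by_contra h0
    exact (hside q hq h0).1 hx.1
  eikonal := by
    rintro _ ⟨q, hq, rfl⟩
    rw [sum_inv_mul_pd_mul_pd, H.differential_eq hh hν hW hWS hE hd hdE (hW' hq)]
    exact (H.dotProduct_pd hh hν (IsManifold.chart_mem_maximalAtlas q.1.2) (hWS (hW' hq))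
      (mem_chart_source _ _)).1
  pos := by
    rintro _ ⟨hx, q, hq, rfl⟩
    rw [hdE q (hW' hq)]
    have h0 : q.2 ≠ 0 := fun h0 => by
      have hqc := H.mem_cylinder q (hWS (hW' hq))
      have h1 : E q = Ψ q.1 := by
        rw [← H.zero q.1 hqc]; exact congrArg E (Prod.ext rfl h0)
      have h2 := hΨ.mem_frontier hqc
      rw [← h1, hI.frontier_eq] at h2
      exact h2.2 hx
    exact (hside q hq h0).2.1 hx

end IsNormalFlow

/-- The initial surface meets an orthogonal hypersurface in a normal direction tangent to it. -/
lemma IsOrthogonalToInitial.normal_time_eq_zero (hh : IsAdmissibleMetric h)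
    (horth : IsOrthogonalToInitial h T Ψ) (hT : 0 < T) {y : M} {n : Fin (m + 2) → ℝ}
    (hn : IsUnitNormal h Ψ (0, y) n) : n 0 = 0 := by
  set e := chartAt (EuclideanSpace ℝ (Fin m)) y
  have he : e ∈ IsManifold.maximalAtlas (𝓡 m) ∞ M := IsManifold.chart_mem_maximalAtlas y
  have hye : y ∈ e.source := mem_chart_source _ _
  have hdom : tanCoord e ((0 : ℝ), y) ∈ tanDomain e T :=
    tanCoord_mem_tanDomain ⟨⟨neg_lt_zero.2 hT, hT⟩, trivial⟩ hye
  have htp : tanPoint e (tanCoord e ((0 : ℝ), y)) = (0, y) := tanPoint_tanCoord hye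
  -- As h_{0i} = 0, the normal direction of Σ_0 is the time axis, so orthogonality reads h_00 n^0 =
  -- 0.
  have h1 := horth e he _ hdom rfl n (Pi.single 0 1)
    (fun a => by rw [htp]; exact hn.orth e he hye a)
    (fun w hw => by rw [hh.ip_eq]; simp [hw])
  rw [htp, hh.ip_eq] at h1
  simpa [(hh.time_time_neg _).ne] using h1

end AdaptedCoordinates

end Tubular

end

/-! ### Assembly of the adapted tube. -/

theorem proposition4p1 {m : ℕ} (hm : 1 ≤ m)
    {M : Type*} [TopologicalSpace M] [ChartedSpace (EuclideanSpace ℝ (Fin m)) M]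
    [IsManifold (𝓡 m) ∞ M]
    (h : (Fin (m + 2) → ℝ) → Matrix (Fin (m + 2)) (Fin (m + 2)) ℝ) (hh : IsAdmissibleMetric h)
    (κ : (Fin (m + 2) → ℝ) → ℝ) (hκ : ContDiff ℝ ∞ κ)
    (Tstar : ℝ) (hTstar : 0 < Tstar)
    (I : Set (Fin (m + 2) → ℝ)) (hI_open : IsOpen I) (hI_bdd : Bornology.IsBounded I)
    (hI_sub : I ⊆ slab m Tstar)
    (hI_side : Disjoint (lateralBoundary I Tstar) (interior (closure I)))
    (Ψ : ℝ × M → (Fin (m + 2) → ℝ))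
    (hΨ : IsAdaptedParametrization h Tstar (lateralBoundary I Tstar) Ψ)
    (h_timelike : IsTimelike h Tstar Ψ)
    (h_curv : HasPrescribedMeanCurvature h κ Tstar I Ψ)
    (h_orth : IsOrthogonalToInitial h Tstar Ψ)
    (T₀ : ℝ) (hT₀ : T₀ < Tstar) :
    ∃ T ρ : ℝ, 0 < T ∧ T₀ < T ∧ T < Tstar ∧ 0 < ρ ∧
    ∃ φ : (ℝ × M) × ℝ → (Fin (m + 2) → ℝ),
      IsDiffeoOntoImage φ (tube M T (2 * ρ)) ∧
      ContinuousOn φ (closedTube M T (2 * ρ)) ∧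
      (∀ p ∈ cylinder M T, φ (p, 0) = Ψ p) ∧
      lateralBoundary I Tstar ∩ slab m T₀ = φ '' (cylinder M T₀ ×ˢ {0}) ∧
      lateralBoundary I Tstar ∩ slab m T₀ ⊆ φ '' tube M T (2 * ρ) ∧
      (∀ q ∈ closedTube M T (2 * ρ), |q.1.1| = T → T₀ < |φ q 0|) ∧
      (∀ (y' : M) (s : ℝ), |s| < 2 * ρ → φ ((0, y'), s) 0 = 0) ∧
      (∀ e ∈ IsManifold.maximalAtlas (𝓡 m) ∞ M, ∀ K : Set M, IsCompact K → K ⊆ e.source →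
        ∃ C : ℝ, ∀ y ∈ tubeDomain e K T (2 * ρ),
          MetricEstimates h κ (Ψ ∘ tanPoint e) (φ ∘ tubePoint e) C y) ∧
      ∃ d : (Fin (m + 2) → ℝ) → ℝ,
        IsEikonalSolution h (lateralBoundary I Tstar) I (φ '' tube M T (2 * ρ)) d ∧
        (∀ d' : (Fin (m + 2) → ℝ) → ℝ,
          IsEikonalSolution h (lateralBoundary I Tstar) I (φ '' tube M T (2 * ρ)) d' →
            EqOn d' d (φ '' tube M T (2 * ρ))) ∧
        ∃ C : ℝ, ∀ q ∈ tube M T (2 * ρ), |q.2 - d (φ q)| ≤ C * d (φ q) ^ 2 := by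
  have hcompact : CompactSpace M := hΨ.compactSpace hTstar hI_bdd
  obtain ⟨ν, hνs, hν⟩ := hΨ.exists_inward_normal hh hI_open hI_side h_timelike
  have hνu : ∀ p ∈ cylinder M Tstar, IsUnitNormal h Ψ p (ν p) := fun p hp => (hν p hp).1
  have hmem0 : ∀ y : M, ((0 : ℝ), y) ∈ cylinder M Tstar := fun y =>
    ⟨⟨neg_lt_zero.2 hTstar, hTstar⟩, trivial⟩
  obtain ⟨E, P, S, H⟩ := exists_normalFlow hh hΨ.smooth hνs
  obtain ⟨k, r₀, hr₀, hks, hkE, hk0, hk'⟩ := H.exists_time_shift hh hΨ hνu hTstar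
    fun y => h_orth.normal_time_eq_zero hh hTstar (hνu _ (hmem0 y))
  -- Nested times max(T₀, 0) < T < T₂ < T₁ < Tstar: `E` is a diffeomorphism over T₁ and φ over T₂,
  -- and the closed tube over T fits inside both.
  obtain ⟨T, hT, hTlt⟩ := exists_between (max_lt hT₀ hTstar)
  obtain ⟨hT₀T, hT0⟩ := max_lt_iff.1 hT
  obtain ⟨T₂, hTT₂, hT₂⟩ := exists_between hTlt
  obtain ⟨T₁, hT₂₁, hT₁⟩ := exists_between hT₂
  have hcyl : ∀ {T' : ℝ}, T' < Tstar → ∀ p : ℝ × M, p.1 ∈ Icc (-T') T' → p ∈ cylinder M Tstar :=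
    fun hT' p hp => ⟨⟨by linarith [hp.1], by linarith [hp.2]⟩, trivial⟩
  obtain ⟨r₁, hr₁, hE, hES⟩ := H.exists_tube hh hΨ hνu hT₁
  have hW₁o := isOpen_tube M T₁ r₁
  have hW₁S : tube M T₁ r₁ ⊆ S := tube_subset_closedTube.trans hES
  obtain ⟨d, hd, hdE⟩ := exists_height hE
  -- χ = 1 at time 0 sends the slice y^0 = 0 into Σ_0, and χ = 0 for |t| ≥ T/2 keeps the tube
  -- invariant under the shift.
  let χ : ContDiffBump (0 : ℝ) := ⟨T / 4, T / 2, by linarith, by linarith⟩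
  have hχ0 : χ 0 = 1 := χ.one_of_mem_closedBall (by simp [χ]; linarith)
  have hχT : ∀ t, T / 2 ≤ |t| → χ t = 0 := fun t ht => χ.zero_of_le_dist (by simpa [χ] using ht)
  set σ : (ℝ × M) × ℝ → (ℝ × M) × ℝ := timeShift χ k with hσdef
  set φ : (ℝ × M) × ℝ → (Fin (m + 2) → ℝ) := E ∘ σ with hφdef
  have hAo : IsOpen ((univ : Set (ℝ × M)) ×ˢ Ioo (-r₀) r₀) := isOpen_univ.prod isOpen_Ioo
  have hσ := contMDiffOn_timeShift (m := m) χ.contDiff hks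
  have hσ0 : ∀ z : ℝ × M, σ (z, 0) = (z, 0) := timeShift_zero hk0
  set A : Set ((ℝ × M) × ℝ) := (univ ×ˢ Ioo (-r₀) r₀) ∩ σ ⁻¹' tube M T₁ r₁ with hA
  have hA₁o : IsOpen A := hσ.continuousOn.isOpen_inter_preimage hAo hW₁o
  have hφs : ContMDiffOn (tubeModel m) 𝓘(ℝ, Fin (m + 2) → ℝ) ∞ φ A :=
    hE.2.2.1.comp (hσ.mono inter_subset_left) fun q hq => hq.2
  have hW₁0 : ∀ p : ℝ × M, p.1 ∈ Icc (-T₂) T₂ → (p, (0 : ℝ)) ∈ tube M T₁ r₁ := fun p hp =>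
    ⟨⟨⟨by linarith [hp.1], by linarith [hp.2]⟩, trivial⟩, ⟨neg_lt_zero.2 hr₁, hr₁⟩⟩
  have hA0 : ∀ p : ℝ × M, p.1 ∈ Icc (-T₂) T₂ → (p, (0 : ℝ)) ∈ A := fun p hp =>
    ⟨⟨trivial, ⟨neg_lt_zero.2 hr₀, hr₀⟩⟩, by rw [mem_preimage, hσ0]; exact hW₁0 p hp⟩
  have hφ0 : ∀ z ∈ cylinder M Tstar, φ (z, 0) = Ψ z := fun z hz => by
    rw [hφdef, Function.comp_apply, hσ0, H.zero z hz]
  have hφν : ∀ z ∈ cylinder M Tstar, HasDerivAt (fun t => φ (z, t)) (ν z) 0 := fun z hz =>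
    H.hasDerivAt_comp_timeShift hh hΨ.time_eq hz (hνu z hz) χ (hk0 _) (hk' _)
  have hAc : ∀ z, (z, (0 : ℝ)) ∈ A → z ∈ cylinder M Tstar := fun z hz => by
    have h1 := hz.2
    rw [mem_preimage, hσ0] at h1
    exact H.mem_cylinder _ (hW₁S h1)
  obtain ⟨r₂, hr₂, hφ⟩ := exists_tube_isDiffeoOntoImage (Φ := φ) (T := T₂)
    (fun p hp => exists_isDiffeoOntoImage_of_transversal (h := h) hA₁o hφs
      (fun z hz => hφ0 z (hAc z hz)) (hA0 p hp) (hΨ.linearIndependent_pd (hcyl hT₂ p hp))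
      (hνu p (hcyl hT₂ p hp)) (hφν p (hcyl hT₂ p hp))
      (by rw [(hνu p (hcyl hT₂ p hp)).unit]; exact one_ne_zero))
    (fun p p' hp hp' hpp => hΨ.injOn (hcyl hT₂ p hp) (hcyl hT₂ p' hp')
      (by rwa [hφ0 _ (hcyl hT₂ p hp), hφ0 _ (hcyl hT₂ p' hp')] at hpp))
  set W : Set ((ℝ × M) × ℝ) := tube M T₂ r₂ ∩ A with hW
  have hWo : IsOpen W := (isOpen_tube M T₂ r₂).inter hA₁o
  have hφW : IsDiffeoOntoImage φ W := hφ.mono hWo inter_subset_left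
  -- Conditions that hold near [-T, T] × M × {0}: |k| < T/2 is needed for `image_timeShift`, |φ^0 -
  -- y^0| < T - T₀ for the ends |y^0| = T, and the last clause for the side on which `I` lies.
  set B : Set ((ℝ × M) × ℝ) := {q | q ∈ A ∧ q ∈ tube M T₁ r₁ ∧ |k (q.1.2, q.2)| < T / 2 ∧
    |φ q 0 - q.1.1| < T - T₀ ∧ (q.2 ≠ 0 → E q ∉ frontier I ∧ (E q ∈ I ↔ 0 < q.2))} with hB
  have hIcc : ∀ p : ℝ × M, p.1 ∈ Icc (-T) T → p.1 ∈ Icc (-T₂) T₂ := fun p hp =>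
    ⟨by linarith [hp.1], by linarith [hp.2]⟩
  obtain ⟨r₃, hr₃, hB₃⟩ := exists_closedTube_subset (S := interior B) isOpen_interior (T := T)
    fun p hp => by
      have hpc := hcyl hTlt p hp
      have hpA := hA0 p (hIcc p hp)
      have hpW := hW₁0 p (hIcc p hp)
      have hkc : ContinuousAt (fun q : (ℝ × M) × ℝ => |k (q.1.2, q.2)|) (p, 0) :=
        (hks.continuousOn.continuousAt (hAo.mem_nhds hpA.1)).abs
      have hφc : ContinuousAt (fun q : (ℝ × M) × ℝ => |φ q 0 - q.1.1|) (p, 0) :=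
        (((continuous_apply 0).continuousAt.comp
          (hφs.continuousOn.continuousAt (hA₁o.mem_nhds hpA))).sub
            (continuous_fst.comp continuous_fst).continuousAt).abs
      refine mem_interior_iff_mem_nhds.2 ?_
      filter_upwards [hA₁o.mem_nhds hpA, hW₁o.mem_nhds hpW,
        hkc.eventually_lt_const (u := T / 2) (by simp only [hk0, abs_zero]; linarith),
        hφc.eventually_lt_const (u := T - T₀) (by
          simp only
          rw [hφ0 p hpc, hΨ.time_eq p hpc, sub_self, abs_zero]
          linarith),
        hΨ.eventually_mem_iff hI_open hI_side hpc hW₁o hpW hE (fun z hz _ => H.zero z hz)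
          (H.hasDerivAt_zero hh hpc) (hν p hpc)] with q h1 h2 h3 h4 h5
      exact ⟨h1, h2, h3, h4, h5⟩
  obtain ⟨ρ, hρ, hρlt⟩ := exists_between (show 0 < min r₂ r₃ / 2 by positivity)
  -- Strict, because the closed tube must fit into an open one of radius r₂.
  have hρ₂ : 2 * ρ < r₂ := by linarith [min_le_left r₂ r₃]
  have hρ₃ : 2 * ρ ≤ r₃ := by linarith [min_le_right r₂ r₃]
  have hCB : closedTube M T (2 * ρ) ⊆ B :=
    (closedTube_mono hρ₃).trans (hB₃.trans interior_subset)
  have hCW : closedTube M T (2 * ρ) ⊆ W := fun q hq =>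
    ⟨⟨⟨⟨by linarith [hq.1.1.1], by linarith [hq.1.1.2]⟩, trivial⟩,
      ⟨by linarith [hq.2.1], by linarith [hq.2.2]⟩⟩, (hCB hq).1⟩
  have hNC : tube M T (2 * ρ) ⊆ closedTube M T (2 * ρ) := tube_subset_closedTube
  have hNW₁ : tube M T (2 * ρ) ⊆ tube M T₁ r₁ := fun q hq => (hCB (hNC hq)).2.1
  -- φ and `E` have the same image, so existence and uniqueness for the eikonal equation need only
  -- be known for `E`.
  have himg : φ '' tube M T (2 * ρ) = E '' tube M T (2 * ρ) := by
    rw [hφdef, image_comp, hσdef, image_timeShift χ.continuous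
      (fun t => ⟨χ.nonneg, χ.le_one⟩) hT0 hχT fun y s hs => ?_]
    exact (hCB (a := ((0, y), s))
      ⟨⟨⟨neg_nonpos.2 hT0.le, hT0.le⟩, trivial⟩, Ioo_subset_Icc_self hs⟩).2.2.1
  have hcylT : ∀ p ∈ cylinder M T, p ∈ cylinder M Tstar := fun p hp =>
    hcyl hTlt p (Ioo_subset_Icc_self hp.1)
  have hcylT₀ : ∀ p ∈ cylinder M T₀, p ∈ cylinder M T := fun p hp =>
    ⟨⟨by linarith [hp.1.1], by linarith [hp.1.2]⟩, trivial⟩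
  have hΓ : lateralBoundary I Tstar ∩ slab m T₀ = φ '' (cylinder M T₀ ×ˢ {0}) := by
    ext x
    constructor
    · rintro ⟨hx, hx0⟩
      rw [← hΨ.image_eq] at hx
      obtain ⟨p, hp, rfl⟩ := hx
      refine ⟨(p, 0), ⟨⟨abs_lt.1 ?_, trivial⟩, rfl⟩, hφ0 p hp⟩
      rw [← hΨ.time_eq p hp]
      exact hx0
    · rintro ⟨⟨p, s⟩, ⟨hp, hs⟩, rfl⟩
      rw [mem_singleton_iff] at hs
      simp only at hp hs
      subst hs
      have hpc := hcylT p (hcylT₀ p hp)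
      rw [hφ0 p hpc]
      refine ⟨⟨hΨ.mem_frontier hpc, hΨ.mem_slab hpc⟩, ?_⟩
      change |Ψ p 0| < T₀
      rw [hΨ.time_eq p hpc]
      exact abs_lt.2 hp.1
  have hE₂ : IsDiffeoOntoImage E (tube M T (2 * ρ)) := hE.mono (isOpen_tube M _ _) hNW₁
  -- The shift preserves y^n, so y^n equals d ∘ φ exactly and the constant 0 suffices in the last
  -- estimate.
  have hdφ : ∀ q ∈ A, d (φ q) = q.2 := fun q hq => hdE (σ q) hq.2
  refine ⟨T, ρ, hT0, hT₀T, hTlt, hρ, φ, hφW.mono (isOpen_tube M _ _) (hNC.trans hCW),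
    hφs.continuousOn.mono fun q hq => (hCB hq).1, fun p hp => hφ0 p (hcylT p hp), hΓ, ?_, ?_, ?_,
    ?_, d, ?_, ?_, 0, ?_⟩
  · rw [hΓ]
    refine image_mono ?_
    rintro ⟨p, s⟩ ⟨hp, hs⟩
    rw [mem_singleton_iff] at hs
    simp only at hp hs
    subst hs
    exact ⟨hcylT₀ p hp, ⟨by linarith, by linarith⟩⟩
  · intro q hq hqT
    have h1 := (hCB hq).2.2.2.1
    have h2 := abs_sub_abs_le_abs_sub q.1.1 (φ q 0)
    rw [abs_sub_comm] at h2
    linarith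
  · intro y' s hs
    have h1 : ((0, y'), s) ∈ A := (hCB (a := ((0, y'), s))
      ⟨⟨⟨neg_nonpos.2 hT0.le, hT0.le⟩, trivial⟩, abs_le.1 hs.le⟩).1
    have h2 : σ ((0, y'), s) = ((k (y', s), y'), s) := by
      simp [hσdef, timeShift, hχ0]
    rw [hφdef, Function.comp_apply, h2]
    exact hkE y' s (abs_lt.2 h1.1.2)
  · intro e he K hK hKe
    have hchart : IsNormalTubeChart h κ (Ψ ∘ tanPoint e) (φ ∘ tubePoint e) (chartDomain e W) :=
      -- The differential of `d` at φ q = E(σ q) is the momentum at σ q.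
      isNormalTubeChart_comp (Q := P ∘ σ) (d := d) hh h_curv hWo
        (fun q hq => hcyl hT₂ _ (Ioo_subset_Icc_self hq.1.1.1)) hφW
        (fun z hz => hφ0 z (hAc z hz.2)) hν (fun z hz => hφν z (hAc z hz.2))
        (H.smooth_momentum.comp (hσ.mono fun q hq => hq.2.1) fun q hq => hW₁S hq.2.2)
        (fun z hz => by
          rw [Function.comp_apply, hσ0, H.momentum_zero z (hAc z hz.2)])
        (fun q hq => (H.dotProduct_pd hh hνu (IsManifold.chart_mem_maximalAtlas (σ q).1.2)
          (hW₁S hq.2.2) (mem_chart_source _ _)).1)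
        (hd.mono (by
          rintro _ ⟨q, hq, rfl⟩
          exact mem_image_of_mem E hq.2.2))
        (fun q hq => hdφ q hq.2)
        (fun q hq => H.differential_eq hh hνu hW₁o hW₁S hE hd hdE hq.2.2) he
    have hbox : ∀ y : Fin (m + 2) → ℝ, |y 0| ≤ T → |y (Fin.last (m + 1))| ≤ 2 * ρ →
        tubePoint e y ∈ W ∧ ((tubePoint e y).1, (0 : ℝ)) ∈ W := fun y h0 h1 =>
      ⟨hCW ⟨⟨abs_le.1 h0, trivial⟩, abs_le.1 h1⟩,
        hCW ⟨⟨abs_le.1 h0, trivial⟩, ⟨by linarith, by linarith⟩⟩⟩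
    obtain ⟨C, hC⟩ := hchart.exists_metricEstimates hh hκ (isCompact_coordBox hK hKe T (2 * ρ))
      (fun y hy => by
        obtain ⟨x, hx, hxy⟩ := hy.2.1
        exact ⟨by rw [← hxy]; exact e.map_source (hKe hx), hbox y hy.1 hy.2.2⟩)
      (fun y hy θ hθ => by
        refine ⟨?_, ?_, ?_⟩
        · rw [Function.update_of_ne (Fin.last_pos.ne)]
          exact hy.1
        · rw [Fin.init_update_last]
          exact hy.2.1
        · rw [Function.update_self, abs_mul, abs_of_nonneg hθ.1]
          exact (mul_le_of_le_one_left (abs_nonneg _) hθ.2).trans hy.2.2)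
    exact ⟨C, fun y hy => hC y ⟨hy.1.le, hy.2.1, hy.2.2.le⟩⟩
  · rw [himg]
    exact H.isEikonalSolution hh hI_open hΨ hνu hW₁o hW₁S hE hNW₁
      (fun q hq => (hCB (hNC hq)).2.2.2.2) hd hdE
  · rw [himg]
    rintro d' hd' _ ⟨q, hq, rfl⟩
    rw [H.eq_of_isEikonalSolution hh hΨ hν (hNW₁.trans hW₁S) hE₂ hd' hq, hdE q (hNW₁ hq)]
  · intro q hq
    rw [hdφ q (hCB (hNC hq)).1, sub_self, abs_zero, zero_mul]
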